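/- Let $d\ge 1$, $\alpha>0$, $\nu\ge 0$ (unpinned if $\nu=0$), $\gamma>0$, $T>0$ and $0<\underline m\le\overline m$. Let $\{m_x\}_{x\in\mathbb Z^d}$ be random masses with $\underline m\le m_x\le\overline m$ almost surely for every $x$. For $N\ge 1$ let $\mathbb T_N^d$ be the discrete torus, its sites identified with $\{0,\dots,N-1\}^d$, and consider on $(q_x,p_x)_{x\in\mathbb T_N^d}\in(\mathbb R^d\times\mathbb R^d)^{\mathbb T_N^d}$ the Hamiltonian $$\mathcal H_N=\sum_{x}\Big[\frac{|p_x|^2}{2m_x}+\nu|q_x|^2+\frac12\sum_{|y-x|=1}\alpha|q_x-q_y|^2\Big]$$ and the generator $$\mathcal L_N=\sum_x\{\partial_{p_x}\mathcal H_N\cdot\partial_{q_x}-\partial_{q_x}\mathcal H_N\cdot\partial_{p_x}\}+\frac{\gamma}{4}\sum_{i,j=1}^d\sum_{|x-z|=1}(X^{i,j}_{x,z})^2,\qquad X^{i,j}_{x,z}=\pi_z^j\partial_{\pi_x^i}-\pi_x^i\partial_{\pi_z^j},\quad \pi_x=\frac{p_x}{\sqrt{m_x}}.$$ Given the masses, let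 $\mathbb E_{N,T}$ be the expectation for the equilibrium dynamics: a continuous process that solves the martingale problem for $\mathcal L_N$ (test functions $C_c^\infty$) and is started from the Gibbs measure $Z_{N,T}^{-1}e^{-\mathcal H_N/T}\,dq\,dp$; if $\nu=0$ this measure is understood modulo common translations $q\mapsto q+c$ of all positions, i.e. as the law of $((q_x-q_0)_x,(p_x)_x)$ (the energy and the current below are invariant under these translations). Let $$\mathfrak J_{e_1}=\sum_{x\in\mathbb T_N^d}j^a_{x,x+e_1},\qquad j^a_{x,x+e_1}=-\frac12\sum_{j=1}^d 2\alpha\,(q^j_{x+e_1}-q^j_x)\Big(\frac{\pi^j_{x+e_1}}{\sqrt{m_{x+e_1}}}+\frac{\pi^j_x}{\sqrt{m_x}}\Big)$$ be the total Hamiltonian energy current in direction $e_1$, and put $$G_N(\lambda)=\int_0^\infty e^{-\lambda t}\,N^{-d}\,\mathbb E_{N,T}\big[\mathfrak J_{e_1}(t)\,\mathfrak J_{e_1}(0)\big]\,dt,\qquad \lambda>0.$$ Then there is a constant $C>0$, depending only on $d,\alpha,\nu,\gamma,T,\underline m,\overline m$ (in particular not on $\lambda$, on $N$ or on the realization of the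 masses), such that for almost every realization of the masses the expectation and the integral defining $G_N(\lambda)$ converge absolutely, $|G_N(\lambda)|\le C$ for all $N\ge1$ and $\lambda>0$, and $$C^{-1}\le\liminf_{\lambda\downarrow 0}\,\liminf_{N\to\infty}G_N(\lambda)\le\limsup_{\lambda\downarrow 0}\,\limsup_{N\to\infty}G_N(\lambda)\le C.$$ -/

import Mathlib

open MeasureTheory Filter Topology
open scoped NNReal ENNReal

noncomputable section

namespace NoisyChain

/-- The `d`-dimensional discrete torus of side length `N`. -/
abbrev Torus (d : ℕ) (N : ℕ+) : Type := Fin d → ZMod (N : ℕ)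

/-- The phase space: pairs `(q, p)`, where `q x j` and `p x j` are the `j`-th coordinates of the
displacement and of the momentum of the atom `x`. -/
abbrev Phase (d : ℕ) (N : ℕ+) : Type :=
  (Torus d N → Fin d → ℝ) × (Torus d N → Fin d → ℝ)

/-- The unit vector `e_k`, on the torus. -/
def unitVec {d : ℕ} {N : ℕ+} (k : Fin d) : Torus d N := Pi.single k 1

/-- Nearest neighbours on the torus, `|x - y| = 1`. -/
def Neighbor {d : ℕ} {N : ℕ+} (x y : Torus d N) : Prop :=
  x ≠ y ∧ ∃ k : Fin d, y = x + unitVec k ∨ x = y + unitVec k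

/-- The masses of the atoms of the torus: those of the mass field on `ℤ^d` at the sites of
`{0, …, N - 1}^d`. -/
def torusMass {d : ℕ} (N : ℕ+) (m : (Fin d → ℤ) → ℝ) (x : Torus d N) : ℝ :=
  m fun k => ((x k).val : ℤ)

/-- The (harmonic) interaction potential. -/
def interaction (α : ℝ) (r : ℝ) : ℝ := α * r ^ 2

/-- The (harmonic) pinning potential. -/
def pinning (ν : ℝ) (r : ℝ) : ℝ := ν * r ^ 2

section

variable {d : ℕ} {N : ℕ+}

open Classical in
/-- The Hamiltonian
`∑_x [ |p_x|² / (2 m_x) + W(q_x) + (1/2) ∑_{|y - x| = 1} V(q_x - q_y) ]`. -/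
def hamiltonian (α ν : ℝ) (M : Torus d N → ℝ) (ω : Phase d N) : ℝ :=
  ∑ x, ((∑ j, ω.2 x j ^ 2) / (2 * M x) + ∑ j, pinning ν (ω.1 x j)
    + 1 / 2 * ∑ y with Neighbor x y, ∑ j, interaction α (ω.1 x j - ω.1 y j))

/-- The partial derivative with respect to `q_x^j`. -/
def dq (x : Torus d N) (j : Fin d) (f : Phase d N → ℝ) (ω : Phase d N) : ℝ :=
  fderiv ℝ f ω (Pi.single x (Pi.single j 1), 0)

/-- The partial derivative with respect to `p_x^j`. -/
def dp (x : Torus d N) (j : Fin d) (f : Phase d N → ℝ) (ω : Phase d N) : ℝ :=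
  fderiv ℝ f ω (0, Pi.single x (Pi.single j 1))

/-- The Liouville operator `∑_x { ∂_{p_x} H · ∂_{q_x} - ∂_{q_x} H · ∂_{p_x} }`. -/
def liouville (α ν : ℝ) (M : Torus d N → ℝ) (f : Phase d N → ℝ) (ω : Phase d N) : ℝ :=
  ∑ x, ∑ j, (dp x j (hamiltonian α ν M) ω * dq x j f ω
    - dq x j (hamiltonian α ν M) ω * dp x j f ω)

/-- The rescaled momentum `π_x^i = p_x^i / √m_x`. -/
def rmom (M : Torus d N → ℝ) (x : Torus d N) (i : Fin d) (ω : Phase d N) : ℝ :=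
  ω.2 x i / √(M x)

/-- The partial derivative with respect to `π_x^i`, that is, `√m_x ∂_{p_x^i}`. -/
def dRmom (M : Torus d N → ℝ) (x : Torus d N) (i : Fin d) (f : Phase d N → ℝ)
    (ω : Phase d N) : ℝ :=
  √(M x) * dp x i f ω

/-- The vector field `X^{i,j}_{x,z} = π_z^j ∂_{π_x^i} - π_x^i ∂_{π_z^j}`. -/
def noiseField (M : Torus d N → ℝ) (i j : Fin d) (x z : Torus d N) (f : Phase d N → ℝ)
    (ω : Phase d N) : ℝ :=
  rmom M z j ω * dRmom M x i f ω - rmom M x i ω * dRmom M z j f ω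

open Classical in
/-- The generator `(1/4) ∑_{i,j} ∑_{|x - z| = 1} (X^{i,j}_{x,z})²` of the energy conserving
noise. -/
def noise (M : Torus d N → ℝ) (f : Phase d N → ℝ) (ω : Phase d N) : ℝ :=
  1 / 4 * ∑ i, ∑ j, ∑ x, ∑ z with Neighbor x z,
    noiseField M i j x z (noiseField M i j x z f) ω

/-- The generator of the dynamics, Liouville operator plus `γ` times the noise. -/
def generator (α ν γ : ℝ) (M : Torus d N → ℝ) (f : Phase d N → ℝ) (ω : Phase d N) : ℝ :=
  liouville α ν M f ω + γ * noise M f ω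

/-- The Hamiltonian part `j^a_{x, x + e_k}` of the instantaneous energy current. -/
def current (α : ℝ) (M : Torus d N → ℝ) (k : Fin d) (x : Torus d N) (ω : Phase d N) : ℝ :=
  -(1 / 2) * ∑ j, deriv (interaction α) (ω.1 (x + unitVec k) j - ω.1 x j)
    * (rmom M (x + unitVec k) j ω / √(M (x + unitVec k)) + rmom M x j ω / √(M x))

/-- The total Hamiltonian current `𝔍_{e_1}` in the first direction. -/
def totalCurrent [NeZero d] (α : ℝ) (M : Torus d N → ℝ) (ω : Phase d N) : ℝ :=
  ∑ x, current α M 0 x ω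

open Classical in
/-- The reference measure `dq dp`. Without pinning the energy is invariant under the translations
`q ↦ q + c` and `exp (-H / T) dq dp` has infinite mass, so that the Gibbs measure lives on the
configurations modulo these translations; they are represented by the configurations with
`q_0 = 0`. -/
def refMeasure (d : ℕ) (N : ℕ+) (ν : ℝ) : Measure (Phase d N) :=
  (Measure.pi fun x : Torus d N =>
    if ν = 0 ∧ x = 0 then Measure.dirac (0 : Fin d → ℝ) else volume).prod volume

/-- The Gibbs measure `Z⁻¹ exp (-H / T) dq dp` at temperature `T` (modulo translations of `q` if
`ν = 0`). -/
def gibbs (α ν T : ℝ) (M : Torus d N → ℝ) : Measure (Phase d N) :=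
  (∫⁻ ω, ENNReal.ofReal (Real.exp (-hamiltonian α ν M ω / T)) ∂refMeasure d N ν)⁻¹ •
    (refMeasure d N ν).withDensity
      fun ω => ENNReal.ofReal (Real.exp (-hamiltonian α ν M ω / T))

open Classical in
/-- The representative of a phase point on which `gibbs` lives: without pinning, the one with
`q_0 = 0` in its class modulo translations of `q`; with pinning, the point itself. -/
def gauge (ν : ℝ) (ω : Phase d N) : Phase d N :=
  if ν = 0 then (fun x => ω.1 x - ω.1 0, ω.2) else ω

/-- `X` is the equilibrium dynamics: a continuous process whose initial law is the Gibbs measure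
(modulo translations of `q` if `ν = 0`) and which solves the martingale problem for the
generator. -/
structure IsEquilibriumDynamics (α ν γ T : ℝ) (M : Torus d N → ℝ) {Ω : Type*}
    [MeasurableSpace Ω] (ℙ : Measure Ω) (X : ℝ≥0 → Ω → Phase d N) : Prop where
  measurable : ∀ t, Measurable (X t)
  continuous : ∀ ω, Continuous fun t => X t ω
  initial : ℙ.map (fun ω => gauge ν (X 0 ω)) = gibbs α ν T M
  martingale : ∃ ℱ : Filtration ℝ≥0 (inferInstance : MeasurableSpace Ω),
    (∀ t, Measurable[ℱ t] (X t)) ∧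
    ∀ f : Phase d N → ℝ, ContDiff ℝ (⊤ : ℕ∞) f → HasCompactSupport f →
      Martingale (fun t ω => f (X t ω) - f (X 0 ω)
        - ∫ s in (0 : ℝ)..t, generator α ν γ M f (X s.toNNReal ω)) ℱ ℙ

/-- The equilibrium correlation `𝔼[𝔍_{e_1}(t) 𝔍_{e_1}(0)]`. -/
def correlation [NeZero d] (α : ℝ) (M : Torus d N → ℝ) {Ω : Type*} [MeasurableSpace Ω]
    (ℙ : Measure Ω) (X : ℝ≥0 → Ω → Phase d N) (t : ℝ≥0) : ℝ :=
  ∫ ω, totalCurrent α M (X t ω) * totalCurrent α M (X 0 ω) ∂ℙ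

/-- The finite volume Green–Kubo quantity
`∫_0^∞ e^{-λt} N^{-d} 𝔼[𝔍_{e_1}(t) 𝔍_{e_1}(0)] dt`. -/
def greenKubo [NeZero d] (α : ℝ) (M : Torus d N → ℝ) {Ω : Type*} [MeasurableSpace Ω]
    (ℙ : Measure Ω) (X : ℝ≥0 → Ω → Phase d N) (lam : ℝ) : ℝ :=
  ∫ t in Set.Ioi (0 : ℝ),
    Real.exp (-lam * t) * (((N : ℕ) : ℝ) ^ d)⁻¹ * correlation α M ℙ X t.toNNReal

end

end NoisyChain

end

/-! The energy is a positive semidefinite quadratic form and the noise rotates rescaled momenta, so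
the problem reduces to finite dimensional linear algebra. `exists_energy_coordinates` gives a linear
surjection `Z` onto a Euclidean space in which the energy is half the squared norm. There the Gibbs
measure is a centred Gaussian of variance `T` (`map_gibbs`), and the Hamiltonian field and all noise
fields are antisymmetric matrices `A` and `X b`. Quadratic functions are preserved by the generator,
which acts on their matrices as `B ↦ [B, A] + κ ∑ [[B, X b], X b]` with `κ = γ / 4`. If `u` solves
the resolvent equation for the matrix `J` of the current, the Laplace transform of the correlation
is exactly `2 T² ⟨u, J⟩` in the Frobenius product (`laplace_corr`, `corr_zero`). It remains to show
that `⟨u, J⟩` is of order `N ^ d`.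

Let `D` be the Dirichlet form of the noise at `u`. Pairing the resolvent equation with `u` removes
the antisymmetric drift and gives `κ D ≤ ⟨u, J⟩`. After summation by parts the current is a sum of
products of a rescaled momentum `e a` and a symmetric position difference `w a`, where the `e a` are
orthonormal and orthogonal to every `w b`. Each such product is a commutator with a noise rotation,
so `⟨J, u⟩² ≤ K N^d D`; together these give the upper bound.

For the lower bound the equation is tested against the form `∑ p_x · (q_{x+e₁} - q_{x-e₁})`. The
drift applied to it has no position part, since by translation invariance the total force is
orthogonal to the symmetric gradient. What is left is a combination of the products `p_x ·
p_{x+e₁}`, again commutators with noise rotations. Hence every term of the tested equation is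
controlled by the square root of `N^d D`, whereas the pairing of the trial form with `J` is of order
`N^d` because the masses cancel in it (`resolvent_bounds`). All estimates are deterministic in the
masses.

The martingale problem only provides compactly supported test functions. Cutoffs extend it to
bounded functions such as `exp (-|Z|²)`, which yields almost sure conservation of energy; then
quadratic functions damped by this factor can be used, and the damping is constant along paths and
can be divided out (`corr_eq`). -/

namespace NoisyChain

/-! ### The generator as an operator on matrices. -/

section FrobeniusProduct

variable {ι β : Type*} [Fintype ι]

/-- The Frobenius inner product of two square matrices. -/
def frob (B C : Matrix ι ι ℝ) : ℝ := ∑ i, ∑ j, B i j * C i j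

/-- The commutator of two square matrices. -/
def comm (B X : Matrix ι ι ℝ) : Matrix ι ι ℝ := B * X - X * B

theorem frob_eq_trace (B C : Matrix ι ι ℝ) : frob B C = (B.transpose * C).trace := by
  simp only [frob, Matrix.trace, Matrix.diag, Matrix.mul_apply, Matrix.transpose_apply]
  exact Finset.sum_comm

theorem frob_comm (B C : Matrix ι ι ℝ) : frob B C = frob C B := by
  simp only [frob, mul_comm]

theorem frob_add_right (B C D : Matrix ι ι ℝ) : frob B (C + D) = frob B C + frob B D := by
  simp only [frob, Matrix.add_apply, mul_add, Finset.sum_add_distrib]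

theorem frob_smul_right (c : ℝ) (B C : Matrix ι ι ℝ) : frob B (c • C) = c * frob B C := by
  simp only [frob, Matrix.smul_apply, smul_eq_mul, Finset.mul_sum]
  exact Finset.sum_congr rfl fun i _ => Finset.sum_congr rfl fun j _ => by ring

theorem frob_neg_right (B C : Matrix ι ι ℝ) : frob B (-C) = -frob B C := by
  simp [frob]

theorem frob_sub_right (B C D : Matrix ι ι ℝ) : frob B (C - D) = frob B C - frob B D := by
  simp only [frob, Matrix.sub_apply, mul_sub, Finset.sum_sub_distrib]

theorem frob_sum_right (s : Finset β) (B : Matrix ι ι ℝ) (C : β → Matrix ι ι ℝ) :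
    frob B (∑ b ∈ s, C b) = ∑ b ∈ s, frob B (C b) := by
  classical
  induction s using Finset.induction_on with
  | empty => simp [frob]
  | insert b s hb ih => rw [Finset.sum_insert hb, Finset.sum_insert hb, frob_add_right, ih]

theorem frob_add_left (B C D : Matrix ι ι ℝ) : frob (B + C) D = frob B D + frob C D := by
  rw [frob_comm, frob_add_right, frob_comm D, frob_comm D]

theorem frob_sub_left (B C D : Matrix ι ι ℝ) : frob (B - C) D = frob B D - frob C D := by
  rw [frob_comm, frob_sub_right, frob_comm D, frob_comm D]

theorem frob_smul_left (c : ℝ) (B C : Matrix ι ι ℝ) : frob (c • B) C = c * frob B C := by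
  rw [frob_comm, frob_smul_right, frob_comm]

theorem frob_sum_left (s : Finset β) (C : β → Matrix ι ι ℝ) (B : Matrix ι ι ℝ) :
    frob (∑ b ∈ s, C b) B = ∑ b ∈ s, frob (C b) B := by
  rw [frob_comm, frob_sum_right]
  exact Finset.sum_congr rfl fun b _ => frob_comm _ _

theorem frob_self_nonneg (B : Matrix ι ι ℝ) : 0 ≤ frob B B :=
  Finset.sum_nonneg fun _ _ => Finset.sum_nonneg fun _ _ => mul_self_nonneg _

theorem eq_zero_of_frob_self_le {B : Matrix ι ι ℝ} (h : frob B B ≤ 0) : B = 0 := by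
  have h0 : ∑ i, ∑ j, B i j * B i j = 0 := le_antisymm h (frob_self_nonneg B)
  ext i j
  have h1 := (Finset.sum_eq_zero_iff_of_nonneg (fun i _ => Finset.sum_nonneg
    fun j _ => mul_self_nonneg (B i j))).1 h0 i (Finset.mem_univ _)
  have h2 := (Finset.sum_eq_zero_iff_of_nonneg (fun j _ => mul_self_nonneg (B i j))).1 h1 j
    (Finset.mem_univ _)
  exact mul_self_eq_zero.1 h2

theorem sum_frob_sq_le (s : Finset β) (B C : β → Matrix ι ι ℝ) :
    (∑ b ∈ s, frob (B b) (C b)) ^ 2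
      ≤ (∑ b ∈ s, frob (B b) (B b)) * ∑ b ∈ s, frob (C b) (C b) := by
  have key : ∀ E F : β → Matrix ι ι ℝ, ∑ b ∈ s, frob (E b) (F b)
      = ∑ p ∈ s ×ˢ (Finset.univ : Finset (ι × ι)),
        E p.1 p.2.1 p.2.2 * F p.1 p.2.1 p.2.2 := by
    intro E F
    rw [Finset.sum_product]
    exact Finset.sum_congr rfl fun b _ => by rw [frob, Fintype.sum_prod_type]
  rw [key, key, key]
  simpa only [sq] using Finset.sum_mul_sq_le_sq_mul_sq (s ×ˢ (Finset.univ : Finset (ι × ι)))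
    (fun p => B p.1 p.2.1 p.2.2) (fun p => C p.1 p.2.1 p.2.2)

/-- Commuting with an antisymmetric matrix is the derivative of an orthogonal conjugation, which
preserves the Frobenius product. The computation is cyclicity of the trace. -/
theorem frob_comm_right {X : Matrix ι ι ℝ} (hX : X.transpose = -X) (B C : Matrix ι ι ℝ) :
    frob B (comm C X) = -frob (comm B X) C := by
  simp only [frob_eq_trace, comm, Matrix.transpose_sub, Matrix.transpose_mul, hX]
  simp only [Matrix.mul_sub, Matrix.sub_mul, Matrix.trace_sub, Matrix.neg_mul, Matrix.mul_neg,
    Matrix.trace_neg]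
  rw [Matrix.trace_mul_comm (X * B.transpose) C, ← Matrix.mul_assoc C,
    Matrix.trace_mul_comm (C * X), ← Matrix.mul_assoc B.transpose C,
    ← Matrix.mul_assoc B.transpose X]
  rw [Matrix.mul_assoc]
  ring

theorem frob_comm_self {X : Matrix ι ι ℝ} (hX : X.transpose = -X) (B : Matrix ι ι ℝ) :
    frob B (comm B X) = 0 := by
  have h := frob_comm_right hX B B
  rw [frob_comm (comm B X)] at h
  linarith

theorem frob_transpose (B C : Matrix ι ι ℝ) :
    frob B.transpose C.transpose = frob B C := by
  simp only [frob, Matrix.transpose_apply]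
  exact Finset.sum_comm

theorem frob_vecMulVec_left (a b : ι → ℝ) (C : Matrix ι ι ℝ) :
    frob (Matrix.vecMulVec a b) C = a ⬝ᵥ C.mulVec b := by
  simp only [frob, Matrix.vecMulVec_apply, dotProduct, Matrix.mulVec, Finset.mul_sum]
  exact Finset.sum_congr rfl fun i _ => Finset.sum_congr rfl fun j _ => by ring

theorem frob_vecMulVec (a b c d : ι → ℝ) :
    frob (Matrix.vecMulVec a b) (Matrix.vecMulVec c d) = (a ⬝ᵥ c) * (b ⬝ᵥ d) := by
  rw [frob_vecMulVec_left, Matrix.vecMulVec_mulVec]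
  simp only [dotProduct, Finset.sum_mul, Finset.mul_sum, Pi.smul_apply, MulOpposite.smul_eq_mul_unop,
    MulOpposite.unop_op]
  rw [Finset.sum_comm]
  exact Finset.sum_congr rfl fun i _ => Finset.sum_congr rfl fun j _ => by ring

theorem vecMulVec_mul_vecMulVec_eq (a b c d : ι → ℝ) :
    Matrix.vecMulVec a b * Matrix.vecMulVec c d = (b ⬝ᵥ c) • Matrix.vecMulVec a d := by
  ext i j
  simp only [Matrix.mul_apply, Matrix.vecMulVec_apply, Matrix.smul_apply, smul_eq_mul, dotProduct,
    Finset.sum_mul]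
  exact Finset.sum_congr rfl fun k _ => by ring

/-- The matrix generator: the action of `A + κ ∑_b X_b²` on quadratic forms. -/
def genMat (κ : ℝ) (s : Finset β) (A : Matrix ι ι ℝ) (X : β → Matrix ι ι ℝ) (B : Matrix ι ι ℝ) :
    Matrix ι ι ℝ :=
  comm B A + κ • ∑ b ∈ s, comm (comm B (X b)) (X b)

/-- Moving one commutator to the other factor turns the noise into its Dirichlet form. -/
theorem frob_genMat (κ : ℝ) (s : Finset β) {A : Matrix ι ι ℝ} {X : β → Matrix ι ι ℝ}
    (hA : A.transpose = -A) (hX : ∀ b, (X b).transpose = -X b) (C B : Matrix ι ι ℝ) :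
    frob C (genMat κ s A X B)
      = -frob (comm C A) B - κ * ∑ b ∈ s, frob (comm C (X b)) (comm B (X b)) := by
  rw [genMat, frob_add_right, frob_smul_right, frob_sum_right, frob_comm_right hA,
    Finset.sum_congr rfl fun b _ => frob_comm_right (hX b) C (comm B (X b)),
    Finset.sum_neg_distrib]
  ring

theorem frob_genMat_self (κ : ℝ) (s : Finset β) {A : Matrix ι ι ℝ} {X : β → Matrix ι ι ℝ}
    (hA : A.transpose = -A) (hX : ∀ b, (X b).transpose = -X b) (B : Matrix ι ι ℝ) :
    frob B (genMat κ s A X B) = -(κ * ∑ b ∈ s, frob (comm B (X b)) (comm B (X b))) := by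
  rw [frob_genMat κ s hA hX, frob_comm (comm B A), frob_comm_self hA]
  ring

theorem comm_add_left (B C X : Matrix ι ι ℝ) : comm (B + C) X = comm B X + comm C X := by
  simp only [comm, Matrix.add_mul, Matrix.mul_add]
  abel

theorem comm_smul_left (c : ℝ) (B X : Matrix ι ι ℝ) : comm (c • B) X = c • comm B X := by
  simp only [comm, Matrix.smul_mul, Matrix.mul_smul, smul_sub]

/-- `genMat` as a linear map. -/
def genMatLin (κ : ℝ) (s : Finset β) (A : Matrix ι ι ℝ) (X : β → Matrix ι ι ℝ) :
    Matrix ι ι ℝ →ₗ[ℝ] Matrix ι ι ℝ where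
  toFun := genMat κ s A X
  map_add' B C := by
    simp only [genMat, comm_add_left, Finset.sum_add_distrib, smul_add]
    abel
  map_smul' c B := by
    simp only [genMat, comm_smul_left, ← Finset.smul_sum, smul_add, RingHom.id_apply]
    rw [smul_comm]

/-- The generator is dissipative for the Frobenius product, so `lam` minus the generator is
injective, hence surjective in finite dimension. -/
theorem exists_resolvent {κ lam : ℝ} (hκ : 0 ≤ κ) (hlam : 0 < lam) (s : Finset β)
    {A : Matrix ι ι ℝ} {X : β → Matrix ι ι ℝ}
    (hA : A.transpose = -A) (hX : ∀ b, (X b).transpose = -X b) (J : Matrix ι ι ℝ) :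
    ∃ u, lam • u - genMat κ s A X u = J := by
  have hinj : Function.Injective
      (lam • (LinearMap.id : Matrix ι ι ℝ →ₗ[ℝ] Matrix ι ι ℝ) - genMatLin κ s A X) := by
    rw [injective_iff_map_eq_zero]
    intro u hu
    have hu' : lam • u - genMat κ s A X u = 0 := hu
    apply eq_zero_of_frob_self_le
    have h1 : frob u (lam • u - genMat κ s A X u) = 0 := by rw [hu']; simp [frob]
    rw [frob_sub_right, frob_smul_right, frob_genMat_self κ s hA hX] at h1
    have h2 : 0 ≤ κ * ∑ b ∈ s, frob (comm u (X b)) (comm u (X b)) :=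
      mul_nonneg hκ (Finset.sum_nonneg fun _ _ => frob_self_nonneg _)
    by_contra! h3
    have := mul_pos hlam h3
    linarith
  obtain ⟨u, hu⟩ := LinearMap.injective_iff_surjective.1 hinj J
  exact ⟨u, hu⟩

end FrobeniusProduct

/-! ### Resolvent estimates for products of momenta and position differences. -/

section Orthonormal

open Matrix

variable {ι α : Type*} [Fintype ι] [Fintype α] [DecidableEq α]

/-- The rotation generator in the plane of `e a` and `e b`. -/
def rotMat (e : α → ι → ℝ) (a b : α) : Matrix ι ι ℝ :=
  vecMulVec (e a) (e b) - vecMulVec (e b) (e a)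

/-- The symmetrized product of two linear forms. -/
def symProd (a b : ι → ℝ) : Matrix ι ι ℝ := vecMulVec a b + vecMulVec b a

/-- The matrix of the quadratic form `∑ c_a (e_a · z) (w_a · z)`. -/
noncomputable def crossMat (e w : α → ι → ℝ) (c : α → ℝ) : Matrix ι ι ℝ :=
  (1 / 2 : ℝ) • ∑ a, c a • symProd (e a) (w a)

omit [Fintype ι] [Fintype α] [DecidableEq α] in
theorem rotMat_transpose (e : α → ι → ℝ) (a b : α) : (rotMat e a b)ᵀ = -rotMat e a b := by
  simp [rotMat, transpose_vecMulVec]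

omit [Fintype ι] in
theorem symProd_transpose (a b : ι → ℝ) : (symProd a b)ᵀ = symProd a b := by
  rw [symProd, transpose_add, transpose_vecMulVec, transpose_vecMulVec, add_comm]

omit [DecidableEq α] [Fintype ι] in
theorem crossMat_transpose (e w : α → ι → ℝ) (c : α → ℝ) :
    (crossMat e w c)ᵀ = crossMat e w c := by
  simp only [crossMat, transpose_smul, transpose_sum, symProd_transpose]

theorem frob_symProd (a b c d : ι → ℝ) :
    frob (symProd a b) (symProd c d) = 2 * ((a ⬝ᵥ c) * (b ⬝ᵥ d) + (a ⬝ᵥ d) * (b ⬝ᵥ c)) := by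
  simp only [symProd, frob_add_left, frob_add_right, frob_vecMulVec]
  ring

theorem dotProduct_symProd_mulVec (a b z : ι → ℝ) :
    z ⬝ᵥ (symProd a b *ᵥ z) = 2 * ((a ⬝ᵥ z) * (b ⬝ᵥ z)) := by
  simp only [symProd, add_mulVec, vecMulVec_mulVec, dotProduct_add]
  simp only [dotProduct, Pi.smul_apply, MulOpposite.smul_eq_mul_unop, MulOpposite.unop_op,
    ← mul_assoc, ← Finset.sum_mul]
  simp only [mul_comm (z _)]
  ring

omit [DecidableEq α] in
theorem dotProduct_crossMat_mulVec (e w : α → ι → ℝ) (c : α → ℝ) (z : ι → ℝ) :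
    z ⬝ᵥ (crossMat e w c *ᵥ z) = ∑ a, c a * ((e a ⬝ᵥ z) * (w a ⬝ᵥ z)) := by
  simp only [crossMat, smul_mulVec, sum_mulVec, dotProduct_smul, dotProduct_sum,
    dotProduct_symProd_mulVec, smul_eq_mul, Finset.mul_sum]
  exact Finset.sum_congr rfl fun a _ => by ring

variable {e w : α → ι → ℝ} (he : ∀ a b, e a ⬝ᵥ e b = if a = b then 1 else 0)
  (hw : ∀ a b, e a ⬝ᵥ w b = 0)

include he hw in
theorem frob_crossMat (c c' : α → ℝ) :
    frob (crossMat e w c) (crossMat e w c') = 1 / 2 * ∑ a, c a * c' a * (w a ⬝ᵥ w a) := by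
  simp only [crossMat, frob_smul_left, frob_smul_right, frob_sum_left, frob_sum_right,
    frob_symProd, he, hw]
  congr 1
  refine Finset.sum_congr rfl fun a _ => ?_
  rw [Finset.sum_eq_single a (fun b _ hb => by simp [hb]) (by simp)]
  simp only [if_true]
  ring

include hw in
omit [DecidableEq α] in
theorem trace_crossMat (c : α → ℝ) : (crossMat e w c).trace = 0 := by
  simp [crossMat, symProd, trace_sum, trace_smul, trace_vecMulVec, hw, dotProduct_comm (w _)]

include he hw in
omit [Fintype α] in
-- The rotation turns `e b` into `e a` up to sign and annihilates `w v`, which is orthogonal to its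
-- plane. This places every summand of the current in the range of a noise field.
theorem comm_symProd_rotMat {a b : α} (hab : a ≠ b) (v : α) :
    comm (symProd (e b) (w v)) (rotMat e a b) = -symProd (e a) (w v) := by
  have hw' : ∀ a b, w b ⬝ᵥ e a = 0 := fun a b => by rw [dotProduct_comm, hw]
  simp only [comm, symProd, rotMat, Matrix.add_mul, Matrix.mul_add, Matrix.sub_mul, Matrix.mul_sub,
    vecMulVec_mul_vecMulVec_eq, he, hw, hw', hab, hab.symm, if_true, if_false]
  simp only [one_smul, zero_smul, zero_sub, sub_zero, zero_add, add_zero]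
  abel

include he in
omit [Fintype α] in
-- Rotating the square of one momentum produces its product with another, so mixed momentum products
-- also lie in the range of the noise.
theorem comm_vecMulVec_rotMat {a b : α} (hab : a ≠ b) :
    comm (vecMulVec (e a) (e a)) (rotMat e a b) = symProd (e a) (e b) := by
  simp only [comm, symProd, rotMat, Matrix.sub_mul, Matrix.mul_sub,
    vecMulVec_mul_vecMulVec_eq, he, hab, hab.symm, if_true, if_false]
  simp

variable {s : Finset (α × α)} {σ : α → α}

omit [DecidableEq α] in
theorem sum_comm_rotMat_le (hσ : ∀ a, (a, σ a) ∈ s) (u : Matrix ι ι ℝ) :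
    ∑ a, frob (comm u (rotMat e a (σ a))) (comm u (rotMat e a (σ a)))
      ≤ ∑ b ∈ s, frob (comm u (rotMat e b.1 b.2)) (comm u (rotMat e b.1 b.2)) := by
  have hinj : Function.Injective fun a => (a, σ a) := fun a b h => congrArg Prod.fst h
  refine (Finset.sum_map Finset.univ ⟨_, hinj⟩ fun b : α × α =>
    frob (comm u (rotMat e b.1 b.2)) (comm u (rotMat e b.1 b.2))).symm.trans_le ?_
  refine Finset.sum_le_sum_of_subset_of_nonneg ?_ fun _ _ _ => frob_self_nonneg _
  intro p hp
  obtain ⟨a, -, rfl⟩ := Finset.mem_map.1 hp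
  exact hσ a

include he hw in
-- Each summand is a commutator with the rotation in the plane of `a` and `σ a`. Moving that
-- rotation onto `u` and applying Cauchy–Schwarz leaves the Dirichlet form; one partner `σ a` per
-- coordinate suffices.
theorem frob_crossMat_sq_le (hσ : ∀ a, (a, σ a) ∈ s) (hne : ∀ a, a ≠ σ a) (c : α → ℝ)
    (u : Matrix ι ι ℝ) :
    frob (crossMat e w c) u ^ 2 ≤ 1 / 2 * (∑ a, c a ^ 2 * (w a ⬝ᵥ w a)) *
      ∑ b ∈ s, frob (comm u (rotMat e b.1 b.2)) (comm u (rotMat e b.1 b.2)) := by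
  have h1 : frob (crossMat e w c) u = 1 / 2 *
      ∑ a, frob (c a • symProd (e (σ a)) (w a)) (comm u (rotMat e a (σ a))) := by
    rw [crossMat, frob_smul_left, frob_sum_left]
    congr 1
    refine Finset.sum_congr rfl fun a _ => ?_
    rw [frob_smul_left, frob_smul_left, frob_comm_right (rotMat_transpose e _ _),
      comm_symProd_rotMat he hw (hne a), frob_comm (-_), frob_neg_right, frob_comm u]
    ring
  have h2 := sum_frob_sq_le Finset.univ (fun a => c a • symProd (e (σ a)) (w a))
    (fun a => comm u (rotMat e a (σ a)))
  have h3 : ∑ a, frob (c a • symProd (e (σ a)) (w a)) (c a • symProd (e (σ a)) (w a))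
      = 2 * ∑ a, c a ^ 2 * (w a ⬝ᵥ w a) := by
    rw [Finset.mul_sum]
    refine Finset.sum_congr rfl fun a _ => ?_
    rw [frob_smul_left, frob_smul_right, frob_symProd, he, hw]
    simp only [if_true]
    ring
  have h4 := sum_comm_rotMat_le (e := e) hσ u
  have h5 : 0 ≤ ∑ a, c a ^ 2 * (w a ⬝ᵥ w a) := Finset.sum_nonneg fun a _ =>
    mul_nonneg (sq_nonneg _) (Finset.sum_nonneg fun _ _ => mul_self_nonneg _)
  rw [h3] at h2
  rw [h1]
  nlinarith [mul_le_mul_of_nonneg_left h4 h5]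

include he in
-- The same argument for products of neighbouring momenta, written as commutators of the squares `e
-- a ⊗ e a`. It controls the drift applied to the trial form.
theorem frob_sum_symProd_sq_le (hσ : ∀ a, (a, σ a) ∈ s) (hne : ∀ a, a ≠ σ a) (c : α → ℝ)
    (u : Matrix ι ι ℝ) :
    frob (crossMat e (fun a => e (σ a)) c) u ^ 2 ≤ 1 / 4 * (∑ a, c a ^ 2) *
      ∑ b ∈ s, frob (comm u (rotMat e b.1 b.2)) (comm u (rotMat e b.1 b.2)) := by
  have h1 : frob (crossMat e (fun a => e (σ a)) c) u = -(1 / 2) *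
      ∑ a, frob (c a • vecMulVec (e a) (e a)) (comm u (rotMat e a (σ a))) := by
    rw [crossMat, frob_smul_left, frob_sum_left, neg_mul, ← mul_neg, ← Finset.sum_neg_distrib]
    congr 1
    refine Finset.sum_congr rfl fun a _ => ?_
    rw [frob_smul_left, frob_smul_left, frob_comm_right (rotMat_transpose e _ _),
      comm_vecMulVec_rotMat he (hne a)]
    ring
  have h2 := sum_frob_sq_le Finset.univ (fun a => c a • vecMulVec (e a) (e a))
    (fun a => comm u (rotMat e a (σ a)))
  have h3 : ∑ a, frob (c a • vecMulVec (e a) (e a)) (c a • vecMulVec (e a) (e a))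
      = ∑ a, c a ^ 2 := by
    refine Finset.sum_congr rfl fun a _ => ?_
    rw [frob_smul_left, frob_smul_right, frob_vecMulVec, he]
    simp only [if_true]
    ring
  have h4 := sum_comm_rotMat_le (e := e) hσ u
  have h5 : 0 ≤ ∑ a, c a ^ 2 := Finset.sum_nonneg fun a _ => sq_nonneg _
  rw [h3] at h2
  rw [h1]
  nlinarith [mul_le_mul_of_nonneg_left h4 h5]

theorem frob_add_transpose_self_le (B : Matrix ι ι ℝ) :
    frob (B + Bᵀ) (B + Bᵀ) ≤ 4 * frob B B := by
  have h := frob_self_nonneg (B - Bᵀ)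
  simp only [frob_sub_left, frob_sub_right, frob_add_left, frob_add_right, frob_transpose] at h ⊢
  rw [frob_comm Bᵀ B] at h ⊢
  linarith

include he hw in
-- The commutator is `S + Sᵀ` with `S` the product of the two matrices, and orthogonality leaves in
-- `S` only the summands at `a` and `b`. The bound is thus local, and its sum over bonds is of the
-- order of the volume.
theorem frob_comm_crossMat_le {a b : α} (hab : a ≠ b) (c : α → ℝ) :
    frob (comm (crossMat e w c) (rotMat e a b)) (comm (crossMat e w c) (rotMat e a b))
      ≤ c a ^ 2 * (w a ⬝ᵥ w a) + c b ^ 2 * (w b ⬝ᵥ w b) := by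
  have hw' : ∀ a b, w b ⬝ᵥ e a = 0 := fun a b => by rw [dotProduct_comm, hw]
  have h1 : crossMat e w c * rotMat e a b =
      (1 / 2 : ℝ) • (c a • vecMulVec (w a) (e b) - c b • vecMulVec (w b) (e a)) := by
    rw [crossMat, Matrix.smul_mul, Finset.sum_mul]
    congr 1
    simp only [symProd, rotMat, Matrix.smul_mul, Matrix.add_mul, Matrix.mul_sub,
      vecMulVec_mul_vecMulVec_eq, he, hw', zero_smul, zero_add, ite_smul,
      one_smul, smul_ite, smul_zero, Finset.sum_sub_distrib, Finset.sum_ite_eq',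
      Finset.mem_univ, if_true]
  have h2 : comm (crossMat e w c) (rotMat e a b)
      = crossMat e w c * rotMat e a b + (crossMat e w c * rotMat e a b)ᵀ := by
    rw [comm, transpose_mul, rotMat_transpose, crossMat_transpose, Matrix.neg_mul, sub_eq_add_neg]
  rw [h2]
  refine (frob_add_transpose_self_le _).trans (le_of_eq ?_)
  rw [h1]
  simp only [frob_smul_left, frob_smul_right, frob_sub_left, frob_sub_right, frob_vecMulVec, he,
    hab, hab.symm, if_true, if_false]
  ring

/-- Two-sided bounds for the quadratic form of the resolvent of `A + κ ∑_b X_b²` at a current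
`J = crossMat e w c`, given a trial function `crossMat e w c'` whose image under `A` does not involve
the null space of the noise. -/
theorem resolvent_bounds {κ lam V K : ℝ} (hκ : 0 < κ) (hlam : 0 ≤ lam)
    {A : Matrix ι ι ℝ} (hA : Aᵀ = -A)
    (hs : ∀ b ∈ s, b.1 ≠ b.2) (hσ : ∀ a, (a, σ a) ∈ s)
    {c c' r : α → ℝ} (hr : comm (crossMat e w c') A = crossMat e (fun a => e (σ a)) r)
    (he : ∀ a b, e a ⬝ᵥ e b = if a = b then 1 else 0) (hw : ∀ a b, e a ⬝ᵥ w b = 0)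
    (hK : 0 ≤ K) (hV : 0 ≤ V)
    (hc : ∑ a, c a ^ 2 * (w a ⬝ᵥ w a) ≤ K * V) (hc' : ∑ a, c' a ^ 2 * (w a ⬝ᵥ w a) ≤ K * V)
    (hr' : ∑ a, r a ^ 2 ≤ K * V)
    (hs' : ∑ b ∈ s, (c' b.1 ^ 2 * (w b.1 ⬝ᵥ w b.1) + c' b.2 ^ 2 * (w b.2 ⬝ᵥ w b.2)) ≤ K * V)
    {u : Matrix ι ι ℝ}
    (hu : lam • u - genMat κ s A (fun b => rotMat e b.1 b.2) u = crossMat e w c) :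
    0 ≤ frob u (crossMat e w c) ∧ frob u (crossMat e w c) ≤ K / κ * V ∧
    frob (crossMat e w c') (crossMat e w c) ^ 2
      ≤ 3 * (lam ^ 2 + 1 + κ ^ 2) * K * V * (frob u (crossMat e w c) / κ) := by
  have hX : ∀ b : α × α, (rotMat e b.1 b.2)ᵀ = -rotMat e b.1 b.2 := fun b => rotMat_transpose e _ _
  have hne : ∀ a, a ≠ σ a := fun a => hs _ (hσ a)
  set D := ∑ b ∈ s, frob (comm u (rotMat e b.1 b.2)) (comm u (rotMat e b.1 b.2)) with hD
  set Q := frob u (crossMat e w c) with hQ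
  have hD0 : 0 ≤ D := Finset.sum_nonneg fun _ _ => frob_self_nonneg _
  have hKV : 0 ≤ K * V := mul_nonneg hK hV
  -- Pairing the resolvent equation with `u` itself; the drift drops out by antisymmetry.
  have hQD : κ * D ≤ Q := by
    have h : Q = lam * frob u u + κ * D := by
      rw [hQ, ← hu, frob_sub_right, frob_smul_right, frob_genMat_self κ s hA hX]
      ring
    rw [h]
    nlinarith [mul_nonneg hlam (frob_self_nonneg u)]
  have hQ0 : 0 ≤ Q := (mul_nonneg hκ.le hD0).trans hQD
  have hDQ : D ≤ Q / κ := by rw [le_div_iff₀ hκ]; linarith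
  have h1 : ∀ c : α → ℝ, ∑ a, c a ^ 2 * (w a ⬝ᵥ w a) ≤ K * V →
      frob (crossMat e w c) u ^ 2 ≤ K * V * D := by
    intro c hc
    refine (frob_crossMat_sq_le he hw hσ hne c u).trans ?_
    refine mul_le_mul_of_nonneg_right ?_ hD0
    have : 0 ≤ ∑ a, c a ^ 2 * (w a ⬝ᵥ w a) := Finset.sum_nonneg fun a _ =>
      mul_nonneg (sq_nonneg _) (Finset.sum_nonneg fun _ _ => mul_self_nonneg _)
    linarith
  refine ⟨hQ0, ?_, ?_⟩
  · have h2 := h1 c hc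
    rw [frob_comm, ← hQ] at h2
    have h3 : Q ^ 2 ≤ K * V * (Q / κ) := h2.trans (mul_le_mul_of_nonneg_left hDQ hKV)
    rcases hQ0.eq_or_lt with h | h
    · rw [← h]; positivity
    · have h4 : Q * Q ≤ (K / κ * V) * Q := by
        calc Q * Q = Q ^ 2 := by ring
          _ ≤ _ := h3
          _ = _ := by ring
      exact le_of_mul_le_mul_right h4 h
  · have h2 := h1 c' hc'
    have h3 : frob (comm (crossMat e w c') A) u ^ 2 ≤ K * V * D := by
      rw [hr]
      refine (frob_sum_symProd_sq_le he hσ hne r u).trans ?_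
      refine mul_le_mul_of_nonneg_right ?_ hD0
      have : 0 ≤ ∑ a, r a ^ 2 := Finset.sum_nonneg fun a _ => sq_nonneg _
      linarith
    set E := ∑ b ∈ s, frob (comm (crossMat e w c') (rotMat e b.1 b.2))
      (comm u (rotMat e b.1 b.2)) with hE
    have h4 : E ^ 2 ≤ K * V * D := by
      refine (sum_frob_sq_le s _ _).trans (mul_le_mul_of_nonneg_right ?_ hD0)
      exact (Finset.sum_le_sum fun b hb => frob_comm_crossMat_le he hw (hs b hb) c').trans hs'
    -- The resolvent equation paired with the trial form: each of the three terms has already been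
    -- bounded through `D`.
    have h5 : frob (crossMat e w c') (crossMat e w c) =
        lam * frob (crossMat e w c') u + frob (comm (crossMat e w c') A) u + κ * E := by
      rw [← hu, frob_sub_right, frob_smul_right, frob_genMat κ s hA hX]
      ring
    have h6 : frob (crossMat e w c') (crossMat e w c) ^ 2
        ≤ 3 * (lam ^ 2 + 1 + κ ^ 2) * (K * V * D) := by
      rw [h5]
      set x := frob (crossMat e w c') u
      set y := frob (comm (crossMat e w c') A) u
      have : (lam * x + y + κ * E) ^ 2 ≤ 3 * (lam ^ 2 * x ^ 2 + y ^ 2 + κ ^ 2 * E ^ 2) := by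
        nlinarith [sq_nonneg (lam * x - y), sq_nonneg (lam * x - κ * E), sq_nonneg (y - κ * E)]
      nlinarith [mul_le_mul_of_nonneg_left h2 (sq_nonneg lam),
        mul_le_mul_of_nonneg_left h4 (sq_nonneg κ)]
    refine h6.trans ?_
    have h7 : K * V * D ≤ K * V * (Q / κ) := mul_le_mul_of_nonneg_left hDQ hKV
    calc 3 * (lam ^ 2 + 1 + κ ^ 2) * (K * V * D)
        ≤ 3 * (lam ^ 2 + 1 + κ ^ 2) * (K * V * (Q / κ)) :=
          mul_le_mul_of_nonneg_left h7 (by positivity)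
      _ = _ := by ring

end Orthonormal

/-! ### Fourth moments of Gaussian product measures. -/

section GaussianMoments

open ProbabilityTheory

theorem hasDerivAt_mul_gaussian_mgf (v : ℝ) {p : ℝ → ℝ} {p' t : ℝ} (hp : HasDerivAt p p' t) :
    HasDerivAt (fun t => p t * Real.exp (v * t ^ 2 / 2))
      ((p' + p t * (v * t)) * Real.exp (v * t ^ 2 / 2)) t := by
  have h : HasDerivAt (fun t : ℝ => v * t ^ 2 / 2) (v * t) t := by
    refine (((hasDerivAt_pow 2 t).const_mul v).div_const 2).congr_deriv ?_
    push_cast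
    ring
  refine (hp.mul h.exp).congr_deriv ?_
  ring

/-- The fourth derivative at zero of the moment generating function `exp (v t² / 2)`; every
derivative is a polynomial times this exponential. -/
theorem integral_pow_four_gaussianReal (v : ℝ≥0) :
    ∫ x, x ^ 4 ∂gaussianReal 0 v = 3 * (v : ℝ) ^ 2 := by
  have h := iteratedDeriv_mgf_zero (X := id) (μ := gaussianReal 0 v)
    (by rw [integrableExpSet_id_gaussianReal]; simp) 4
  have h1 : ∫ x, ((id : ℝ → ℝ) ^ 4) x ∂gaussianReal 0 v = ∫ x, x ^ 4 ∂gaussianReal 0 v := rfl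
  rw [← h1, ← h, mgf_id_gaussianReal]
  have e0 : (fun t : ℝ => Real.exp ((0 : ℝ) * t + v * t ^ 2 / 2))
      = fun t => 1 * Real.exp (v * t ^ 2 / 2) := by
    funext t; simp
  have e1 : deriv (fun t : ℝ => 1 * Real.exp ((v : ℝ) * t ^ 2 / 2))
      = fun t => (v * t) * Real.exp (v * t ^ 2 / 2) := by
    funext t
    rw [(hasDerivAt_mul_gaussian_mgf v (hasDerivAt_const t (1 : ℝ))).deriv]
    ring
  have e2 : deriv (fun t : ℝ => ((v : ℝ) * t) * Real.exp (v * t ^ 2 / 2))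
      = fun t => (v + v ^ 2 * t ^ 2) * Real.exp (v * t ^ 2 / 2) := by
    funext t
    rw [(hasDerivAt_mul_gaussian_mgf v ((hasDerivAt_id' t).const_mul (v : ℝ))).deriv]
    ring
  have e3 : deriv (fun t : ℝ => ((v : ℝ) + v ^ 2 * t ^ 2) * Real.exp (v * t ^ 2 / 2))
      = fun t => (3 * v ^ 2 * t + v ^ 3 * t ^ 3) * Real.exp (v * t ^ 2 / 2) := by
    funext t
    rw [(hasDerivAt_mul_gaussian_mgf v
      (((hasDerivAt_pow 2 t).const_mul ((v : ℝ) ^ 2)).const_add (v : ℝ))).deriv]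
    push_cast
    ring
  have e4 : deriv (fun t : ℝ => (3 * (v : ℝ) ^ 2 * t + v ^ 3 * t ^ 3) *
      Real.exp (v * t ^ 2 / 2)) 0 = 3 * (v : ℝ) ^ 2 := by
    rw [(hasDerivAt_mul_gaussian_mgf v (p := fun t => 3 * (v : ℝ) ^ 2 * t + v ^ 3 * t ^ 3)
      (((hasDerivAt_id' (0 : ℝ)).const_mul (3 * (v : ℝ) ^ 2)).add
        ((hasDerivAt_pow 3 (0 : ℝ)).const_mul ((v : ℝ) ^ 3)))).deriv]
    simp
  rw [e0, iteratedDeriv_succ', iteratedDeriv_succ', iteratedDeriv_succ', iteratedDeriv_succ',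
    iteratedDeriv_zero, e1, e2, e3, e4]

theorem integral_pow_two_gaussianReal (v : ℝ≥0) :
    ∫ x, x ^ 2 ∂gaussianReal 0 v = v := by
  have h := variance_fun_id_gaussianReal (μ := 0) (v := v)
  rw [variance_of_integral_eq_zero (by fun_prop) (by simp [integral_id_gaussianReal])] at h
  exact h

theorem integrable_pow_gaussianReal (v : ℝ≥0) (k : ℕ) :
    Integrable (fun x : ℝ => x ^ k) (gaussianReal 0 v) := by
  simpa using (memLp_id_gaussianReal (μ := 0) (v := v) (k : ℝ≥0)).integrable_norm_pow'.mono'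
    (by fun_prop) (by simp)

variable {ι : Type*} [Fintype ι] [DecidableEq ι]

/-- The Gaussian product measure on `ι → ℝ` with variance `v`. -/
noncomputable def gaussianPi (ι : Type*) [Fintype ι] (v : ℝ≥0) : Measure (ι → ℝ) :=
  Measure.pi fun _ => gaussianReal 0 v

instance (v : ℝ≥0) : IsProbabilityMeasure (gaussianPi ι v) := by
  unfold gaussianPi; infer_instance

theorem monomial_eq_prod (z : ι → ℝ) (i j k l : ι) :
    z i * z j * z k * z l = ∏ m, z m ^ ((if m = i then 1 else 0) + (if m = j then 1 else 0)
      + (if m = k then 1 else 0) + if m = l then 1 else 0) := by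
  simp only [pow_add, Finset.prod_mul_distrib, pow_ite, pow_one, pow_zero, Finset.prod_ite_eq',
    Finset.mem_univ, if_true]

theorem integrable_monomial (v : ℝ≥0) (i j k l : ι) :
    Integrable (fun z : ι → ℝ => z i * z j * z k * z l) (gaussianPi ι v) := by
  simp only [monomial_eq_prod]
  exact Integrable.fintype_prod (f := fun m (x : ℝ) => x ^ ((if m = i then 1 else 0) +
    (if m = j then 1 else 0) + (if m = k then 1 else 0) + if m = l then 1 else 0))
    fun m => integrable_pow_gaussianReal v _

theorem integral_monomial (v : ℝ≥0) (i j k l : ι) :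
    ∫ z, z i * z j * z k * z l ∂gaussianPi ι v
      = ∏ m, ∫ x, x ^ ((if m = i then 1 else 0) + (if m = j then 1 else 0)
      + (if m = k then 1 else 0) + if m = l then 1 else 0) ∂gaussianReal 0 v := by
  simp only [monomial_eq_prod]
  exact integral_fintype_prod_eq_prod (fun m (x : ℝ) => x ^ ((if m = i then 1 else 0) +
    (if m = j then 1 else 0) + (if m = k then 1 else 0) + if m = l then 1 else 0))

/-- An index that occurs exactly once contributes a vanishing mean as a factor. -/
theorem integral_monomial_of_ne (v : ℝ≥0) {i j k l : ι} (hj : i ≠ j) (hk : i ≠ k) (hl : i ≠ l) :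
    ∫ z, z i * z j * z k * z l ∂gaussianPi ι v = 0 := by
  rw [integral_monomial]
  refine Finset.prod_eq_zero (Finset.mem_univ i) ?_
  simp [hj, hk, hl, integral_id_gaussianReal]

theorem integral_monomial_pair (v : ℝ≥0) {i k : ι} (hk : i ≠ k) :
    ∫ z, z i * z i * z k * z k ∂gaussianPi ι v = (v : ℝ) ^ 2 := by
  rw [integral_monomial]
  have h : ∀ m : ι, ∫ x, x ^ ((if m = i then 1 else 0) + (if m = i then 1 else 0)
      + (if m = k then 1 else 0) + if m = k then 1 else 0) ∂gaussianReal 0 v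
      = (if m = i then (v : ℝ) else 1) * if m = k then (v : ℝ) else 1 := by
    intro m
    by_cases h1 : m = i
    · subst h1
      simp [hk, integral_pow_two_gaussianReal]
    · by_cases h2 : m = k
      · subst h2
        simp [h1, integral_pow_two_gaussianReal]
      · simp [h1, h2]
  simp only [h, Finset.prod_mul_distrib, Finset.prod_ite_eq', Finset.mem_univ, if_true, sq]

theorem integral_monomial_self (v : ℝ≥0) (i : ι) :
    ∫ z, z i * z i * z i * z i ∂gaussianPi ι v = 3 * (v : ℝ) ^ 2 := by
  rw [integral_monomial, Finset.prod_eq_single i]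
  · simp [integral_pow_four_gaussianReal]
  · intro m _ hm
    simp [hm]
  · simp

/-- Isserlis' formula for fourth moments. -/
theorem isserlis (v : ℝ≥0) (i j k l : ι) :
    ∫ z, z i * z j * z k * z l ∂gaussianPi ι v = (v : ℝ) ^ 2 *
      ((if i = j then 1 else 0) * (if k = l then 1 else 0)
        + (if i = k then 1 else 0) * (if j = l then 1 else 0)
        + (if i = l then 1 else 0) * (if j = k then 1 else 0)) := by
  have perm : ∀ {f g : (ι → ℝ) → ℝ}, (∀ z, f z = g z) →
      ∫ z, f z ∂gaussianPi ι v = ∫ z, g z ∂gaussianPi ι v := fun h =>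
    integral_congr_ae (ae_of_all _ h)
  have h2 : ∀ i j k l : ι, j ≠ i → j ≠ k → j ≠ l →
      ∫ z, z i * z j * z k * z l ∂gaussianPi ι v = 0 := fun i j k l h1 h2 h3 =>
    (perm fun z => by ring).trans (integral_monomial_of_ne v h1 h2 h3)
  have h3 : ∀ i j k l : ι, k ≠ i → k ≠ j → k ≠ l →
      ∫ z, z i * z j * z k * z l ∂gaussianPi ι v = 0 := fun i j k l h1 h2 h3 =>
    (perm fun z => by ring).trans (integral_monomial_of_ne v h1 h2 h3)
  have h4 : ∀ i j k l : ι, l ≠ i → l ≠ j → l ≠ k →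
      ∫ z, z i * z j * z k * z l ∂gaussianPi ι v = 0 := fun i j k l h1 h2 h3 =>
    (perm fun z => by ring).trans (integral_monomial_of_ne v h1 h2 h3)
  rcases eq_or_ne i j with rfl | hij
  · rcases eq_or_ne k l with rfl | hkl
    · rcases eq_or_ne i k with rfl | hik
      · rw [integral_monomial_self]; simp; ring
      · rw [integral_monomial_pair v hik]; simp [hik]
    · rcases eq_or_ne i k with rfl | hik
      · rw [h4 _ _ _ _ hkl.symm hkl.symm hkl.symm]; simp [hkl]
      · rw [h3 _ _ _ _ hik.symm hik.symm hkl]; simp [hkl, hik]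
  · rcases eq_or_ne i k with rfl | hik
    · rcases eq_or_ne j l with rfl | hjl
      · rw [perm (g := fun z => z i * z i * z j * z j) fun z => by ring,
          integral_monomial_pair v hij]; simp [hij]
      · rw [h2 _ _ _ _ hij.symm hij.symm hjl]; simp [hij, hij.symm, hjl]
    · rcases eq_or_ne i l with rfl | hil
      · rcases eq_or_ne j k with rfl | hjk
        · rw [perm (g := fun z => z i * z i * z j * z j) fun z => by ring,
          integral_monomial_pair v hij]; simp [hij]
        · rw [h2 _ _ _ _ hij.symm hjk hij.symm]; simp [hij, hik, hjk]
      · rw [integral_monomial_of_ne v hij hik hil]; simp [hij, hik, hil]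

omit [DecidableEq ι] in
theorem dotProduct_mulVec_mul (B C : Matrix ι ι ℝ) (z : ι → ℝ) :
    (z ⬝ᵥ B.mulVec z) * (z ⬝ᵥ C.mulVec z)
      = ∑ i, ∑ j, ∑ k, ∑ l, (B i j * C k l) * (z i * z j * z k * z l) := by
  have h : ∀ B : Matrix ι ι ℝ, z ⬝ᵥ B.mulVec z = ∑ i, ∑ j, z i * (B i j * z j) := fun B => by
    simp only [dotProduct, Matrix.mulVec, Finset.mul_sum]
  rw [h, h, Finset.sum_mul]
  refine Finset.sum_congr rfl fun i _ => ?_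
  rw [Finset.sum_mul]
  refine Finset.sum_congr rfl fun j _ => ?_
  rw [Finset.mul_sum]
  refine Finset.sum_congr rfl fun k _ => ?_
  rw [Finset.mul_sum]
  exact Finset.sum_congr rfl fun l _ => by ring

theorem integrable_mulVec_mul (v : ℝ≥0) (B C : Matrix ι ι ℝ) :
    Integrable (fun z : ι → ℝ => (z ⬝ᵥ B.mulVec z) * (z ⬝ᵥ C.mulVec z)) (gaussianPi ι v) := by
  simp only [dotProduct_mulVec_mul]
  exact integrable_finsetSum _ fun i _ => integrable_finsetSum _ fun j _ =>
    integrable_finsetSum _ fun k _ => integrable_finsetSum _ fun l _ =>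
      (integrable_monomial v i j k l).const_mul _

/-- Of the three pairings, one gives the product of the traces, which is zero, and the other two
coincide by symmetry of `C`. Nothing is needed of `B`, so the resolvent solution need not be shown
symmetric. -/
theorem integral_mulVec_mul (v : ℝ≥0) {B C : Matrix ι ι ℝ} (hC : C.transpose = C)
    (htr : C.trace = 0) :
    ∫ z, (z ⬝ᵥ B.mulVec z) * (z ⬝ᵥ C.mulVec z) ∂gaussianPi ι v = 2 * (v : ℝ) ^ 2 * frob B C := by
  have hC' : ∀ i j, C i j = C j i := fun i j => congrFun (congrFun hC j) i
  have htr' : ∑ k, C k k = 0 := htr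
  have hint : ∀ i j k l, Integrable
      (fun z : ι → ℝ => (B i j * C k l) * (z i * z j * z k * z l)) (gaussianPi ι v) :=
    fun i j k l => (integrable_monomial v i j k l).const_mul _
  simp only [dotProduct_mulVec_mul]
  rw [integral_finsetSum _ fun i _ => integrable_finsetSum _ fun j _ =>
    integrable_finsetSum _ fun k _ => integrable_finsetSum _ fun l _ => hint i j k l, frob,
    Finset.mul_sum]
  refine Finset.sum_congr rfl fun i _ => ?_
  rw [integral_finsetSum _ fun j _ =>
    integrable_finsetSum _ fun k _ => integrable_finsetSum _ fun l _ => hint i j k l,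
    Finset.mul_sum]
  refine Finset.sum_congr rfl fun j _ => ?_
  rw [integral_finsetSum _ fun k _ => integrable_finsetSum _ fun l _ => hint i j k l]
  have h1 : ∀ k, ∫ z, ∑ l, (B i j * C k l) * (z i * z j * z k * z l) ∂gaussianPi ι v
      = (v : ℝ) ^ 2 * B i j * ((if i = j then 1 else 0) * C k k + (if i = k then 1 else 0) * C k j
        + (if j = k then 1 else 0) * C k i) := by
    intro k
    rw [integral_finsetSum _ fun l _ => hint i j k l]
    simp only [integral_const_mul, isserlis, mul_add, Finset.sum_add_distrib]
    simp
    split_ifs <;> ring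
  simp only [h1, ← Finset.mul_sum, Finset.sum_add_distrib, htr']
  simp [hC' j i]
  ring

omit [DecidableEq ι] in
theorem gaussianPi_eq_withDensity {v : ℝ≥0} (hv : v ≠ 0) :
    gaussianPi ι v = volume.withDensity fun z => ENNReal.ofReal (∏ i, gaussianPDFReal 0 v (z i)) := by
  refine Measure.pi_eq fun s hs => ?_
  have hint : Integrable (fun z : ι → ℝ => ∏ i, gaussianPDFReal 0 v (z i)) :=
    Integrable.fintype_prod fun i => integrable_gaussianPDFReal 0 v
  have hms : MeasurableSet (Set.univ.pi s) := MeasurableSet.univ_pi hs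
  rw [withDensity_apply _ hms,
    ← ofReal_integral_eq_lintegral_ofReal hint.restrict
      (ae_of_all _ fun z => Finset.prod_nonneg fun i _ => gaussianPDFReal_nonneg _ _ _)]
  have h2 : ∫ z in Set.univ.pi s, ∏ i, gaussianPDFReal 0 v (z i)
      = ∏ i, ∫ x in s i, gaussianPDFReal 0 v x := by
    rw [← integral_indicator hms]
    simp only [← fun i => integral_indicator (hs i) (μ := volume) (f := gaussianPDFReal 0 v)]
    rw [← integral_fintype_prod_volume_eq_prod]
    congr 1
    funext z
    by_cases hz : z ∈ Set.univ.pi s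
    · rw [Set.indicator_of_mem hz]
      exact Finset.prod_congr rfl fun i _ => (Set.indicator_of_mem (hz i trivial) _).symm
    · rw [Set.indicator_of_notMem hz]
      simp only [Set.mem_univ_pi, not_forall] at hz
      obtain ⟨i, hi⟩ := hz
      exact (Finset.prod_eq_zero (Finset.mem_univ i) (Set.indicator_of_notMem hi _)).symm
  rw [h2, ENNReal.ofReal_prod_of_nonneg
    fun i _ => integral_nonneg fun x => gaussianPDFReal_nonneg _ _ _]
  exact Finset.prod_congr rfl fun i _ => (gaussianReal_apply_eq_integral 0 hv (s i)).symm

omit [DecidableEq ι] in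
/-- A probability measure proportional to `exp (-|z|² / (2 v)) dz` is the Gaussian measure. -/
theorem eq_gaussianPi_of_smul {v : ℝ≥0} (hv : v ≠ 0) {μ : Measure (ι → ℝ)}
    [IsProbabilityMeasure μ] {c : ℝ≥0∞}
    (hμ : μ = c • volume.withDensity fun z : ι → ℝ => ENNReal.ofReal (Real.exp (-(z ⬝ᵥ z) / (2 * v)))) :
    μ = gaussianPi ι v := by
  set K : ℝ := ((√(2 * Real.pi * v))⁻¹) ^ Fintype.card ι with hK
  have hvpos : 0 < (v : ℝ) := by positivity
  have hK0 : 0 < K := by positivity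
  have h1 : gaussianPi ι v = ENNReal.ofReal K • volume.withDensity
      fun z : ι → ℝ => ENNReal.ofReal (Real.exp (-(z ⬝ᵥ z) / (2 * v))) := by
    rw [gaussianPi_eq_withDensity hv, ← withDensity_smul _ (by fun_prop)]
    congr 1
    funext z
    rw [Pi.smul_apply, smul_eq_mul, ← ENNReal.ofReal_mul hK0.le]
    congr 1
    simp only [gaussianPDFReal, Finset.prod_mul_distrib, ← Real.exp_sum, Finset.prod_const]
    rw [hK, Finset.card_univ]
    congr 2
    simp only [dotProduct, sub_zero, ← Finset.sum_div, Finset.sum_neg_distrib, sq]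
  set ρ := volume.withDensity
      fun z : ι → ℝ => ENNReal.ofReal (Real.exp (-(z ⬝ᵥ z) / (2 * v)))
  have h2 : c * ρ Set.univ = 1 := by
    have := measure_univ (μ := μ)
    rwa [hμ, Measure.smul_apply, smul_eq_mul] at this
  have h3 : ENNReal.ofReal K * ρ Set.univ = 1 := by
    have := measure_univ (μ := gaussianPi ι v)
    rwa [h1, Measure.smul_apply, smul_eq_mul] at this
  have h4 : c = ENNReal.ofReal K := by
    rw [ENNReal.eq_inv_of_mul_eq_one_left h2, ENNReal.eq_inv_of_mul_eq_one_left h3]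
  rw [hμ, h1, h4]

end GaussianMoments

/-! ### Second order operators built from linear vector fields, and cutoffs. -/

section LinearFields


variable {P β : Type*} [NormedAddCommGroup P] [NormedSpace ℝ P]

/-- The derivative of `f` along the linear vector field `X`. -/
noncomputable def dirD (X : P →L[ℝ] P) (f : P → ℝ) (ω : P) : ℝ := fderiv ℝ f ω (X ω)

/-- The second order operator `A + κ ∑_b X_b²` built from linear vector fields. -/
noncomputable def genD (κ : ℝ) (s : Finset β) (A : P →L[ℝ] P) (X : β → P →L[ℝ] P) (f : P → ℝ)
    (ω : P) : ℝ :=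
  dirD A f ω + κ * ∑ b ∈ s, dirD (X b) (dirD (X b) f) ω

theorem contDiff_dirD {f : P → ℝ} (hf : ContDiff ℝ (⊤ : ℕ∞) f) (X : P →L[ℝ] P) :
    ContDiff ℝ (⊤ : ℕ∞) (dirD X f) :=
  (hf.fderiv_right (m := (⊤ : ℕ∞)) (by simp)).clm_apply X.contDiff

theorem contDiff_genD {f : P → ℝ} (hf : ContDiff ℝ (⊤ : ℕ∞) f) (κ : ℝ) (s : Finset β) (A : P →L[ℝ] P)
    (X : β → P →L[ℝ] P) : ContDiff ℝ (⊤ : ℕ∞) (genD κ s A X f) :=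
  (contDiff_dirD hf A).add (contDiff_const.mul
    (ContDiff.sum fun b _ => contDiff_dirD (contDiff_dirD hf (X b)) (X b)))

theorem dirD_mul {f g : P → ℝ} (hf : ContDiff ℝ (⊤ : ℕ∞) f) (hg : ContDiff ℝ (⊤ : ℕ∞) g) (X : P →L[ℝ] P) :
    dirD X (fun ω => f ω * g ω) = fun ω => dirD X f ω * g ω + f ω * dirD X g ω := by
  funext ω
  have h1 : DifferentiableAt ℝ f ω := (hf.differentiable (by simp)) ω
  have h2 : DifferentiableAt ℝ g ω := (hg.differentiable (by simp)) ω
  simp only [dirD]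
  rw [fderiv_fun_mul h1 h2]
  simp only [add_apply, smul_apply, smul_eq_mul]
  ring

theorem dirD_add {f g : P → ℝ} (hf : ContDiff ℝ (⊤ : ℕ∞) f) (hg : ContDiff ℝ (⊤ : ℕ∞) g) (X : P →L[ℝ] P) :
    dirD X (fun ω => f ω + g ω) = fun ω => dirD X f ω + dirD X g ω := by
  funext ω
  have h1 : DifferentiableAt ℝ f ω := (hf.differentiable (by simp)) ω
  have h2 : DifferentiableAt ℝ g ω := (hg.differentiable (by simp)) ω
  simp only [dirD]
  rw [fderiv_fun_add h1 h2]
  simp only [add_apply]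

theorem genD_mul {f g : P → ℝ} (hf : ContDiff ℝ (⊤ : ℕ∞) f) (hg : ContDiff ℝ (⊤ : ℕ∞) g) (κ : ℝ) (s : Finset β)
    (A : P →L[ℝ] P) (X : β → P →L[ℝ] P) (ω : P) :
    genD κ s A X (fun ω => f ω * g ω) ω = genD κ s A X f ω * g ω + f ω * genD κ s A X g ω
      + 2 * κ * ∑ b ∈ s, dirD (X b) f ω * dirD (X b) g ω := by
  have h : ∀ b, dirD (X b) (dirD (X b) fun ω => f ω * g ω) ω
      = dirD (X b) (dirD (X b) f) ω * g ω + f ω * dirD (X b) (dirD (X b) g) ω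
        + 2 * (dirD (X b) f ω * dirD (X b) g ω) := by
    intro b
    have hf' := contDiff_dirD hf (X b)
    have hg' := contDiff_dirD hg (X b)
    rw [dirD_mul hf hg, dirD_add (hf'.mul hg) (hf.mul hg'), dirD_mul hf' hg, dirD_mul hf hg']
    ring
  simp only [genD, h]
  simp only [dirD_mul hf hg, Finset.sum_add_distrib, ← Finset.sum_mul, ← Finset.mul_sum]
  ring

/-- A linear field commutes with dilations. Hence rescaling a cutoff leaves the bounds on its
derivatives along the fields unchanged, in spite of the linear growth of the coefficients. -/
theorem dirD_comp_smul (X : P →L[ℝ] P) (f : P → ℝ) (c : ℝ) :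
    dirD X (fun ω => f (c • ω)) = fun ω => dirD X f (c • ω) := by
  funext ω
  simp only [dirD]
  rw [fderiv_comp_smul, smul_apply, ← map_smul, map_smul X]

theorem genD_comp_smul (κ : ℝ) (s : Finset β) (A : P →L[ℝ] P) (X : β → P →L[ℝ] P) (f : P → ℝ)
    (c : ℝ) : genD κ s A X (fun ω => f (c • ω)) = fun ω => genD κ s A X f (c • ω) := by
  funext ω
  simp only [genD, dirD_comp_smul]

theorem dirD_congr {f g : P → ℝ} {ω : P} (h : f =ᶠ[𝓝 ω] g) (X : P →L[ℝ] P) :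
    dirD X f =ᶠ[𝓝 ω] dirD X g := by
  filter_upwards [h.fderiv (𝕜 := ℝ)] with η hη
  simp only [dirD, hη]

theorem genD_congr {f g : P → ℝ} {ω : P} (h : f =ᶠ[𝓝 ω] g) (κ : ℝ) (s : Finset β) (A : P →L[ℝ] P)
    (X : β → P →L[ℝ] P) : genD κ s A X f ω = genD κ s A X g ω := by
  simp only [genD]
  rw [(dirD_congr h A).eq_of_nhds,
    Finset.sum_congr rfl fun b _ => (dirD_congr (dirD_congr h (X b)) (X b)).eq_of_nhds]

theorem hasCompactSupport_dirD {f : P → ℝ} (hf : HasCompactSupport f) (X : P →L[ℝ] P) :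
    HasCompactSupport (dirD X f) := by
  refine (hf.fderiv ℝ).mono fun ω hω => ?_
  contrapose! hω
  simp only [Function.mem_support, not_not] at hω ⊢
  simp [NoisyChain.dirD, hω]

theorem exists_bound {f : P → ℝ} (hf : ContDiff ℝ (⊤ : ℕ∞) f) (hs : HasCompactSupport f) :
    ∃ C, ∀ ω, |f ω| ≤ C := by
  obtain ⟨C, hC⟩ := hf.continuous.bounded_above_of_compact_support hs
  exact ⟨C, hC⟩

/-- Smooth bounded functions with bounded derivatives along the fields are approximated, together
with their images under the operator, by test functions. -/
theorem exists_cutoff [FiniteDimensional ℝ P] (κ : ℝ) (s : Finset β) (A : P →L[ℝ] P)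
    (X : β → P →L[ℝ] P) {G : P → ℝ} (hG : ContDiff ℝ (⊤ : ℕ∞) G) {K : ℝ} (hK : ∀ ω, |G ω| ≤ K)
    (hKX : ∀ b, ∃ K, ∀ ω, |dirD (X b) G ω| ≤ K) {K' : ℝ} (hKL : ∀ ω, |genD κ s A X G ω| ≤ K') :
    ∃ f : ℕ → P → ℝ, (∀ k, ContDiff ℝ (⊤ : ℕ∞) (f k) ∧ HasCompactSupport (f k)) ∧
      (∃ C, ∀ k ω, |f k ω| ≤ C ∧ |genD κ s A X (f k) ω| ≤ C) ∧
      ∀ ω, ∀ᶠ k in atTop, f k ω = G ω ∧ genD κ s A X (f k) ω = genD κ s A X G ω := by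
  let χ : ContDiffBump (0 : P) := ⟨1, 2, one_pos, one_lt_two⟩
  have hχ : ContDiff ℝ (⊤ : ℕ∞) χ := χ.contDiff
  have hχs : HasCompactSupport χ := χ.hasCompactSupport
  let c : ℕ → ℝ := fun k => ((k : ℝ) + 1)⁻¹
  have hc : ∀ k, c k ≠ 0 := fun k => by positivity
  have hsm : ∀ k, ContDiff ℝ (⊤ : ℕ∞) fun ω : P => χ (c k • ω) := fun k =>
    hχ.comp (contDiff_const_smul _)
  choose K₁ hK₁ using hKX
  choose K₂ hK₂ using fun b => exists_bound (contDiff_dirD hχ (X b)) (hasCompactSupport_dirD hχs (X b))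
  obtain ⟨K₃, hK₃⟩ := exists_bound (contDiff_dirD hχ A) (hasCompactSupport_dirD hχs A)
  choose K₄ hK₄ using fun b => exists_bound (contDiff_dirD (contDiff_dirD hχ (X b)) (X b))
    (hasCompactSupport_dirD (hasCompactSupport_dirD hχs (X b)) (X b))
  have hχ1 : ∀ ω, |χ ω| ≤ 1 := fun ω => by
    rw [abs_of_nonneg χ.nonneg]; exact χ.le_one
  have hLχ : ∀ ω, |genD κ s A X χ ω| ≤ K₃ + |κ| * ∑ b ∈ s, K₄ b := by
    intro ω
    refine (abs_add_le _ _).trans (add_le_add (hK₃ ω) ?_)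
    rw [abs_mul]
    exact mul_le_mul_of_nonneg_left ((Finset.abs_sum_le_sum_abs _ _).trans
      (Finset.sum_le_sum fun b _ => hK₄ b ω)) (abs_nonneg _)
  refine ⟨fun k ω => G ω * χ (c k • ω), fun k => ⟨hG.mul (hsm k), ?_⟩, ?_, ?_⟩
  · exact (hχs.comp_smul (hc k)).mul_left
  · refine ⟨max K (K' + K * (K₃ + |κ| * ∑ b ∈ s, K₄ b) + 2 * |κ| * ∑ b ∈ s, K₁ b * K₂ b),
      fun k ω => ⟨?_, ?_⟩⟩
    · refine le_max_of_le_left ?_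
      rw [abs_mul]
      calc |G ω| * |χ (c k • ω)| ≤ |G ω| * 1 := mul_le_mul_of_nonneg_left (hχ1 _) (abs_nonneg _)
        _ ≤ K := by rw [mul_one]; exact hK ω
    · refine le_max_of_le_right ?_
      rw [genD_mul hG (hsm k), genD_comp_smul κ s A X χ]
      simp only [dirD_comp_smul _ χ]
      refine (abs_add_le _ _).trans (add_le_add ((abs_add_le _ _).trans (add_le_add ?_ ?_)) ?_)
      · rw [abs_mul]
        calc _ ≤ |genD κ s A X G ω| * 1 := mul_le_mul_of_nonneg_left (hχ1 _) (abs_nonneg _)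
          _ ≤ K' := by rw [mul_one]; exact hKL ω
      · rw [abs_mul]
        exact mul_le_mul (hK ω) (hLχ _) (abs_nonneg _) ((abs_nonneg _).trans (hK ω))
      · rw [abs_mul, abs_mul, abs_two]
        refine mul_le_mul_of_nonneg_left ((Finset.abs_sum_le_sum_abs _ _).trans
          (Finset.sum_le_sum fun b _ => ?_)) (by positivity)
        rw [abs_mul]
        exact mul_le_mul (hK₁ b ω) (hK₂ b _) (abs_nonneg _) ((abs_nonneg _).trans (hK₁ b ω))
  · intro ω
    have hlim : Tendsto (fun k => c k • ω) atTop (𝓝 (0 : P)) := by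
      have h := (tendsto_one_div_add_atTop_nhds_zero_nat (𝕜 := ℝ)).smul_const ω
      simpa [c] using h
    have hball : ∀ᶠ k in atTop, c k • ω ∈ Metric.ball (0 : P) 1 :=
      hlim (Metric.ball_mem_nhds _ one_pos)
    filter_upwards [hball] with k hk
    -- The cutoff equals one on a whole neighbourhood of `ω`, so the images under the operator agree
    -- there and not only the values.
    have hev : (fun ω => G ω * χ (c k • ω)) =ᶠ[𝓝 ω] G := by
      have : ∀ᶠ η in 𝓝 ω, c k • η ∈ Metric.ball (0 : P) 1 :=
        (continuous_const_smul (c k)).continuousAt.preimage_mem_nhds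
          (Metric.isOpen_ball.mem_nhds hk)
      filter_upwards [this] with η hη
      rw [χ.one_of_mem_closedBall (Metric.ball_subset_closedBall hη), mul_one]
    exact ⟨hev.eq_of_nhds, genD_congr hev κ s A X⟩

end LinearFields

/-! ### Quadratic functions and their Gaussian damping. -/

section QuadraticFunctions


variable {P β ι : Type*} [NormedAddCommGroup P] [NormedSpace ℝ P] [Fintype ι]

/-- The quadratic function with matrix `B` in the coordinates `Z`. -/
def quad (Z : P →L[ℝ] (ι → ℝ)) (B : Matrix ι ι ℝ) (ω : P) : ℝ := Z ω ⬝ᵥ B.mulVec (Z ω)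

/-- The quadratic function with matrix `B`, damped by a Gaussian factor. -/
noncomputable def dampedQuad (Z : P →L[ℝ] (ι → ℝ)) (B : Matrix ι ι ℝ) (ω : P) : ℝ :=
  quad Z B ω * Real.exp (-(Z ω ⬝ᵥ Z ω))

variable (Z : P →L[ℝ] (ι → ℝ))

theorem contDiff_quad (B : Matrix ι ι ℝ) : ContDiff ℝ (⊤ : ℕ∞) (quad Z B) := by
  have h : ∀ i, ContDiff ℝ (⊤ : ℕ∞) fun ω => Z ω i := fun i =>
    ((ContinuousLinearMap.proj (R := ℝ) (φ := fun _ : ι => ℝ) i).comp Z).contDiff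
  unfold quad dotProduct Matrix.mulVec dotProduct
  exact ContDiff.sum fun i _ => (h i).mul (ContDiff.sum fun j _ => contDiff_const.mul (h j))

theorem quad_one [DecidableEq ι] (ω : P) : quad Z 1 ω = Z ω ⬝ᵥ Z ω := by simp [quad]

theorem contDiff_normSq : ContDiff ℝ (⊤ : ℕ∞) fun ω => Z ω ⬝ᵥ Z ω := by
  classical
  rw [show (fun ω => Z ω ⬝ᵥ Z ω) = quad Z 1 from funext fun ω => (quad_one Z ω).symm]
  exact contDiff_quad Z 1

theorem contDiff_exp_normSq (c : ℝ) : ContDiff ℝ (⊤ : ℕ∞) fun ω => Real.exp (c * (Z ω ⬝ᵥ Z ω)) :=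
  (contDiff_const.mul (contDiff_normSq Z)).exp

theorem contDiff_dampedQuad (B : Matrix ι ι ℝ) : ContDiff ℝ (⊤ : ℕ∞) (dampedQuad Z B) :=
  (contDiff_quad Z B).mul (contDiff_normSq Z).neg.exp

variable {Z} {X : P →L[ℝ] P} {MX : Matrix ι ι ℝ} (hX : ∀ ω, Z (X ω) = MX.mulVec (Z ω))
  (hM : MX.transpose = -MX)

include hX hM in
-- The linear coefficient of the quadratic polynomial along the line in direction `X ω`;
-- antisymmetry turns the transpose of `MX` into a minus sign and thus yields a commutator.
theorem dirD_quad (B : Matrix ι ι ℝ) : dirD X (quad Z B) = quad Z (comm B MX) := by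
  funext ω
  have hd : DifferentiableAt ℝ (quad Z B) ω := (contDiff_quad Z B).differentiable (by simp) ω
  rw [dirD, ← hd.lineDeriv_eq_fderiv, lineDeriv]
  set v := MX.mulVec (Z ω) with hv
  have h1 : (fun t : ℝ => quad Z B (ω + t • X ω)) = fun t : ℝ => Z ω ⬝ᵥ B.mulVec (Z ω)
      + t * (v ⬝ᵥ B.mulVec (Z ω) + Z ω ⬝ᵥ B.mulVec v) + t ^ 2 * (v ⬝ᵥ B.mulVec v) := by
    funext t
    simp only [quad, map_add, map_smul, hX, ← hv, Matrix.mulVec_add, Matrix.mulVec_smul,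
      add_dotProduct, dotProduct_add, smul_dotProduct, dotProduct_smul, smul_eq_mul]
    ring
  have h2 : HasDerivAt (fun t : ℝ => Z ω ⬝ᵥ B.mulVec (Z ω)
      + t * (v ⬝ᵥ B.mulVec (Z ω) + Z ω ⬝ᵥ B.mulVec v) + t ^ 2 * (v ⬝ᵥ B.mulVec v))
      (v ⬝ᵥ B.mulVec (Z ω) + Z ω ⬝ᵥ B.mulVec v) 0 := by
    refine ((((hasDerivAt_id' (0 : ℝ)).mul_const _).const_add _).add
      ((hasDerivAt_pow 2 (0 : ℝ)).mul_const _)).congr_deriv ?_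
    simp
  rw [h1, h2.deriv, quad, comm, Matrix.sub_mulVec, dotProduct_sub, ← Matrix.mulVec_mulVec,
    ← Matrix.mulVec_mulVec, ← hv]
  have h3 : Z ω ⬝ᵥ MX.mulVec (B.mulVec (Z ω)) = -(v ⬝ᵥ B.mulVec (Z ω)) := by
    rw [Matrix.dotProduct_mulVec, ← Matrix.mulVec_transpose, hM, Matrix.neg_mulVec, neg_dotProduct]
  rw [h3]
  ring

include hX hM in
theorem dirD_normSq : dirD X (fun ω => Z ω ⬝ᵥ Z ω) = 0 := by
  classical
  have h := dirD_quad hX hM 1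
  have h1 : comm 1 MX = 0 := by simp [comm]
  have h2 : quad Z (0 : Matrix ι ι ℝ) = 0 := by funext ω; simp [quad]
  rw [h1, h2] at h
  have h3 : quad Z (1 : Matrix ι ι ℝ) = fun ω => Z ω ⬝ᵥ Z ω := funext (quad_one Z)
  rwa [h3] at h

include hX hM in
theorem dirD_exp_normSq (c : ℝ) : dirD X (fun ω => Real.exp (c * (Z ω ⬝ᵥ Z ω))) = 0 := by
  funext ω
  have hd : DifferentiableAt ℝ (fun ω => Z ω ⬝ᵥ Z ω) ω :=
    (contDiff_normSq Z).differentiable (by simp) ω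
  have h := congrFun (dirD_normSq hX hM) ω
  simp only [dirD, Pi.zero_apply] at h
  simp only [dirD]
  rw [fderiv_exp (hd.const_mul c), fderiv_const_mul hd]
  simp [h]

include hX hM in
theorem dirD_dampedQuad (B : Matrix ι ι ℝ) :
    dirD X (dampedQuad Z B) = dampedQuad Z (comm B MX) := by
  have h := dirD_mul (contDiff_quad Z B) (contDiff_exp_normSq Z (-1)) X
  rw [dirD_quad hX hM, dirD_exp_normSq hX hM] at h
  simp only [neg_one_mul, Pi.zero_apply, mul_zero, add_zero] at h
  exact h

variable (Z) in
theorem quad_add (B C : Matrix ι ι ℝ) (ω : P) : quad Z (B + C) ω = quad Z B ω + quad Z C ω := by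
  simp [quad, Matrix.add_mulVec]

variable (Z) in
theorem quad_smul (c : ℝ) (B : Matrix ι ι ℝ) (ω : P) : quad Z (c • B) ω = c * quad Z B ω := by
  simp [quad, Matrix.smul_mulVec]

variable (Z) in
theorem quad_sub (B C : Matrix ι ι ℝ) (ω : P) : quad Z (B - C) ω = quad Z B ω - quad Z C ω := by
  simp [quad, Matrix.sub_mulVec]

variable (Z) in
theorem quad_sum (s : Finset β) (C : β → Matrix ι ι ℝ) (ω : P) :
    quad Z (∑ b ∈ s, C b) ω = ∑ b ∈ s, quad Z (C b) ω := by
  simp [quad, Matrix.sum_mulVec, dotProduct_sum]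

/-- All fields are tangent to the energy spheres, so they do not see the damping factor and the
operator acts on the matrix alone. -/
theorem genD_dampedQuad {κ : ℝ} {s : Finset β} {A : P →L[ℝ] P} {X : β → P →L[ℝ] P}
    {MA : Matrix ι ι ℝ} {MX : β → Matrix ι ι ℝ}
    (hA : ∀ ω, Z (A ω) = MA.mulVec (Z ω)) (hX : ∀ b ω, Z (X b ω) = (MX b).mulVec (Z ω))
    (hMA : MA.transpose = -MA) (hMX : ∀ b, (MX b).transpose = -MX b) (B : Matrix ι ι ℝ) :
    genD κ s A X (dampedQuad Z B) = dampedQuad Z (genMat κ s MA MX B) := by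
  funext ω
  simp only [genD, dirD_dampedQuad hA hMA, dirD_dampedQuad (hX _) (hMX _)]
  simp only [dampedQuad, genMat, quad_add, quad_smul, quad_sum, add_mul, Finset.sum_mul, mul_assoc]

/-- A constant controlling the quadratic function of `B` by the energy. -/
def quadBound (B : Matrix ι ι ℝ) : ℝ := ∑ i, ∑ j, |B i j|

theorem quadBound_nonneg (B : Matrix ι ι ℝ) : 0 ≤ quadBound B :=
  Finset.sum_nonneg fun _ _ => Finset.sum_nonneg fun _ _ => abs_nonneg _

theorem normSq_nonneg (z : ι → ℝ) : 0 ≤ z ⬝ᵥ z := Finset.sum_nonneg fun _ _ => mul_self_nonneg _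

theorem sq_le_normSq (z : ι → ℝ) (i : ι) : z i * z i ≤ z ⬝ᵥ z :=
  Finset.single_le_sum (f := fun i => z i * z i) (fun _ _ => mul_self_nonneg _) (Finset.mem_univ i)

variable (Z) in
theorem abs_quad_le (B : Matrix ι ι ℝ) (ω : P) : |quad Z B ω| ≤ quadBound B * (Z ω ⬝ᵥ Z ω) := by
  rw [quad, quadBound, dotProduct, Finset.sum_mul]
  refine (Finset.abs_sum_le_sum_abs _ _).trans (Finset.sum_le_sum fun i _ => ?_)
  rw [abs_mul, Matrix.mulVec, dotProduct, Finset.sum_mul]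
  refine (mul_le_mul_of_nonneg_left (Finset.abs_sum_le_sum_abs _ _) (abs_nonneg _)).trans ?_
  rw [Finset.mul_sum]
  refine Finset.sum_le_sum fun j _ => ?_
  rw [abs_mul, mul_left_comm, ← abs_mul]
  refine mul_le_mul_of_nonneg_left ?_ (abs_nonneg _)
  have h1 := sq_le_normSq (Z ω) i
  have h2 := sq_le_normSq (Z ω) j
  rw [abs_le]
  constructor <;> nlinarith [sq_nonneg (Z ω i + Z ω j), sq_nonneg (Z ω i - Z ω j)]

variable (Z) in
-- Since `s ≤ exp s`, damping makes quadratic functions bounded. Because damping commutes with the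
-- fields, their images are bounded too, as the cutoff argument requires.
theorem abs_dampedQuad_le (B : Matrix ι ι ℝ) (ω : P) : |dampedQuad Z B ω| ≤ quadBound B := by
  rw [dampedQuad, abs_mul, abs_of_pos (Real.exp_pos _), Real.exp_neg]
  have h1 := abs_quad_le Z B ω
  have h2 := Real.add_one_le_exp (Z ω ⬝ᵥ Z ω)
  rw [← div_eq_mul_inv, div_le_iff₀ (Real.exp_pos _)]
  refine h1.trans (mul_le_mul_of_nonneg_left ?_ (quadBound_nonneg B))
  linarith

end QuadraticFunctions

/-! ### Bounded test functions and conservation of energy. -/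

section MartingaleProblem

variable {P β : Type*} [NormedAddCommGroup P] [NormedSpace ℝ P] [FiniteDimensional ℝ P]
  [MeasurableSpace P] [BorelSpace P]
  {Ω : Type*} [MeasurableSpace Ω]

/-- The increment of `f` along a path, compensated by the time integral of its image `g` under the
generator. -/
noncomputable def compensated (f g : P → ℝ) (Y : ℝ≥0 → Ω → P) (t : ℝ≥0) (w : Ω) : ℝ :=
  f (Y t w) - f (Y 0 w) - ∫ s in (0 : ℝ)..t, g (Y s.toNNReal w)

/-- The consequence of the martingale problem in which conditioning is on the initial state only. -/
structure SolvesFromStart (κ : ℝ) (s : Finset β) (A : P →L[ℝ] P) (X : β → P →L[ℝ] P)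
    (ℙ : Measure Ω) (Y : ℝ≥0 → Ω → P) : Prop where
  measurable : ∀ t, Measurable (Y t)
  continuous : ∀ w, Continuous fun t => Y t w
  integral_eq_zero : ∀ f : P → ℝ, ContDiff ℝ (⊤ : ℕ∞) f → HasCompactSupport f → ∀ t,
    ∀ h : P → ℝ, Measurable h → (∃ C, ∀ ω, |h ω| ≤ C) →
      ∫ w, compensated f (genD κ s A X f) Y t w * h (Y 0 w) ∂ℙ = 0

omit [NormedAddCommGroup P] [NormedSpace ℝ P] [FiniteDimensional ℝ P] [MeasurableSpace P]
  [BorelSpace P] [MeasurableSpace Ω] in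
theorem abs_compensated_le {f g : P → ℝ} {C : ℝ} (hf : ∀ ω, |f ω| ≤ C) (hg : ∀ ω, |g ω| ≤ C)
    (Y : ℝ≥0 → Ω → P) (t : ℝ≥0) (w : Ω) : |compensated f g Y t w| ≤ C + C + C * t := by
  have h : |∫ s in (0 : ℝ)..t, g (Y s.toNNReal w)| ≤ C * t := by
    have := intervalIntegral.norm_integral_le_of_norm_le_const (a := 0) (b := (t : ℝ))
      (f := fun s : ℝ => g (Y s.toNNReal w)) (C := C) fun s _ => hg _
    simpa using this
  rw [compensated]
  refine (abs_sub _ _).trans (add_le_add ((abs_sub _ _).trans (add_le_add (hf _) (hf _))) h)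

variable {κ : ℝ} {s : Finset β} {A : P →L[ℝ] P} {X : β → P →L[ℝ] P} {ℙ : Measure Ω}
  [IsProbabilityMeasure ℙ] {Y : ℝ≥0 → Ω → P}

omit [FiniteDimensional ℝ P] [IsProbabilityMeasure ℙ] in
theorem SolvesFromStart.measurable_uncurry (hY : SolvesFromStart κ s A X ℙ Y) :
    Measurable fun p : Ω × ℝ => Y p.2.toNNReal p.1 := by
  have h := measurable_uncurry_of_continuous_of_measurable hY.continuous hY.measurable
  exact h.comp ((measurable_real_toNNReal.comp measurable_snd).prodMk measurable_fst)

omit [FiniteDimensional ℝ P] [IsProbabilityMeasure ℙ] in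
theorem SolvesFromStart.measurable_compensated (hY : SolvesFromStart κ s A X ℙ Y) {f g : P → ℝ}
    (hf : Continuous f) (hg : Continuous g) (t : ℝ≥0) : Measurable (compensated f g Y t) := by
  refine ((hf.measurable.comp (hY.measurable t)).sub (hf.measurable.comp (hY.measurable 0))).sub ?_
  have h0 : (0 : ℝ) ≤ t := t.2
  simp only [intervalIntegral.integral_of_le h0]
  exact (StronglyMeasurable.integral_prod_right'
    (f := fun p : Ω × ℝ => g (Y p.2.toNNReal p.1))
    (hg.measurable.comp hY.measurable_uncurry).stronglyMeasurable).measurable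

/-- Dominated convergence along the cutoffs of `exists_cutoff`. Compact support is removed because
`Z` may have a kernel, so that functions of the energy need not decay at infinity. -/
theorem SolvesFromStart.integral_eq_zero_of_bounded (hY : SolvesFromStart κ s A X ℙ Y) {G : P → ℝ}
    (hG : ContDiff ℝ (⊤ : ℕ∞) G) {K : ℝ} (hK : ∀ ω, |G ω| ≤ K)
    (hKX : ∀ b, ∃ K, ∀ ω, |dirD (X b) G ω| ≤ K) {K' : ℝ} (hKL : ∀ ω, |genD κ s A X G ω| ≤ K')
    (t : ℝ≥0) {h : P → ℝ} (hh : Measurable h) {C : ℝ} (hC : ∀ ω, |h ω| ≤ C) :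
    ∫ w, compensated G (genD κ s A X G) Y t w * h (Y 0 w) ∂ℙ = 0 := by
  obtain ⟨f, hf, ⟨K₁, hK₁⟩, hlim⟩ := exists_cutoff κ s A X hG hK hKX hKL
  have hcont : ∀ k, Continuous (genD κ s A X (f k)) := fun k =>
    (contDiff_genD (hf k).1 κ s A X).continuous
  have h1 : Tendsto (fun k => ∫ w, compensated (f k) (genD κ s A X (f k)) Y t w * h (Y 0 w) ∂ℙ)
      atTop (𝓝 (∫ w, compensated G (genD κ s A X G) Y t w * h (Y 0 w) ∂ℙ)) := by
    refine tendsto_integral_of_dominated_convergence (fun _ => (K₁ + K₁ + K₁ * t) * C)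
      (fun k => ((hY.measurable_compensated (hf k).1.continuous (hcont k) t).mul
        (hh.comp (hY.measurable 0))).aestronglyMeasurable) (integrable_const _)
      (fun k => ae_of_all _ fun w => ?_) (ae_of_all _ fun w => ?_)
    · rw [Real.norm_eq_abs, abs_mul]
      have h2 := abs_compensated_le (fun ω => (hK₁ k ω).1) (fun ω => (hK₁ k ω).2) Y t w
      exact mul_le_mul h2 (hC _) (abs_nonneg _) ((abs_nonneg _).trans h2)
    · refine Tendsto.mul_const _ ?_
      refine Tendsto.sub (Tendsto.sub ?_ ?_) ?_
      · exact tendsto_const_nhds.congr' ((hlim (Y t w)).mono fun k hk => hk.1.symm)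
      · exact tendsto_const_nhds.congr' ((hlim (Y 0 w)).mono fun k hk => hk.1.symm)
      · refine intervalIntegral.tendsto_integral_filter_of_dominated_convergence (fun _ => K₁)
          (Eventually.of_forall fun k => ?_) (Eventually.of_forall fun k => ?_) (by simp) ?_
        · exact ((hcont k).comp ((hY.continuous w).comp
            continuous_real_toNNReal)).aestronglyMeasurable
        · exact ae_of_all _ fun r _ => (hK₁ k _).2
        · exact ae_of_all _ fun r _ => tendsto_const_nhds.congr'
            ((hlim _).mono fun k hk => hk.2.symm)
  have h2 : ∀ k, ∫ w, compensated (f k) (genD κ s A X (f k)) Y t w * h (Y 0 w) ∂ℙ = 0 := fun k =>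
    hY.integral_eq_zero _ (hf k).1 (hf k).2 t h hh ⟨C, hC⟩
  simp only [h2] at h1
  exact (tendsto_nhds_unique h1 tendsto_const_nhds)

variable {ι : Type*} [Fintype ι] {Z : P →L[ℝ] (ι → ℝ)} {MA : Matrix ι ι ℝ} {MX : β → Matrix ι ι ℝ}

theorem SolvesFromStart.integral_exp_normSq (hY : SolvesFromStart κ s A X ℙ Y)
    (hA : ∀ ω, Z (A ω) = MA.mulVec (Z ω)) (hX : ∀ b ω, Z (X b ω) = (MX b).mulVec (Z ω))
    (hMA : MA.transpose = -MA) (hMX : ∀ b, (MX b).transpose = -MX b) {c : ℝ} (hc : c ≤ 0)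
    (t : ℝ≥0) {h : P → ℝ} (hh : Measurable h) {C : ℝ} (hC : ∀ ω, |h ω| ≤ C) :
    ∫ w, (Real.exp (c * (Z (Y t w) ⬝ᵥ Z (Y t w))) - Real.exp (c * (Z (Y 0 w) ⬝ᵥ Z (Y 0 w))))
      * h (Y 0 w) ∂ℙ = 0 := by
  have hg : genD κ s A X (fun ω => Real.exp (c * (Z ω ⬝ᵥ Z ω))) = 0 := by
    funext ω
    simp only [genD, dirD_exp_normSq hA hMA, dirD_exp_normSq (hX _) (hMX _)]
    simp [dirD]
  have h1 := hY.integral_eq_zero_of_bounded (contDiff_exp_normSq Z c) (K := 1) (K' := 0)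
    (fun ω => by
      rw [abs_of_pos (Real.exp_pos _)]
      exact Real.exp_le_one_iff.2 (mul_nonpos_of_nonpos_of_nonneg hc (normSq_nonneg _)))
    (fun b => ⟨0, fun ω => by rw [dirD_exp_normSq (hX b) (hMX b)]; simp⟩)
    (fun ω => by rw [hg]; simp) t hh hC
  rw [hg] at h1
  simpa [compensated] using h1

/-- The energy is almost surely conserved. -/
theorem SolvesFromStart.ae_normSq_eq (hY : SolvesFromStart κ s A X ℙ Y)
    (hA : ∀ ω, Z (A ω) = MA.mulVec (Z ω)) (hX : ∀ b ω, Z (X b ω) = (MX b).mulVec (Z ω))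
    (hMA : MA.transpose = -MA) (hMX : ∀ b, (MX b).transpose = -MX b) :
    ∀ᵐ w ∂ℙ, ∀ t, Z (Y t w) ⬝ᵥ Z (Y t w) = Z (Y 0 w) ⬝ᵥ Z (Y 0 w) := by
  have hcE : Continuous fun ω : P => Z ω ⬝ᵥ Z ω := (contDiff_normSq Z).continuous
  have hone : ∀ t, ∀ᵐ w ∂ℙ, Z (Y t w) ⬝ᵥ Z (Y t w) = Z (Y 0 w) ⬝ᵥ Z (Y 0 w) := by
    intro t
    set E : ℝ≥0 → Ω → ℝ := fun t w => Real.exp (-1 * (Z (Y t w) ⬝ᵥ Z (Y t w))) with hE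
    have hm : ∀ t, Measurable (E t) := fun t =>
      Real.measurable_exp.comp ((hcE.measurable.comp (hY.measurable t)).const_mul _)
    have hb : ∀ t w, |E t w| ≤ 1 := fun t w => by
      rw [abs_of_pos (Real.exp_pos _)]
      exact Real.exp_le_one_iff.2
        (mul_nonpos_of_nonpos_of_nonneg (by norm_num) (normSq_nonneg _))
    have hi : ∀ t t', Integrable (fun w => E t w * E t' w) ℙ := fun t t' =>
      Integrable.of_bound ((hm t).mul (hm t')).aestronglyMeasurable 1 (ae_of_all _ fun w => by
        rw [Real.norm_eq_abs, abs_mul]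
        exact mul_le_one₀ (hb t w) (abs_nonneg _) (hb t' w))
    have h1 : ∫ w, (E t w - E 0 w) * E 0 w ∂ℙ = 0 :=
      hY.integral_exp_normSq hA hX hMA hMX (c := -1) (by norm_num) t
        (h := fun ω => Real.exp (-1 * (Z ω ⬝ᵥ Z ω)))
        (contDiff_exp_normSq Z (-1)).continuous.measurable (C := 1) fun ω => by
          rw [abs_of_pos (Real.exp_pos _)]
          exact Real.exp_le_one_iff.2
            (mul_nonpos_of_nonpos_of_nonneg (by norm_num) (normSq_nonneg _))
    -- The exponent `-2` makes the exponential the square of `E`. With `h1` this yields a vanishing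
    -- second moment of `E t - E 0`.
    have h2 : ∫ w, (E t w * E t w - E 0 w * E 0 w) * 1 ∂ℙ = 0 := by
      have := hY.integral_exp_normSq hA hX hMA hMX (c := -2) (by norm_num) t
        (h := fun _ => 1) measurable_const (C := 1) (by simp)
      have hsq : ∀ x : ℝ, Real.exp (-2 * x) = Real.exp (-1 * x) * Real.exp (-1 * x) := fun x => by
        rw [← Real.exp_add]; ring_nf
      simpa only [hsq] using this
    have h3 : ∫ w, (E t w - E 0 w) ^ 2 ∂ℙ = 0 := by
      have : ∀ w, (E t w - E 0 w) ^ 2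
          = (E t w * E t w - E 0 w * E 0 w) * 1 - 2 * ((E t w - E 0 w) * E 0 w) := fun w => by ring
      simp only [this]
      rw [integral_sub, integral_const_mul, h1, h2]
      · simp
      · simp only [mul_one]
        exact (hi t t).sub (hi 0 0)
      · simp only [sub_mul]
        exact ((hi t 0).sub (hi 0 0)).const_mul 2
    have h4 : Integrable (fun w => (E t w - E 0 w) ^ 2) ℙ := by
      have : ∀ w, (E t w - E 0 w) ^ 2
          = E t w * E t w - 2 * (E t w * E 0 w) + E 0 w * E 0 w := fun w => by ring
      simp only [this]
      exact ((hi t t).sub ((hi t 0).const_mul 2)).add (hi 0 0)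
    have h5 := (integral_eq_zero_iff_of_nonneg (fun w => sq_nonneg _) h4).1 h3
    filter_upwards [h5] with w hw
    have h6 : E t w = E 0 w := sub_eq_zero.1 (pow_eq_zero_iff two_ne_zero |>.1 hw)
    have h7 := Real.exp_injective h6
    linarith
  -- A countable dense set of times gives one common null set; path continuity supplies the
  -- remaining times.
  have hall : ∀ᵐ w ∂ℙ, ∀ n : ℕ, Z (Y (TopologicalSpace.denseSeq ℝ≥0 n) w) ⬝ᵥ
      Z (Y (TopologicalSpace.denseSeq ℝ≥0 n) w) = Z (Y 0 w) ⬝ᵥ Z (Y 0 w) :=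
    ae_all_iff.2 fun n => hone _
  filter_upwards [hall] with w hw t
  have hc : Continuous fun t => Z (Y t w) ⬝ᵥ Z (Y t w) := hcE.comp (hY.continuous w)
  have := Continuous.ext_on (TopologicalSpace.denseRange_denseSeq ℝ≥0) hc
    (continuous_const (y := Z (Y 0 w) ⬝ᵥ Z (Y 0 w))) (by rintro _ ⟨n, rfl⟩; exact hw n)
  exact congrFun this t

end MartingaleProblem

/-! ### Time correlations of quadratic functions and their Laplace transform. -/

section Correlations

variable {P β : Type*} [NormedAddCommGroup P] [NormedSpace ℝ P] [FiniteDimensional ℝ P]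
  [MeasurableSpace P] [BorelSpace P]
  {Ω : Type*} [MeasurableSpace Ω]
  {κ : ℝ} {s : Finset β} {A : P →L[ℝ] P} {X : β → P →L[ℝ] P} {ℙ : Measure Ω}
  [IsProbabilityMeasure ℙ] {Y : ℝ≥0 → Ω → P}
  {ι : Type*} [Fintype ι] {Z : P →L[ℝ] (ι → ℝ)}

/-- The correlation between the quadratic function `J` at time `0` and `B` at time `t`. -/
noncomputable def corr (Z : P →L[ℝ] (ι → ℝ)) (ℙ : Measure Ω) (Y : ℝ≥0 → Ω → P)
    (J B : Matrix ι ι ℝ) (t : ℝ≥0) : ℝ :=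
  ∫ w, quad Z J (Y 0 w) * quad Z B (Y t w) ∂ℙ

/-- Data of an equilibrium process with conserved energy, in the coordinates `Z`. -/
structure ConservesEnergy (Z : P →L[ℝ] (ι → ℝ)) (ℙ : Measure Ω) (Y : ℝ≥0 → Ω → P) : Prop where
  measurable : ∀ t, Measurable (Y t)
  continuous : ∀ w, Continuous fun t => Y t w
  normSq_eq : ∀ᵐ w ∂ℙ, ∀ t, Z (Y t w) ⬝ᵥ Z (Y t w) = Z (Y 0 w) ⬝ᵥ Z (Y 0 w)
  integrable : Integrable (fun w => (Z (Y 0 w) ⬝ᵥ Z (Y 0 w)) ^ 2) ℙ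

variable (hY : ConservesEnergy Z ℙ Y)

omit [FiniteDimensional ℝ P] in
theorem measurable_quad (Z : P →L[ℝ] (ι → ℝ)) (B : Matrix ι ι ℝ) : Measurable (quad Z B) :=
  (contDiff_quad Z B).continuous.measurable

omit [FiniteDimensional ℝ P] [MeasurableSpace P] [BorelSpace P] in
theorem abs_quad_mul_quad_le (J B : Matrix ι ι ℝ) {ω η : P} (h : Z η ⬝ᵥ Z η = Z ω ⬝ᵥ Z ω) :
    |quad Z J ω * quad Z B η| ≤ quadBound J * quadBound B * (Z ω ⬝ᵥ Z ω) ^ 2 := by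
  rw [abs_mul]
  have h1 := abs_quad_le Z J ω
  have h2 := abs_quad_le Z B η
  rw [h] at h2
  calc _ ≤ (quadBound J * (Z ω ⬝ᵥ Z ω)) * (quadBound B * (Z ω ⬝ᵥ Z ω)) :=
        mul_le_mul h1 h2 (abs_nonneg _) ((abs_nonneg _).trans h1)
    _ = _ := by ring

include hY

omit [IsProbabilityMeasure ℙ] [FiniteDimensional ℝ P] in
theorem ConservesEnergy.integrable_mul (J B : Matrix ι ι ℝ) (t : ℝ≥0) :
    Integrable (fun w => quad Z J (Y 0 w) * quad Z B (Y t w)) ℙ := by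
  refine (hY.integrable.const_mul (quadBound J * quadBound B)).mono'
    (((measurable_quad Z J).comp (hY.measurable 0)).mul
      ((measurable_quad Z B).comp (hY.measurable t))).aestronglyMeasurable ?_
  filter_upwards [hY.normSq_eq] with w hw
  exact abs_quad_mul_quad_le J B (hw t)

omit [IsProbabilityMeasure ℙ] [FiniteDimensional ℝ P] in
theorem ConservesEnergy.continuous_corr (J B : Matrix ι ι ℝ) : Continuous (corr Z ℙ Y J B) := by
  refine continuous_of_dominated (bound := fun w =>
    quadBound J * quadBound B * (Z (Y 0 w) ⬝ᵥ Z (Y 0 w)) ^ 2)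
    (fun t => (hY.integrable_mul J B t).aestronglyMeasurable) (fun t => ?_)
    (hY.integrable.const_mul _) (ae_of_all _ fun w => ?_)
  · filter_upwards [hY.normSq_eq] with w hw
    exact abs_quad_mul_quad_le J B (hw t)
  · exact continuous_const.mul ((contDiff_quad Z B).continuous.comp (hY.continuous w))

omit [IsProbabilityMeasure ℙ] [FiniteDimensional ℝ P] in
theorem ConservesEnergy.exists_corr_le (J B : Matrix ι ι ℝ) :
    ∃ K, ∀ t, |corr Z ℙ Y J B t| ≤ K := by
  refine ⟨∫ w, quadBound J * quadBound B * (Z (Y 0 w) ⬝ᵥ Z (Y 0 w)) ^ 2 ∂ℙ, fun t => ?_⟩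
  refine (abs_integral_le_integral_abs).trans
    (integral_mono_ae (hY.integrable_mul J B t).abs (hY.integrable.const_mul _) ?_)
  filter_upwards [hY.normSq_eq] with w hw
  exact abs_quad_mul_quad_le J B (hw t)

omit [IsProbabilityMeasure ℙ] [FiniteDimensional ℝ P] in
theorem ConservesEnergy.corr_sub (J B C : Matrix ι ι ℝ) (lam : ℝ) (t : ℝ≥0) :
    corr Z ℙ Y J (lam • B - C) t = lam * corr Z ℙ Y J B t - corr Z ℙ Y J C t := by
  simp only [corr]
  rw [← integral_const_mul, ← integral_sub ((hY.integrable_mul J B t).const_mul lam)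
    (hY.integrable_mul J C t)]
  congr 1
  funext w
  rw [quad_sub, quad_smul]
  ring

omit [IsProbabilityMeasure ℙ] [FiniteDimensional ℝ P] in
theorem ConservesEnergy.integrable_uncurry (J B : Matrix ι ι ℝ) (t : ℝ) :
    Integrable (fun p : Ω × ℝ => quad Z J (Y 0 p.1) * quad Z B (Y p.2.toNNReal p.1))
      (ℙ.prod (volume.restrict (Set.Ioc 0 t))) := by
  have hm : Measurable fun p : Ω × ℝ => Y p.2.toNNReal p.1 :=
    (measurable_uncurry_of_continuous_of_measurable hY.continuous hY.measurable).comp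
      ((measurable_real_toNNReal.comp measurable_snd).prodMk measurable_fst)
  refine ((hY.integrable.const_mul (quadBound J * quadBound B)).comp_fst _).mono'
    ((((measurable_quad Z J).comp (hY.measurable 0)).comp measurable_fst).mul
      ((measurable_quad Z B).comp hm)).aestronglyMeasurable ?_
  have := Measure.quasiMeasurePreserving_fst (μ := ℙ) (ν := volume.restrict (Set.Ioc 0 t)) |>.ae
    hY.normSq_eq
  filter_upwards [this] with p hp
  exact abs_quad_mul_quad_le J B (hp _)

omit [FiniteDimensional ℝ P] in
theorem ConservesEnergy.integral_mul_integral (J B : Matrix ι ι ℝ) (t : ℝ≥0) :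
    Integrable (fun w => quad Z J (Y 0 w) * ∫ r in (0 : ℝ)..t, quad Z B (Y r.toNNReal w)) ℙ ∧
    ∫ w, quad Z J (Y 0 w) * (∫ r in (0 : ℝ)..t, quad Z B (Y r.toNNReal w)) ∂ℙ
      = ∫ r in (0 : ℝ)..t, corr Z ℙ Y J B r.toNNReal := by
  have h0 : (0 : ℝ) ≤ t := t.2
  have h := hY.integrable_uncurry J B t
  simp only [intervalIntegral.integral_of_le h0, ← integral_const_mul]
  exact ⟨h.integral_prod_left, integral_integral_swap h⟩

variable {MA : Matrix ι ι ℝ} {MX : β → Matrix ι ι ℝ}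

/-- Dynkin's formula for an unbounded function. It holds for the damped function, and by
conservation of energy the damping depends only on the initial state, where a weight on energy
shells undoes it. -/
theorem ConservesEnergy.corr_eq (hYs : SolvesFromStart κ s A X ℙ Y)
    (hA : ∀ ω, Z (A ω) = MA.mulVec (Z ω)) (hX : ∀ b ω, Z (X b ω) = (MX b).mulVec (Z ω))
    (hMA : MA.transpose = -MA) (hMX : ∀ b, (MX b).transpose = -MX b) (J B : Matrix ι ι ℝ)
    (t : ℝ≥0) :
    corr Z ℙ Y J B t = corr Z ℙ Y J B 0
      + ∫ r in (0 : ℝ)..t, corr Z ℙ Y J (genMat κ s MA MX B) r.toNNReal := by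
  set C := genMat κ s MA MX B with hC
  set R : Ω → ℝ := fun w => quad Z B (Y t w) - quad Z B (Y 0 w)
    - ∫ r in (0 : ℝ)..t, quad Z C (Y r.toNNReal w) with hR
  have hgen := genD_dampedQuad (κ := κ) (s := s) hA hX hMA hMX
  have hcE : Continuous fun ω : P => Z ω ⬝ᵥ Z ω := (contDiff_normSq Z).continuous
  obtain ⟨hi, hint⟩ := hY.integral_mul_integral J C t
  have hJR : ∀ w, quad Z J (Y 0 w) * R w = quad Z J (Y 0 w) * quad Z B (Y t w)
      - quad Z J (Y 0 w) * quad Z B (Y 0 w)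
      - quad Z J (Y 0 w) * ∫ r in (0 : ℝ)..t, quad Z C (Y r.toNNReal w) := fun w => by
    rw [hR]; ring
  have hRi : Integrable (fun w => quad Z J (Y 0 w) * R w) ℙ := by
    simp only [hJR]
    exact ((hY.integrable_mul J B t).sub (hY.integrable_mul J B 0)).sub hi
  -- the compensated increments vanish on bounded energy shells
  have hn : ∀ n : ℕ, ∫ w, {w | Z (Y 0 w) ⬝ᵥ Z (Y 0 w) ≤ n}.indicator
      (fun w => quad Z J (Y 0 w) * R w) w ∂ℙ = 0 := by
    intro n
    -- The exponential weight cancels the damping, and the truncation keeps the weight bounded.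
    set h : P → ℝ := {ω : P | Z ω ⬝ᵥ Z ω ≤ n}.indicator
      (fun ω => Real.exp (Z ω ⬝ᵥ Z ω) * quad Z J ω) with hh
    have hhm : Measurable h := Measurable.indicator
      ((Real.measurable_exp.comp hcE.measurable).mul (measurable_quad Z J))
      (measurableSet_le hcE.measurable measurable_const)
    have hhb : ∀ ω, |h ω| ≤ Real.exp n * (quadBound J * n) := by
      intro ω
      by_cases hω : Z ω ⬝ᵥ Z ω ≤ n
      · rw [hh, Set.indicator_of_mem (by exact hω), abs_mul, abs_of_pos (Real.exp_pos _)]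
        exact mul_le_mul (Real.exp_le_exp.2 hω) ((abs_quad_le Z J ω).trans
          (mul_le_mul_of_nonneg_left hω (quadBound_nonneg J))) (abs_nonneg _) (Real.exp_pos _).le
      · rw [hh, Set.indicator_of_notMem (by exact hω), abs_zero]
        exact mul_nonneg (Real.exp_pos _).le (mul_nonneg (quadBound_nonneg J) n.cast_nonneg)
    have h1 := hYs.integral_eq_zero_of_bounded (contDiff_dampedQuad Z B) (abs_dampedQuad_le Z B)
      (fun b => ⟨quadBound (comm B (MX b)), fun ω => by
        rw [dirD_dampedQuad (hX b) (hMX b)]; exact abs_dampedQuad_le Z _ ω⟩)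
      (K' := quadBound C) (fun ω => by rw [hgen]; exact abs_dampedQuad_le Z _ ω) t hhm hhb
    rw [hgen] at h1
    rw [← h1]
    refine integral_congr_ae ?_
    filter_upwards [hY.normSq_eq] with w hw
    have h2 : compensated (dampedQuad Z B) (dampedQuad Z C) Y t w
        = R w * Real.exp (-(Z (Y 0 w) ⬝ᵥ Z (Y 0 w))) := by
      simp only [compensated, dampedQuad, hw, hR, intervalIntegral.integral_mul_const, sub_mul]
    rw [h2]
    by_cases hω : Z (Y 0 w) ⬝ᵥ Z (Y 0 w) ≤ n
    · rw [hh, Set.indicator_of_mem (by exact hω), Set.indicator_of_mem (by exact hω)]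
      have h3 : Real.exp (-(Z (Y 0 w) ⬝ᵥ Z (Y 0 w))) * Real.exp (Z (Y 0 w) ⬝ᵥ Z (Y 0 w)) = 1 := by
        rw [← Real.exp_add]; simp
      linear_combination (-quad Z J (Y 0 w) * R w) * h3
    · rw [hh, Set.indicator_of_notMem (by exact hω), Set.indicator_of_notMem (by exact hω),
        mul_zero]
  have hzero : ∫ w, quad Z J (Y 0 w) * R w ∂ℙ = 0 := by
    have hlim : Tendsto (fun n : ℕ => ∫ w, {w | Z (Y 0 w) ⬝ᵥ Z (Y 0 w) ≤ n}.indicator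
      (fun w => quad Z J (Y 0 w) * R w) w ∂ℙ) atTop (𝓝 (∫ w, quad Z J (Y 0 w) * R w ∂ℙ)) := by
      refine tendsto_integral_of_dominated_convergence (fun w => |quad Z J (Y 0 w) * R w|)
        (fun n => hRi.aestronglyMeasurable.indicator (measurableSet_le
          (hcE.measurable.comp (hY.measurable 0)) measurable_const)) hRi.abs
        (fun n => ae_of_all _ fun w => norm_indicator_le_norm_self _ _) (ae_of_all _ fun w => ?_)
      refine tendsto_const_nhds.congr' ?_
      obtain ⟨N, hN⟩ := exists_nat_ge (Z (Y 0 w) ⬝ᵥ Z (Y 0 w))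
      filter_upwards [eventually_ge_atTop N] with n hNn
      have hmem : w ∈ {w | Z (Y 0 w) ⬝ᵥ Z (Y 0 w) ≤ (n : ℝ)} :=
        hN.trans (by exact_mod_cast hNn)
      rw [Set.indicator_of_mem hmem]
    simp only [hn] at hlim
    exact tendsto_nhds_unique hlim tendsto_const_nhds
  simp only [hJR] at hzero
  have hi' : Integrable (fun w => quad Z J (Y 0 w) * quad Z B (Y t w)
      - quad Z J (Y 0 w) * quad Z B (Y 0 w)) ℙ :=
    (hY.integrable_mul J B t).sub (hY.integrable_mul J B 0)
  rw [integral_sub hi' hi,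
    integral_sub (hY.integrable_mul J B t) (hY.integrable_mul J B 0), hint] at hzero
  simp only [corr] at hzero ⊢
  linarith

/-- The Laplace transform of the correlations, expressed by the resolvent. -/
theorem ConservesEnergy.laplace_corr (hYs : SolvesFromStart κ s A X ℙ Y)
    (hA : ∀ ω, Z (A ω) = MA.mulVec (Z ω)) (hX : ∀ b ω, Z (X b ω) = (MX b).mulVec (Z ω))
    (hMA : MA.transpose = -MA) (hMX : ∀ b, (MX b).transpose = -MX b) {J u : Matrix ι ι ℝ}
    {lam : ℝ} (hlam : 0 < lam) (hu : lam • u - genMat κ s MA MX u = J) :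
    IntegrableOn (fun t : ℝ => Real.exp (-lam * t) * corr Z ℙ Y J J t.toNNReal) (Set.Ioi 0) ∧
    ∫ t in Set.Ioi (0 : ℝ), Real.exp (-lam * t) * corr Z ℙ Y J J t.toNNReal
      = corr Z ℙ Y J u 0 := by
  have hcont : ∀ B, Continuous fun t : ℝ => corr Z ℙ Y J B t.toNNReal := fun B =>
    (hY.continuous_corr J B).comp continuous_real_toNNReal
  obtain ⟨K, hK⟩ := hY.exists_corr_le J J
  obtain ⟨K', hK'⟩ := hY.exists_corr_le J u
  have hexp : IntegrableOn (fun t : ℝ => Real.exp (-lam * t)) (Set.Ioi 0) :=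
    exp_neg_integrableOn_Ioi 0 hlam
  have hint : IntegrableOn (fun t : ℝ => Real.exp (-lam * t) * corr Z ℙ Y J J t.toNNReal)
      (Set.Ioi 0) := by
    refine (hexp.mul_const K).mono' (((Real.continuous_exp.comp
      (continuous_const.mul continuous_id)).mul (hcont J)).aestronglyMeasurable) ?_
    refine ae_of_all _ fun t => ?_
    rw [Real.norm_eq_abs, abs_mul, abs_of_pos (Real.exp_pos _)]
    exact mul_le_mul_of_nonneg_left (hK _) (Real.exp_pos _).le
  refine ⟨hint, ?_⟩
  -- Because `lam • u` minus the generator at `u` equals `J`, the integrand has an explicit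
  -- primitive vanishing at infinity.
  have hder : ∀ t ∈ Set.Ioi (0 : ℝ), HasDerivAt
      (fun t : ℝ => -(Real.exp (-lam * t) * corr Z ℙ Y J u t.toNNReal))
      (Real.exp (-lam * t) * corr Z ℙ Y J J t.toNNReal) t := by
    intro t ht
    set C := genMat κ s MA MX u
    have h1 : HasDerivAt (fun t : ℝ => corr Z ℙ Y J u 0
        + ∫ r in (0 : ℝ)..t, corr Z ℙ Y J C r.toNNReal) (corr Z ℙ Y J C t.toNNReal) t :=
      ((hcont C).integral_hasStrictDerivAt 0 t).hasDerivAt.const_add _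
    have h2 : HasDerivAt (fun t : ℝ => corr Z ℙ Y J u t.toNNReal) (corr Z ℙ Y J C t.toNNReal) t := by
      refine h1.congr_of_eventuallyEq ?_
      filter_upwards [Ioi_mem_nhds ht] with r hr
      rw [hY.corr_eq hYs hA hX hMA hMX J u r.toNNReal, Real.coe_toNNReal _ (le_of_lt hr)]
    have h3 : HasDerivAt (fun t : ℝ => Real.exp (-lam * t)) (Real.exp (-lam * t) * -lam) t := by
      refine (((hasDerivAt_id' t).const_mul (-lam)).exp).congr_deriv ?_
      ring
    refine ((h3.mul h2).neg).congr_deriv ?_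
    rw [← hu, hY.corr_sub]
    ring
  have hlim : Tendsto (fun t : ℝ => -(Real.exp (-lam * t) * corr Z ℙ Y J u t.toNNReal)) atTop
      (𝓝 0) := by
    have h1 : Tendsto (fun t : ℝ => Real.exp (-lam * t)) atTop (𝓝 0) :=
      Real.tendsto_exp_atBot.comp
        ((tendsto_const_mul_atBot_of_neg (neg_lt_zero.2 hlam)).2 tendsto_id)
    have h2 := h1.mul_const K'
    rw [zero_mul] at h2
    refine squeeze_zero_norm (fun t => ?_) h2
    rw [norm_neg, Real.norm_eq_abs, abs_mul, abs_of_pos (Real.exp_pos _)]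
    exact mul_le_mul_of_nonneg_left (hK' _) (Real.exp_pos _).le
  have hc0 : Continuous fun t : ℝ => -(Real.exp (-lam * t) * corr Z ℙ Y J u t.toNNReal) :=
    ((Real.continuous_exp.comp (continuous_const.mul continuous_id)).mul (hcont u)).neg
  rw [integral_Ioi_of_hasDerivAt_of_tendsto hc0.continuousWithinAt hder hint hlim]
  simp

end Correlations

/-! ### Consequences of the Gaussian initial law. -/

section Equilibrium

variable {P β : Type*} [NormedAddCommGroup P] [NormedSpace ℝ P] [FiniteDimensional ℝ P]
  [MeasurableSpace P] [BorelSpace P]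
  {Ω : Type*} [MeasurableSpace Ω]
  {κ : ℝ} {s : Finset β} {A : P →L[ℝ] P} {X : β → P →L[ℝ] P} {ℙ : Measure Ω}
  [IsProbabilityMeasure ℙ] {Y : ℝ≥0 → Ω → P}
  {ι : Type*} [Fintype ι] [DecidableEq ι] {Z : P →L[ℝ] (ι → ℝ)}
  {MA : Matrix ι ι ℝ} {MX : β → Matrix ι ι ℝ}

theorem SolvesFromStart.conservesEnergy {v : ℝ≥0} (hYs : SolvesFromStart κ s A X ℙ Y)
    (hA : ∀ ω, Z (A ω) = MA.mulVec (Z ω)) (hX : ∀ b ω, Z (X b ω) = (MX b).mulVec (Z ω))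
    (hMA : MA.transpose = -MA) (hMX : ∀ b, (MX b).transpose = -MX b)
    (hlaw : ℙ.map (fun w => Z (Y 0 w)) = gaussianPi ι v) : ConservesEnergy Z ℙ Y where
  measurable := hYs.measurable
  continuous := hYs.continuous
  normSq_eq := hYs.ae_normSq_eq hA hX hMA hMX
  integrable := by
    have h := integrable_mulVec_mul (ι := ι) v 1 1
    have hm : Measurable fun w => Z (Y 0 w) := Z.continuous.measurable.comp (hYs.measurable 0)
    rw [← hlaw] at h
    have h1 := h.comp_measurable hm
    simpa [Function.comp_def, sq] using h1

omit [FiniteDimensional ℝ P] [IsProbabilityMeasure ℙ] in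
theorem corr_zero {v : ℝ≥0} (hm : Measurable (Y 0))
    (hlaw : ℙ.map (fun w => Z (Y 0 w)) = gaussianPi ι v) {J : Matrix ι ι ℝ}
    (hJ : J.transpose = J) (htr : J.trace = 0) (u : Matrix ι ι ℝ) :
    corr Z ℙ Y J u 0 = 2 * (v : ℝ) ^ 2 * frob u J := by
  have hZ : Measurable fun w => Z (Y 0 w) := Z.continuous.measurable.comp hm
  rw [← integral_mulVec_mul v hJ htr, ← hlaw, integral_map hZ.aemeasurable]
  · exact integral_congr_ae (ae_of_all _ fun w => mul_comm _ _)
  · rw [hlaw]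
    exact (integrable_mulVec_mul v u J).aestronglyMeasurable

end Equilibrium

/-! ### Euclidean coordinates for a semidefinite form. -/

section Coordinates

variable {P : Type*} [AddCommGroup P] [Module ℝ P] [FiniteDimensional ℝ P]

/-- A positive semidefinite symmetric bilinear form is the pullback of a Euclidean scalar product
under a surjective linear map. -/
theorem exists_coordinates (B : P →ₗ[ℝ] P →ₗ[ℝ] ℝ) (hs : ∀ x y, B x y = B y x)
    (hp : ∀ x, 0 ≤ B x x) :
    ∃ (ι : Type) (_ : Fintype ι) (_ : DecidableEq ι) (Z : P →ₗ[ℝ] (ι → ℝ)),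
      Function.Surjective Z ∧ ∀ x y, B x y = Z x ⬝ᵥ Z y := by
  classical
  let Q : QuadraticForm ℝ P := LinearMap.BilinMap.toQuadraticMap B
  -- Sylvester's law with weights in `{-1, 0, 1}`. Nonnegativity excludes `-1`, and `Z` keeps the
  -- coordinates of weight one.
  obtain ⟨w, ⟨e⟩⟩ := QuadraticForm.equivalent_signType_weighted_sum_squared Q
  have hQ : ∀ x, B x x = ∑ i, (w i : ℝ) * (e x i * e x i) := by
    intro x
    have h := e.map_app x
    rw [QuadraticMap.weightedSumSquares_apply] at h
    simp only [smul_eq_mul] at h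
    rw [h]
    rfl
  have hw : ∀ i, w i = 0 ∨ w i = 1 := by
    intro i
    have h := hp (e.toLinearEquiv.symm (Pi.single i 1))
    rw [hQ] at h
    have h1 : e (e.toLinearEquiv.symm (Pi.single i 1)) = Pi.single i 1 :=
      e.toLinearEquiv.apply_symm_apply _
    rw [h1] at h
    simp only [Pi.single_apply, mul_ite, mul_one, mul_zero] at h
    simp at h
    cases hwi : w i with
    | zero => exact Or.inl rfl
    | pos => exact Or.inr rfl
    | neg => rw [hwi] at h; norm_num at h
  let Z : P →ₗ[ℝ] ({i // w i = 1} → ℝ) :=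
    (LinearMap.funLeft ℝ ℝ Subtype.val) ∘ₗ e.toLinearEquiv.toLinearMap
  have hZ : ∀ x i, Z x i = e x i.1 := fun _ _ => rfl
  refine ⟨{i // w i = 1}, inferInstance, inferInstance, Z, ?_, ?_⟩
  · exact (LinearMap.funLeft_surjective_of_injective ℝ ℝ _ Subtype.val_injective).comp
      e.toLinearEquiv.surjective
  · have hdiag : ∀ x, B x x = Z x ⬝ᵥ Z x := by
      intro x
      have h := Finset.sum_subtype (F := inferInstance) (p := fun i => w i = 1) (Finset.univ.filter fun i => w i = 1)
        (by simp) fun i => e x i * e x i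
      refine (hQ x).trans (Eq.trans ?_ h)
      rw [Finset.sum_filter]
      refine Finset.sum_congr rfl fun i _ => ?_
      rcases hw i with h | h <;> simp [h]
    intro x y
    have h := hdiag (x + y)
    simp only [map_add, LinearMap.add_apply, add_dotProduct, dotProduct_add] at h
    rw [← hdiag, ← hdiag, hs y x, dotProduct_comm (Z y)] at h
    linarith

variable {ι : Type*} [Fintype ι] {B : P →ₗ[ℝ] P →ₗ[ℝ] ℝ} {Z : P →ₗ[ℝ] (ι → ℝ)}
  (hZ : Function.Surjective Z) (hB : ∀ x y, B x y = Z x ⬝ᵥ Z y)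

omit [FiniteDimensional ℝ P]
include hZ hB

/-- An antisymmetric map preserves the kernel of the form: if `Z x = 0`, moving `A` across gives `Z
(A x)` zero norm. It therefore descends to the image of `Z`. -/
theorem exists_matrix_of_antisymm [DecidableEq ι] {A : P →ₗ[ℝ] P} (hA : ∀ x, B (A x) x = 0) :
    ∃ MA : Matrix ι ι ℝ, MA.transpose = -MA ∧ ∀ x, Z (A x) = MA.mulVec (Z x) := by
  obtain ⟨g, hg⟩ := Z.exists_rightInverse_of_surjective (LinearMap.range_eq_top.2 hZ)
  have hg' : ∀ z, Z (g z) = z := fun z => congrArg (fun f => f z) hg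
  have hA' : ∀ x y, Z (A x) ⬝ᵥ Z y = -(Z x ⬝ᵥ Z (A y)) := by
    intro x y
    have h := hA (x + y)
    have hx := hA x
    have hy := hA y
    rw [hB] at h hx hy
    simp only [map_add, add_dotProduct, dotProduct_add] at h
    rw [hx, hy, dotProduct_comm (Z (A y))] at h
    linarith
  have hfac : ∀ x, Z (A x) = Z (A (g (Z x))) := by
    intro x
    have h1 : Z (x - g (Z x)) = 0 := by rw [map_sub, hg', sub_self]
    have h2 : Z (A (x - g (Z x))) ⬝ᵥ Z (A (x - g (Z x))) = 0 := by
      rw [hA', h1, zero_dotProduct, neg_zero]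
    have h3 : Z (A (x - g (Z x))) = 0 := dotProduct_self_eq_zero.1 h2
    rwa [map_sub, map_sub, sub_eq_zero] at h3
  refine ⟨LinearMap.toMatrix' (Z ∘ₗ A ∘ₗ g), ?_, fun x => ?_⟩
  · ext i j
    have h := hA' (g (Pi.single i 1)) (g (Pi.single j 1))
    rw [hg', hg'] at h
    simp only [dotProduct_single, single_dotProduct, mul_one, one_mul] at h
    simpa [LinearMap.toMatrix'_apply] using h
  · rw [← Matrix.toLin'_apply, Matrix.toLin'_toMatrix']
    exact hfac x

/-- Riesz representation on the quotient by the kernel of `Z`, on which `l` vanishes by the bound.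
Testing the bound on a preimage of `w` gives `|w|⁴ ≤ C |w|²`. -/
theorem exists_dual_vector {l : P →ₗ[ℝ] ℝ} {C : ℝ} (hC : 0 ≤ C) (hl : ∀ x, l x ^ 2 ≤ C * B x x) :
    ∃ w : ι → ℝ, (∀ x, w ⬝ᵥ Z x = l x) ∧ w ⬝ᵥ w ≤ C := by
  classical
  obtain ⟨g, hg⟩ := Z.exists_rightInverse_of_surjective (LinearMap.range_eq_top.2 hZ)
  have hg' : ∀ z, Z (g z) = z := fun z => congrArg (fun f => f z) hg
  have hfac : ∀ x, l (g (Z x)) = l x := by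
    intro x
    have h1 : Z (x - g (Z x)) = 0 := by rw [map_sub, hg', sub_self]
    have h2 := hl (x - g (Z x))
    rw [hB, h1, zero_dotProduct, mul_zero] at h2
    have h3 : l (x - g (Z x)) = 0 := pow_eq_zero_iff two_ne_zero |>.1 (le_antisymm h2 (sq_nonneg _))
    rw [map_sub, sub_eq_zero] at h3
    exact h3.symm
  have hw : ∀ x, (fun i => l (g (Pi.single i 1))) ⬝ᵥ Z x = l x := by
    intro x
    have h1 : Z x = ∑ i, Z x i • (Pi.single i 1 : ι → ℝ) := by
      rw [← pi_eq_sum_univ' (Z x)]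
    rw [← hfac x]
    conv_rhs => rw [h1]
    simp only [map_sum, map_smul, smul_eq_mul, dotProduct]
    exact Finset.sum_congr rfl fun i _ => mul_comm _ _
  set w : ι → ℝ := fun i => l (g (Pi.single i 1)) with hwdef
  refine ⟨w, hw, ?_⟩
  have h1 := hl (g w)
  rw [← hw, hB, hg'] at h1
  rcases (normSq_nonneg w).eq_or_lt with h | h
  · rwa [← h]
  · have h2 : (w ⬝ᵥ w) * (w ⬝ᵥ w) ≤ C * (w ⬝ᵥ w) := by rwa [sq] at h1
    exact le_of_mul_le_mul_right h2 h

end Coordinates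

/-! ### The chain as a system of linear vector fields. -/

section Model

variable {d : ℕ} {N : ℕ+}

theorem single_single_apply (x y : Torus d N) (j k : Fin d) :
    (Pi.single x (Pi.single j 1) : Torus d N → Fin d → ℝ) y k
      = if y = x then if k = j then 1 else 0 else 0 := by
  by_cases h : y = x
  · subst h
    simp [Pi.single_apply]
  · simp [h]

/-- The basis vector of the phase space in the direction of the position coordinate `a`. -/
def dirQ (a : Torus d N × Fin d) : Phase d N := (Pi.single a.1 (Pi.single a.2 1), 0)

/-- The basis vector of the phase space in the direction of the momentum coordinate `a`. -/
def dirP (a : Torus d N × Fin d) : Phase d N := (0, Pi.single a.1 (Pi.single a.2 1))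

theorem phase_eq_sum (ω : Phase d N) :
    ω = ∑ x, ∑ j, (ω.1 x j • dirQ (x, j) + ω.2 x j • dirP (x, j)) := by
  ext x j
  · simp only [Prod.fst_sum, Finset.sum_apply, Prod.fst_add, Prod.smul_fst, Pi.add_apply,
      Pi.smul_apply, dirQ, dirP, single_single_apply, smul_eq_mul, Pi.zero_apply]
    simp
  · simp only [Prod.snd_sum, Finset.sum_apply, Prod.snd_add, Prod.smul_snd, Pi.add_apply,
      Pi.smul_apply, dirQ, dirP, single_single_apply, smul_eq_mul, Pi.zero_apply]
    simp

open Classical in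
/-- The symmetric bilinear form whose diagonal is twice the Hamiltonian. -/
noncomputable def pol (α ν : ℝ) (M : Torus d N → ℝ) : Phase d N →ₗ[ℝ] Phase d N →ₗ[ℝ] ℝ :=
  LinearMap.mk₂ ℝ (fun ω η => ∑ x, ∑ j, (ω.2 x j * η.2 x j / M x + 2 * ν * (ω.1 x j * η.1 x j)
      + ∑ y with Neighbor x y, α * ((ω.1 x j - ω.1 y j) * (η.1 x j - η.1 y j))))
    (fun ω ω' η => by
      simp only [← Finset.sum_add_distrib, Prod.fst_add, Prod.snd_add, Pi.add_apply]
      refine Finset.sum_congr rfl fun x _ => Finset.sum_congr rfl fun j _ => ?_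
      rw [add_add_add_comm, ← Finset.sum_add_distrib]
      congr 1
      · ring
      · exact Finset.sum_congr rfl fun y _ => by ring)
    (fun c ω η => by
      simp only [Prod.smul_fst, Prod.smul_snd, Pi.smul_apply, smul_eq_mul]
      rw [Finset.mul_sum]
      simp only [Finset.mul_sum, mul_add]
      refine Finset.sum_congr rfl fun x _ => Finset.sum_congr rfl fun j _ => ?_
      congr 1
      · ring
      · exact Finset.sum_congr rfl fun y _ => by ring)
    (fun ω η η' => by
      simp only [← Finset.sum_add_distrib, Prod.fst_add, Prod.snd_add, Pi.add_apply]
      refine Finset.sum_congr rfl fun x _ => Finset.sum_congr rfl fun j _ => ?_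
      rw [add_add_add_comm, ← Finset.sum_add_distrib]
      congr 1
      · ring
      · exact Finset.sum_congr rfl fun y _ => by ring)
    (fun c ω η => by
      simp only [Prod.smul_fst, Prod.smul_snd, Pi.smul_apply, smul_eq_mul]
      rw [Finset.mul_sum]
      simp only [Finset.mul_sum, mul_add]
      refine Finset.sum_congr rfl fun x _ => Finset.sum_congr rfl fun j _ => ?_
      congr 1
      · ring
      · exact Finset.sum_congr rfl fun y _ => by ring)

open Classical in
theorem pol_apply (α ν : ℝ) (M : Torus d N → ℝ) (ω η : Phase d N) :
    pol α ν M ω η = ∑ x, ∑ j, (ω.2 x j * η.2 x j / M x + 2 * ν * (ω.1 x j * η.1 x j)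
      + ∑ y with Neighbor x y, α * ((ω.1 x j - ω.1 y j) * (η.1 x j - η.1 y j))) := rfl

theorem pol_comm (α ν : ℝ) (M : Torus d N → ℝ) (ω η : Phase d N) :
    pol α ν M ω η = pol α ν M η ω := by
  simp only [pol_apply, mul_comm]

theorem hamiltonian_eq (α ν : ℝ) (M : Torus d N → ℝ) (ω : Phase d N) :
    hamiltonian α ν M ω = 1 / 2 * pol α ν M ω ω := by
  classical
  rw [pol_apply, hamiltonian, Finset.mul_sum]
  refine Finset.sum_congr rfl fun x _ => ?_
  rw [Finset.sum_comm, Finset.sum_div, Finset.mul_sum, Finset.mul_sum, ← Finset.sum_add_distrib,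
    ← Finset.sum_add_distrib]
  refine Finset.sum_congr rfl fun j _ => ?_
  simp only [interaction, pinning, mul_add, sq]
  congr 1
  rw [show 2 * M x = M x * 2 by ring, ← div_div]
  ring

theorem pol_dirP (α ν : ℝ) (M : Torus d N → ℝ) (ω : Phase d N) (a : Torus d N × Fin d) :
    pol α ν M ω (dirP a) = ω.2 a.1 a.2 / M a.1 := by
  classical
  simp only [pol_apply, dirP, single_single_apply, Pi.zero_apply, mul_ite, mul_one, mul_zero,
    sub_self, Finset.sum_const_zero, add_zero, ite_div, zero_div]
  simp

variable {α ν : ℝ} {M : Torus d N → ℝ}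

theorem pol_term_le (hα : 0 < α) (hν : 0 ≤ ν) (hM : ∀ x, 0 < M x) (ω : Phase d N)
    {x y : Torus d N} (hxy : Neighbor x y) (j : Fin d) :
    α * ((ω.1 x j - ω.1 y j) * (ω.1 x j - ω.1 y j)) ≤ pol α ν M ω ω := by
  classical
  rw [pol_apply]
  have h0 : ∀ x y j, 0 ≤ α * ((ω.1 x j - ω.1 y j) * (ω.1 x j - ω.1 y j)) := fun x y j =>
    mul_nonneg hα.le (mul_self_nonneg _)
  have h1 : ∀ x j, 0 ≤ ω.2 x j * ω.2 x j / M x + 2 * ν * (ω.1 x j * ω.1 x j) := fun x j =>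
    add_nonneg (div_nonneg (mul_self_nonneg _) (hM x).le)
      (mul_nonneg (by positivity) (mul_self_nonneg _))
  have h2 : ∀ x j, 0 ≤ ω.2 x j * ω.2 x j / M x + 2 * ν * (ω.1 x j * ω.1 x j)
      + ∑ y with Neighbor x y, α * ((ω.1 x j - ω.1 y j) * (ω.1 x j - ω.1 y j)) := fun x j =>
    add_nonneg (h1 x j) (Finset.sum_nonneg fun y _ => h0 x y j)
  refine le_trans ?_ (Finset.single_le_sum (fun x _ => Finset.sum_nonneg fun j _ => h2 x j)
    (Finset.mem_univ x))
  refine le_trans ?_ (Finset.single_le_sum (fun j _ => h2 x j) (Finset.mem_univ j))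
  refine le_add_of_nonneg_of_le (h1 x j) ?_
  exact Finset.single_le_sum (f := fun y => α * ((ω.1 x j - ω.1 y j) * (ω.1 x j - ω.1 y j)))
    (fun y _ => h0 x y j) (by simpa using hxy)

theorem pol_self_nonneg (hα : 0 < α) (hν : 0 ≤ ν) (hM : ∀ x, 0 < M x) (ω : Phase d N) :
    0 ≤ pol α ν M ω ω := by
  classical
  rw [pol_apply]
  exact Finset.sum_nonneg fun x _ => Finset.sum_nonneg fun j _ => add_nonneg
    (add_nonneg (div_nonneg (mul_self_nonneg _) (hM x).le)
      (mul_nonneg (by positivity) (mul_self_nonneg _)))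
    (Finset.sum_nonneg fun y _ => mul_nonneg hα.le (mul_self_nonneg _))

theorem neighbor_add_right (e x y : Torus d N) : Neighbor (x + e) (y + e) ↔ Neighbor x y := by
  have h : ∀ (x y : Torus d N) (k : Fin d),
      y + e = x + e + unitVec k ↔ y = x + unitVec k := fun x y k => by
    rw [add_right_comm, add_left_inj]
  simp only [Neighbor, ne_eq, add_left_inj, h]

/-- The configuration of positions translated by `e`. -/
def shiftQ (e : Torus d N) (q : Torus d N → Fin d → ℝ) : Torus d N → Fin d → ℝ := fun x => q (x + e)

theorem pol_shiftQ (e : Torus d N) (q r : Torus d N → Fin d → ℝ) :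
    pol α ν M (shiftQ e q, 0) (shiftQ e r, 0) = pol α ν M (q, 0) (r, 0) := by
  classical
  simp only [pol_apply, Finset.sum_filter, Pi.zero_apply, mul_zero, zero_div, zero_add]
  refine Eq.trans ?_ (Equiv.sum_comp (Equiv.addRight e) _)
  refine Finset.sum_congr rfl fun x _ => Finset.sum_congr rfl fun j _ => ?_
  refine congrArg₂ (· + ·) rfl ?_
  refine Eq.trans ?_ (Equiv.sum_comp (Equiv.addRight e) _)
  refine Finset.sum_congr rfl fun y _ => ?_
  simp only [Equiv.coe_addRight, neighbor_add_right, shiftQ]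

/-- The potential energy is translation invariant, so the shifts by `e` and by `-e` are adjoint to
each other and their difference is antisymmetric. -/
theorem pol_shiftQ_sub (e : Torus d N) (q : Torus d N → Fin d → ℝ) :
    pol α ν M (q, 0) (shiftQ e q - shiftQ (-e) q, 0) = 0 := by
  have h1 : ((shiftQ e q - shiftQ (-e) q, 0) : Phase d N) = (shiftQ e q, 0) - (shiftQ (-e) q, 0) := by
    simp
  have h2 : shiftQ (-e) (shiftQ e q) = q := by
    funext x
    simp [shiftQ]
  have h3 : pol α ν M (q, 0) (shiftQ e q, 0) = pol α ν M (shiftQ (-e) q, 0) (q, 0) := by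
    conv_rhs => rw [← h2]
    rw [pol_shiftQ, h2]
  rw [h1, map_sub, h3, pol_comm, sub_self]

/-- The Hamiltonian vector field. -/
noncomputable def hamField (α ν : ℝ) (M : Torus d N → ℝ) : Phase d N →ₗ[ℝ] Phase d N where
  toFun ω := (fun x j => pol α ν M ω (dirP (x, j)), fun x j => -pol α ν M ω (dirQ (x, j)))
  map_add' ω η := by
    ext x j
    · simp
    · simp only [map_add, LinearMap.add_apply, Prod.snd_add, Pi.add_apply]
      ring
  map_smul' c ω := by
    ext x j <;> simp

theorem hamField_eq_sum (ω : Phase d N) : hamField α ν M ω =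
    ∑ x, ∑ j, (pol α ν M ω (dirP (x, j)) • dirQ (x, j)
      - pol α ν M ω (dirQ (x, j)) • dirP (x, j)) := by
  rw [phase_eq_sum (hamField α ν M ω)]
  refine Finset.sum_congr rfl fun x _ => Finset.sum_congr rfl fun j _ => ?_
  rw [sub_eq_add_neg, ← neg_smul]
  rfl

theorem pol_hamField_self (ω : Phase d N) : pol α ν M (hamField α ν M ω) ω = 0 := by
  rw [pol_comm, hamField_eq_sum]
  simp only [map_sum, map_sub, map_smul, smul_eq_mul]
  refine Finset.sum_eq_zero fun x _ => Finset.sum_eq_zero fun j _ => ?_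
  ring

/-- The rescaled basis vector, dual to the rescaled momentum. -/
noncomputable def dirPi (M : Torus d N → ℝ) (a : Torus d N × Fin d) : Phase d N :=
  √(M a.1) • dirP a

/-- The rescaled momentum as a linear form. -/
noncomputable def rmomLin (M : Torus d N → ℝ) (a : Torus d N × Fin d) : Phase d N →ₗ[ℝ] ℝ where
  toFun ω := rmom M a.1 a.2 ω
  map_add' ω η := by simp [rmom, add_div]
  map_smul' c ω := by simp [rmom, mul_div_assoc]

theorem pol_dirPi (hM : ∀ x, 0 < M x) (ω : Phase d N) (a : Torus d N × Fin d) :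
    pol α ν M ω (dirPi M a) = rmom M a.1 a.2 ω := by
  rw [dirPi, map_smul, pol_dirP, rmom, smul_eq_mul]
  have h := Real.mul_self_sqrt (hM a.1).le
  have h' : √(M a.1) ≠ 0 := (Real.sqrt_pos.2 (hM a.1)).ne'
  have h2 : M a.1 ≠ 0 := (hM a.1).ne'
  field_simp
  rw [sq, h]
  ring

theorem pol_dirPi_dirPi (hM : ∀ x, 0 < M x) (a b : Torus d N × Fin d) :
    pol α ν M (dirPi M a) (dirPi M b) = if a = b then 1 else 0 := by
  rw [pol_dirPi hM]
  simp only [rmom, dirPi, dirP, Prod.smul_snd, Pi.smul_apply, single_single_apply, smul_eq_mul]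
  have h' : ∀ x, √(M x) ≠ 0 := fun x => (Real.sqrt_pos.2 (hM x)).ne'
  by_cases hab : a = b
  · subst hab
    simp [h']
  · have : ¬(b.1 = a.1 ∧ b.2 = a.2) := fun h => hab (Prod.ext h.1.symm h.2.symm)
    rw [if_neg hab]
    split_ifs with h1 h2
    · exact absurd ⟨h1, h2⟩ this
    · simp
    · simp

/-- The vector field of the noise on the bond `(a, b)`. -/
noncomputable def rotField (M : Torus d N → ℝ) (a b : Torus d N × Fin d) :
    Phase d N →ₗ[ℝ] Phase d N :=
  (rmomLin M b).smulRight (dirPi M a) - (rmomLin M a).smulRight (dirPi M b)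

theorem noiseField_eq_dirD (i j : Fin d) (x z : Torus d N) (f : Phase d N → ℝ) :
    noiseField M i j x z f
      = dirD (LinearMap.toContinuousLinearMap (rotField M (x, i) (z, j))) f := by
  funext ω
  have h : LinearMap.toContinuousLinearMap (rotField M (x, i) (z, j)) ω
      = rmom M z j ω • dirPi M (x, i) - rmom M x i ω • dirPi M (z, j) := rfl
  rw [dirD, h]
  simp only [noiseField, map_sub, map_smul, smul_eq_mul, dRmom, dp, dirPi, dirP]

open Classical in
/-- The pairs of momentum coordinates that are coupled by the noise. -/
noncomputable def noisePairs (d : ℕ) (N : ℕ+) :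
    Finset ((Torus d N × Fin d) × (Torus d N × Fin d)) :=
  Finset.univ.filter fun b => Neighbor b.1.1 b.2.1

theorem noise_eq_sum (f : Phase d N → ℝ) (ω : Phase d N) :
    noise M f ω = 1 / 4 * ∑ b ∈ noisePairs d N,
      dirD (LinearMap.toContinuousLinearMap (rotField M b.1 b.2))
        (dirD (LinearMap.toContinuousLinearMap (rotField M b.1 b.2)) f) ω := by
  classical
  rw [noise, noisePairs, Finset.sum_filter]
  simp only [noiseField_eq_dirD, Finset.sum_filter, Fintype.sum_prod_type]
  congr 1
  have h : ∀ G : Fin d → Fin d → Torus d N → Torus d N → ℝ,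
      ∑ i, ∑ j, ∑ x, ∑ z, G i j x z = ∑ x, ∑ i, ∑ z, ∑ j, G i j x z := fun G => by
    rw [Finset.sum_congr rfl fun i _ => Finset.sum_comm, Finset.sum_comm]
    exact Finset.sum_congr rfl fun x _ => Finset.sum_congr rfl fun i _ => Finset.sum_comm
  exact h _

theorem liouville_eq_dirD {ι : Type*} [Fintype ι] {Z : Phase d N →L[ℝ] (ι → ℝ)}
    (hZ : ∀ ω η, pol α ν M ω η = Z ω ⬝ᵥ Z η) (f : Phase d N → ℝ) (ω : Phase d N) :
    liouville α ν M f ω = dirD (LinearMap.toContinuousLinearMap (hamField α ν M)) f ω := by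
  -- The coordinates `Z` serve only to obtain differentiability of the Hamiltonian.
  have hH : ∀ v, fderiv ℝ (hamiltonian α ν M) ω v = pol α ν M ω v := by
    intro v
    have h0 : hamiltonian α ν M = fun ω => 1 / 2 * (Z ω ⬝ᵥ Z ω) :=
      funext fun ω => by rw [hamiltonian_eq, hZ]
    have hd : DifferentiableAt ℝ (hamiltonian α ν M) ω := by
      rw [h0]
      exact ((contDiff_normSq Z).differentiable (by simp) ω).const_mul _
    rw [← hd.lineDeriv_eq_fderiv, lineDeriv]
    have h1 : (fun t : ℝ => hamiltonian α ν M (ω + t • v)) = fun t : ℝ =>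
        1 / 2 * pol α ν M ω ω + t * pol α ν M ω v + t ^ 2 * (1 / 2 * pol α ν M v v) := by
      funext t
      simp only [hamiltonian_eq, map_add, map_smul, LinearMap.add_apply, LinearMap.smul_apply,
        smul_eq_mul, pol_comm α ν M v ω]
      ring
    have h2 : HasDerivAt (fun t : ℝ => 1 / 2 * pol α ν M ω ω + t * pol α ν M ω v
        + t ^ 2 * (1 / 2 * pol α ν M v v)) (pol α ν M ω v) 0 := by
      refine ((((hasDerivAt_id' (0 : ℝ)).mul_const _).const_add _).add
        ((hasDerivAt_pow 2 (0 : ℝ)).mul_const _)).congr_deriv ?_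
      simp
    rw [h1, h2.deriv]
  rw [dirD, LinearMap.coe_toContinuousLinearMap', hamField_eq_sum]
  simp only [liouville, dp, dq, hH, map_sum, map_sub, map_smul, smul_eq_mul]
  rfl

theorem generator_eq_genD {γ : ℝ} {ι : Type*} [Fintype ι] {Z : Phase d N →L[ℝ] (ι → ℝ)}
    (hZ : ∀ ω η, pol α ν M ω η = Z ω ⬝ᵥ Z η) (f : Phase d N → ℝ) :
    generator α ν γ M f = genD (γ / 4) (noisePairs d N)
      (LinearMap.toContinuousLinearMap (hamField α ν M))
      (fun b => LinearMap.toContinuousLinearMap (rotField M b.1 b.2)) f := by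
  funext ω
  rw [generator, genD, liouville_eq_dirD hZ, noise_eq_sum]
  ring

end Model

/-! ### The Gibbs measure is Gaussian in the energy coordinates. -/

section Gibbs

variable {d : ℕ} {N : ℕ+} {α ν : ℝ} {M : Torus d N → ℝ}

open Classical in
/-- The embedding of the free coordinates of the Gibbs measure into the phase space. -/
noncomputable def freeEmb (d : ℕ) (N : ℕ+) (ν : ℝ) :
    (({x : Torus d N // ¬(ν = 0 ∧ x = 0)} → Fin d → ℝ) × (Torus d N → Fin d → ℝ)) →ₗ[ℝ]
      Phase d N where
  toFun f := (fun x => if h : ν = 0 ∧ x = 0 then 0 else f.1 ⟨x, h⟩, f.2)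
  map_add' f g := by
    ext x j
    · by_cases h : ν = 0 ∧ x = 0 <;> simp [h]
    · rfl
  map_smul' c f := by
    ext x j
    · by_cases h : ν = 0 ∧ x = 0 <;> simp [h]
    · rfl

/-- Discarding the pinned site, if there is one, leaves Lebesgue measure on the free coordinates, to
which the transformation rule for Haar measures applies. -/
theorem refMeasure_eq_map (d : ℕ) (N : ℕ+) (ν : ℝ) :
    refMeasure d N ν = Measure.map (freeEmb d N ν) volume := by
  classical
  let E : ({x : Torus d N // ¬(ν = 0 ∧ x = 0)} → Fin d → ℝ) → Torus d N → Fin d → ℝ :=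
    fun f x => if h : ν = 0 ∧ x = 0 then 0 else f ⟨x, h⟩
  have hE : Measurable E := by
    refine measurable_pi_lambda _ fun x => ?_
    by_cases h : ν = 0 ∧ x = 0
    · simp only [E, h, and_self, dif_pos]
      exact measurable_const
    · simp only [E, h, dif_neg, not_false_eq_true]
      exact measurable_pi_apply _
  have hsf : ∀ x : Torus d N, SigmaFinite
      (if ν = 0 ∧ x = 0 then Measure.dirac (0 : Fin d → ℝ) else volume) := fun x => by
    split_ifs <;> infer_instance
  have hpi : (Measure.pi fun x : Torus d N =>
      if ν = 0 ∧ x = 0 then Measure.dirac (0 : Fin d → ℝ) else volume)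
        = Measure.map E volume := by
    refine Measure.pi_eq fun s hs => ?_
    rw [Measure.map_apply hE (MeasurableSet.univ_pi hs),
      ← Fintype.prod_subtype_mul_prod_subtype fun x : Torus d N => ν = 0 ∧ x = 0]
    have h1 : ∀ i : {x : Torus d N // ¬(ν = 0 ∧ x = 0)},
        (if ν = 0 ∧ i.1 = 0 then Measure.dirac (0 : Fin d → ℝ) else volume) (s i.1)
          = volume (s i.1) := fun i => by rw [if_neg i.2]
    have h2 : ∀ i : {x : Torus d N // ν = 0 ∧ x = 0},
        (if ν = 0 ∧ i.1 = 0 then Measure.dirac (0 : Fin d → ℝ) else volume) (s i.1)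
          = (s i.1).indicator 1 0 := fun i => by
      rw [if_pos i.2, Measure.dirac_apply' _ (hs _)]
    rw [Finset.prod_congr rfl fun i _ => h1 i, Finset.prod_congr rfl fun i _ => h2 i,
      ← volume_pi_pi]
    by_cases hz : ∀ i : {x : Torus d N // ν = 0 ∧ x = 0}, (0 : Fin d → ℝ) ∈ s i.1
    · rw [Finset.prod_eq_one fun i _ => by rw [Set.indicator_of_mem (hz i)]; rfl, one_mul]
      congr 1
      ext f
      simp only [Set.mem_preimage, Set.mem_univ_pi]
      constructor
      · intro h i
        have := h i.1
        simpa only [E, dif_neg i.2] using this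
      · intro h x
        by_cases hx : ν = 0 ∧ x = 0
        · simpa only [E, dif_pos hx] using hz ⟨x, hx⟩
        · simpa only [E, dif_neg hx] using h ⟨x, hx⟩
    · push Not at hz
      obtain ⟨i, hi⟩ := hz
      rw [Finset.prod_eq_zero (Finset.mem_univ i) (Set.indicator_of_notMem hi _), zero_mul]
      refine measure_mono_null (t := ∅) (fun f hf => ?_) measure_empty
      have := hf i.1 trivial
      simp only [E, dif_pos i.2] at this
      exact hi this
  have hprod : ⇑(freeEmb d N ν) = Prod.map E id := rfl
  have hvol : (volume : Measure (Torus d N → Fin d → ℝ)) = Measure.map id volume := by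
    rw [Measure.map_id]
  rw [hprod, Measure.volume_eq_prod, ← Measure.map_prod_map _ _ hE measurable_id, ← hvol, ← hpi]
  rw [refMeasure]

variable {ι : Type*} [Fintype ι] {Z : Phase d N →L[ℝ] (ι → ℝ)}
  (hZ : ∀ ω η, pol α ν M ω η = Z ω ⬝ᵥ Z η)

include hZ in
-- Without pinning a common translation has zero energy, so `Z` does not see it.
theorem map_gauge (ω : Phase d N) : Z (gauge ν ω) = Z ω := by
  classical
  by_cases h : ν = 0
  · have h0 : pol α ν M (ω - gauge ν ω) (ω - gauge ν ω) = 0 := by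
      rw [pol_apply]
      simp [gauge, h]
    rw [hZ, dotProduct_self_eq_zero, map_sub, sub_eq_zero] at h0
    exact h0.symm
  · rw [gauge, if_neg h]

include hZ in
theorem surjective_comp_freeEmb (hs : Function.Surjective Z) :
    Function.Surjective ((Z : Phase d N →ₗ[ℝ] (ι → ℝ)) ∘ₗ freeEmb d N ν) := by
  classical
  intro z
  obtain ⟨ω, rfl⟩ := hs z
  refine ⟨(fun x => (gauge ν ω).1 x.1, (gauge ν ω).2), ?_⟩
  rw [← map_gauge hZ ω]
  change Z _ = Z _
  congr 1
  ext x j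
  · by_cases h : ν = 0 ∧ x = 0
    · simp [freeEmb, h, gauge]
    · simp [freeEmb, h]
  · rfl

include hZ in
-- A linear surjection sends Haar measure to a multiple of Haar measure, and the density depends on
-- `Z` only. Total mass one then fixes the constant.
theorem map_gibbs (hs : Function.Surjective Z) {T : ℝ} (hT : 0 < T)
    [IsProbabilityMeasure (gibbs α ν T M)] :
    (gibbs α ν T M).map Z = gaussianPi ι T.toNNReal := by
  have hZm : Measurable Z := Z.continuous.measurable
  have : IsProbabilityMeasure ((gibbs α ν T M).map Z) :=
    Measure.isProbabilityMeasure_map hZm.aemeasurable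
  have hTc : (T.toNNReal : ℝ) = T := Real.coe_toNNReal _ hT.le
  have hv : T.toNNReal ≠ 0 := by simpa using hT
  set g : (ι → ℝ) → ℝ≥0∞ :=
    fun z => ENNReal.ofReal (Real.exp (-(z ⬝ᵥ z) / (2 * T.toNNReal))) with hg
  have hgm : Measurable g := by
    rw [hg]
    unfold dotProduct
    fun_prop
  have hH1 : (volume : Measure ({x : Torus d N // ¬(ν = 0 ∧ x = 0)} → Fin d → ℝ)).IsAddHaarMeasure :=
    Measure.pi.isAddHaarMeasure _
  have hH2 : (volume : Measure (Torus d N → Fin d → ℝ)).IsAddHaarMeasure :=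
    Measure.pi.isAddHaarMeasure _
  have hH : (volume : Measure (({x : Torus d N // ¬(ν = 0 ∧ x = 0)} → Fin d → ℝ) ×
      (Torus d N → Fin d → ℝ))).IsAddHaarMeasure := Measure.prod.instIsAddHaarMeasure _ _
  obtain ⟨c, -, hc⟩ := LinearMap.exists_map_addHaar_eq_smul_addHaar
    ((Z : Phase d N →ₗ[ℝ] (ι → ℝ)) ∘ₗ freeEmb d N ν) volume volume (surjective_comp_freeEmb hZ hs)
  have hemb : Measurable (freeEmb d N ν) :=
    (LinearMap.continuous_of_finiteDimensional _).measurable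
  have hmap : (refMeasure d N ν).map Z = c • volume := by
    rw [refMeasure_eq_map, Measure.map_map hZm hemb, ← hc]
    rfl
  have hdens : (fun ω : Phase d N => ENNReal.ofReal (Real.exp (-hamiltonian α ν M ω / T)))
      = fun ω => g (Z ω) := by
    funext ω
    rw [hg, hamiltonian_eq, hZ, hTc]
    congr 2
    field_simp
  have hwd : ((refMeasure d N ν).withDensity fun ω => g (Z ω)).map Z
      = ((refMeasure d N ν).map Z).withDensity g := by
    ext t ht
    rw [Measure.map_apply hZm ht, withDensity_apply _ (hZm ht), withDensity_apply _ ht,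
      setLIntegral_map ht hgm hZm]
  refine eq_gaussianPi_of_smul hv (c := (∫⁻ ω, g (Z ω) ∂refMeasure d N ν)⁻¹ * c) ?_
  rw [gibbs, hdens, Measure.map_smul, hwd, hmap, withDensity_smul_measure, smul_smul]

end Gibbs

/-! ### From the equilibrium dynamics to the abstract setting. -/

section Dynamics

variable {d : ℕ} {N : ℕ+} {α ν γ T : ℝ} {M : Torus d N → ℝ} {Ω : Type*} [MeasurableSpace Ω]
  {ℙ : Measure Ω} [IsProbabilityMeasure ℙ] {Y : ℝ≥0 → Ω → Phase d N}
  {ι : Type*} [Fintype ι] {Z : Phase d N →L[ℝ] (ι → ℝ)}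
  (hZ : ∀ ω η, pol α ν M ω η = Z ω ⬝ᵥ Z η)

include hZ in
-- The martingale vanishes at time zero, so its conditional expectation given the initial
-- sigma-algebra is zero, and a bounded function of the initial state can be pulled out.
theorem IsEquilibriumDynamics.solvesFromStart (hY : IsEquilibriumDynamics α ν γ T M ℙ Y) :
    SolvesFromStart (γ / 4) (noisePairs d N) (LinearMap.toContinuousLinearMap (hamField α ν M))
      (fun b => LinearMap.toContinuousLinearMap (rotField M b.1 b.2)) ℙ Y where
  measurable := hY.measurable
  continuous := hY.continuous
  integral_eq_zero f hf hfs t h hh hC := by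
    obtain ⟨ℱ, hℱ, hM⟩ := hY.martingale
    obtain ⟨C, hC⟩ := hC
    have hMf := hM f hf hfs
    rw [generator_eq_genD hZ] at hMf
    set g := genD (γ / 4) (noisePairs d N) (LinearMap.toContinuousLinearMap (hamField α ν M))
      (fun b => LinearMap.toContinuousLinearMap (rotField M b.1 b.2)) f
    have h1 : ℙ[compensated f g Y t | ℱ 0] =ᵐ[ℙ] 0 := by
      have h2 := hMf.2 0 t bot_le
      refine h2.trans (ae_of_all _ fun w => ?_)
      simp
    have hint : Integrable (compensated f g Y t) ℙ := hMf.integrable t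
    have hsm : StronglyMeasurable[ℱ 0] fun w => h (Y 0 w) :=
      (hh.comp (hℱ 0)).stronglyMeasurable
    have hprod : Integrable (compensated f g Y t * fun w => h (Y 0 w)) ℙ :=
      hint.mul_bdd (c := C) (hsm.mono (ℱ.le 0)).aestronglyMeasurable (ae_of_all _ fun w => hC _)
    have h3 := condExp_mul_of_stronglyMeasurable_right hsm hprod hint
    have h4 := integral_condExp (μ := ℙ) (m := ℱ 0) (ℱ.le 0)
      (f := compensated f g Y t * fun w => h (Y 0 w))
    have h5 : ∫ w, (ℙ[compensated f g Y t * fun w => h (Y 0 w) | ℱ 0]) w ∂ℙ = 0 := by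
      refine (integral_congr_ae (h3.trans ?_)).trans (integral_zero' Ω ℝ)
      filter_upwards [h1] with w hw
      simp [hw]
    exact h4.symm.trans h5

include hZ in
theorem IsEquilibriumDynamics.map_eq_gaussianPi (hT : 0 < T) (hs : Function.Surjective Z)
    (hY : IsEquilibriumDynamics α ν γ T M ℙ Y) :
    ℙ.map (fun w => Z (Y 0 w)) = gaussianPi ι T.toNNReal := by
  have hgm : Measurable (gauge ν : Phase d N → Phase d N) := by
    unfold gauge
    split_ifs <;> fun_prop
  have hgY : Measurable fun w => gauge ν (Y 0 w) := hgm.comp (hY.measurable 0)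
  have : IsProbabilityMeasure (gibbs α ν T M) := by
    rw [← hY.initial]
    exact Measure.isProbabilityMeasure_map hgY.aemeasurable
  rw [← map_gibbs hZ hs hT, ← hY.initial,
    Measure.map_map Z.continuous.measurable hgY]
  congr 1
  funext w
  exact (map_gauge hZ _).symm

end Dynamics

/-! ### Counting and geometry on the torus. -/

section Torus

variable {d : ℕ} {N : ℕ+}

theorem neighbor_comm (x y : Torus d N) : Neighbor x y ↔ Neighbor y x := by
  simp only [Neighbor, ne_comm (a := x), or_comm (a := y = _)]

open Classical in
theorem card_neighbor_le (x : Torus d N) :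
    (Finset.univ.filter fun y => Neighbor x y).card ≤ 2 * d := by
  have hsub : (Finset.univ.filter fun y => Neighbor x y) ⊆
      (Finset.univ.image fun k : Fin d => x + unitVec k) ∪
        Finset.univ.image fun k : Fin d => x - unitVec k := by
    intro y hy
    obtain ⟨-, k, hk | hk⟩ := (Finset.mem_filter.1 hy).2
    · exact Finset.mem_union_left _ (Finset.mem_image.2 ⟨k, Finset.mem_univ _, hk.symm⟩)
    · exact Finset.mem_union_right _ (Finset.mem_image.2 ⟨k, Finset.mem_univ _, by rw [hk]; simp⟩)
  refine (Finset.card_le_card hsub).trans ((Finset.card_union_le _ _).trans ?_)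
  have h : ∀ f : Fin d → Torus d N, (Finset.univ.image f).card ≤ d := fun f =>
    Finset.card_image_le.trans (by simp)
  have h1 := h fun k => x + unitVec k
  have h2 := h fun k => x - unitVec k
  omega

theorem card_torus : Fintype.card (Torus d N) = (N : ℕ) ^ d := by
  simp [ZMod.card]

open Classical in
theorem card_noisePairs_le : (noisePairs d N).card ≤ (N : ℕ) ^ d * (d * (2 * d * d)) := by
  have h : (noisePairs d N).card = ∑ x : Torus d N, ∑ _i : Fin d,
      (Finset.univ.filter fun y => Neighbor x y).card * d := by
    rw [noisePairs, Finset.card_filter]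
    simp only [Fintype.sum_prod_type, Finset.card_filter, Finset.sum_mul]
    refine Finset.sum_congr rfl fun x _ => Finset.sum_congr rfl fun i _ =>
      Finset.sum_congr rfl fun y _ => ?_
    by_cases hxy : Neighbor x y <;> simp [hxy]
  rw [h]
  calc _ ≤ ∑ _x : Torus d N, ∑ _i : Fin d, 2 * d * d :=
        Finset.sum_le_sum fun x _ => Finset.sum_le_sum fun i _ =>
          Nat.mul_le_mul_right _ (card_neighbor_le x)
    _ = _ := by simp only [Finset.sum_const, Finset.card_univ, card_torus, Fintype.card_fin,
                  smul_eq_mul]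

theorem unitVec_ne_zero (hN : (N : ℕ) ≠ 1) (k : Fin d) : (unitVec k : Torus d N) ≠ 0 := by
  intro h
  have h1 := congrFun h k
  simp only [unitVec, Pi.single_eq_same, Pi.zero_apply] at h1
  exact hN (ZMod.one_eq_zero_iff.1 h1)

theorem unitVec_eq_zero (hN : (N : ℕ) = 1) (k : Fin d) : (unitVec k : Torus d N) = 0 := by
  rw [unitVec, ZMod.one_eq_zero_iff.2 hN, Pi.single_zero]

theorem sub_unitVec_ne (hN : 3 ≤ (N : ℕ)) (k : Fin d) (x : Torus d N) :
    x - unitVec k ≠ x + unitVec k := by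
  intro h
  have h1 := congrFun h k
  simp only [unitVec, Pi.sub_apply, Pi.add_apply, Pi.single_eq_same] at h1
  have h2 : ((2 : ℕ) : ZMod (N : ℕ)) = 0 := by
    push_cast
    linear_combination -h1
  have h3 := Nat.le_of_dvd two_pos ((ZMod.natCast_eq_zero_iff 2 (N : ℕ)).1 h2)
  omega

theorem neighbor_add_unitVec (hN : (N : ℕ) ≠ 1) (k : Fin d) (x : Torus d N) :
    Neighbor x (x + unitVec k) :=
  ⟨fun h => unitVec_ne_zero hN k (by simpa using h), k, Or.inl rfl⟩

variable {α ν : ℝ} {M : Torus d N → ℝ}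

/-- Pinning contributes `2 * ν`. Each of the at most `2 * d` neighbours contributes `α` twice, since
the energy sums over ordered pairs. -/
theorem pol_dirQ_self_le (hα : 0 < α) (a : Torus d N × Fin d) :
    pol α ν M (dirQ a) (dirQ a) ≤ 2 * ν + 4 * d * α := by
  classical
  have hterm : ∀ (x : Torus d N) (j : Fin d),
      (dirQ a).2 x j * (dirQ a).2 x j / M x + 2 * ν * ((dirQ a).1 x j * (dirQ a).1 x j)
        + ∑ y with Neighbor x y, α * (((dirQ a).1 x j - (dirQ a).1 y j) *
          ((dirQ a).1 x j - (dirQ a).1 y j))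
      ≤ if j = a.2 then 2 * ν * (if x = a.1 then 1 else 0) + (∑ y with Neighbor x y,
          α * ((if x = a.1 then 1 else 0) + (if y = a.1 then 1 else 0))) else 0 := by
    intro x j
    simp only [dirQ, single_single_apply, Pi.zero_apply]
    by_cases hj : j = a.2
    · simp only [hj, if_true, mul_zero, zero_div, zero_add]
      refine add_le_add (le_of_eq (by split_ifs <;> simp)) (Finset.sum_le_sum fun y _ => ?_)
      refine mul_le_mul_of_nonneg_left ?_ hα.le
      split_ifs <;> norm_num
    · simp [hj]
  rw [pol_apply]
  refine (Finset.sum_le_sum fun x _ => Finset.sum_le_sum fun j _ => hterm x j).trans ?_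
  have h0 : ∀ g : Torus d N → ℝ, ∑ x, ∑ j, (if j = a.2 then g x else 0) = ∑ x, g x :=
    fun g => Finset.sum_congr rfl fun x _ => by simp
  rw [h0, Finset.sum_add_distrib]
  simp only [← Finset.mul_sum]
  rw [Finset.sum_congr rfl fun x _ => Finset.sum_add_distrib, Finset.sum_add_distrib]
  have h1 : ∑ x : Torus d N, (if x = a.1 then (1 : ℝ) else 0) = 1 := by simp
  have h2 : ∑ x : Torus d N, ∑ _y ∈ Finset.univ.filter (fun y => Neighbor x y),
      (if x = a.1 then (1 : ℝ) else 0) ≤ 2 * d := by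
    simp only [Finset.sum_const, nsmul_eq_mul, mul_ite, mul_one, mul_zero, Finset.sum_ite_eq',
      Finset.mem_univ, if_true]
    exact_mod_cast card_neighbor_le a.1
  have h3 : ∑ x : Torus d N, ∑ y with Neighbor x y, (if y = a.1 then (1 : ℝ) else 0) ≤ 2 * d := by
    have h4 : ∀ x : Torus d N, ∑ y with Neighbor x y, (if y = a.1 then (1 : ℝ) else 0)
        = if Neighbor a.1 x then 1 else 0 := by
      intro x
      rw [Finset.sum_ite_eq']
      simp [neighbor_comm x]
    rw [Finset.sum_congr rfl fun x _ => h4 x, ← Finset.sum_filter, Finset.sum_const, nsmul_eq_mul,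
      mul_one]
    exact_mod_cast card_neighbor_le a.1
  rw [h1, mul_one]
  nlinarith [mul_le_mul_of_nonneg_left h2 hα.le, mul_le_mul_of_nonneg_left h3 hα.le]

end Torus

/-! ### The current, the trial form and its drift. -/

section Current

variable {d : ℕ} [NeZero d] {N : ℕ+} {α ν : ℝ} {M : Torus d N → ℝ}

/-- The symmetric difference of positions in the first direction. -/
def diffLin (a : Torus d N × Fin d) : Phase d N →ₗ[ℝ] ℝ where
  toFun ω := ω.1 (a.1 + unitVec 0) a.2 - ω.1 (a.1 - unitVec 0) a.2
  map_add' ω η := by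
    simp only [Prod.fst_add, Pi.add_apply]
    ring
  map_smul' c ω := by
    simp only [Prod.smul_fst, Pi.smul_apply, smul_eq_mul, RingHom.id_apply]
    ring

theorem diffLin_apply (a : Torus d N × Fin d) (ω : Phase d N) :
    diffLin a ω = ω.1 (a.1 + unitVec 0) a.2 - ω.1 (a.1 - unitVec 0) a.2 := rfl

theorem deriv_interaction (α r : ℝ) : deriv (interaction α) r = 2 * α * r := by
  have h : HasDerivAt (interaction α) (α * (2 * r)) r :=
    ((hasDerivAt_pow 2 r).const_mul α).congr_deriv (by push_cast; ring)
  rw [h.deriv]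
  ring

/-- Summation by parts: collecting the two bonds at each site leaves one momentum times a symmetric
difference of positions. -/
theorem totalCurrent_eq (ω : Phase d N) : totalCurrent α M ω
    = ∑ a : Torus d N × Fin d, (-α / √(M a.1)) * (rmom M a.1 a.2 ω * diffLin a ω) := by
  rw [Fintype.sum_prod_type]
  simp only [totalCurrent, current, deriv_interaction, diffLin_apply]
  have h : ∑ x : Torus d N, ∑ j, -α * (ω.1 (x + unitVec 0) j - ω.1 x j)
      * (rmom M (x + unitVec 0) j ω / √(M (x + unitVec 0)))
      = ∑ x : Torus d N, ∑ j, -α * (ω.1 x j - ω.1 (x - unitVec 0) j) * (rmom M x j ω / √(M x)) := by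
    refine Eq.trans ?_ (Equiv.sum_comp (Equiv.addRight (unitVec 0 : Torus d N)) _)
    simp
  calc _ = ∑ x : Torus d N, ∑ j, -α * (ω.1 (x + unitVec 0) j - ω.1 x j)
      * (rmom M (x + unitVec 0) j ω / √(M (x + unitVec 0)))
      + ∑ x : Torus d N, ∑ j, -α * (ω.1 (x + unitVec 0) j - ω.1 x j) * (rmom M x j ω / √(M x)) := by
        simp only [← Finset.sum_add_distrib, Finset.mul_sum]
        exact Finset.sum_congr rfl fun x _ => Finset.sum_congr rfl fun j _ => by ring
    _ = _ := by
        rw [h]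
        simp only [← Finset.sum_add_distrib]
        exact Finset.sum_congr rfl fun x _ => Finset.sum_congr rfl fun j _ => by ring

/-- The neighbouring momentum coordinate in the first direction. -/
def nextCoord (a : Torus d N × Fin d) : Torus d N × Fin d := (a.1 + unitVec 0, a.2)

omit [NeZero d] in
theorem pol_fst (ω : Phase d N) (h : Torus d N → Fin d → ℝ) :
    pol α ν M ω (h, 0) = pol α ν M (ω.1, 0) (h, 0) := by
  simp [pol_apply]

/-- This is `pol_shiftQ_sub` read as forces against the symmetric gradient. It removes the position
part of the drift of the trial form, a part outside the range of the noise. -/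
theorem sum_hamField_snd_mul_diffLin (ω : Phase d N) :
    ∑ a : Torus d N × Fin d, (hamField α ν M ω).2 a.1 a.2 * diffLin a ω = 0 := by
  have h1 : ((shiftQ (unitVec 0) ω.1 - shiftQ (-unitVec 0) ω.1, 0) : Phase d N)
      = ∑ x, ∑ j, diffLin (x, j) ω • dirQ (x, j) := by
    rw [phase_eq_sum (_, 0)]
    refine Finset.sum_congr rfl fun x _ => Finset.sum_congr rfl fun j _ => ?_
    simp only [Pi.zero_apply, zero_smul, add_zero, diffLin_apply, shiftQ, Pi.sub_apply,
      sub_eq_add_neg]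
  have h2 := pol_shiftQ_sub (α := α) (ν := ν) (M := M) (unitVec 0) ω.1
  rw [← pol_fst, h1] at h2
  simp only [map_sum, map_smul, smul_eq_mul] at h2
  rw [Fintype.sum_prod_type, ← neg_eq_zero, ← h2, ← Finset.sum_neg_distrib]
  refine Finset.sum_congr rfl fun x _ => ?_
  rw [← Finset.sum_neg_distrib]
  refine Finset.sum_congr rfl fun j _ => ?_
  simp only [hamField, LinearMap.coe_mk, AddHom.coe_mk]
  ring

/-- Velocities are `p / M`; shifting the backward term by one site leaves products of neighbouring
momenta, weighted by differences of inverse masses. -/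
theorem sum_diffLin_hamField_mul (ω : Phase d N) :
    ∑ a : Torus d N × Fin d, diffLin a (hamField α ν M ω) * ω.2 a.1 a.2
      = ∑ a : Torus d N × Fin d, (1 / M (nextCoord a).1 - 1 / M a.1)
        * (ω.2 a.1 a.2 * ω.2 (nextCoord a).1 (nextCoord a).2) := by
  simp only [Fintype.sum_prod_type, diffLin_apply, nextCoord]
  have hq : ∀ x j, (hamField α ν M ω).1 x j = ω.2 x j / M x := fun x j =>
    pol_dirP α ν M ω (x, j)
  have h : ∑ x : Torus d N, ∑ j, ω.2 (x - unitVec 0) j / M (x - unitVec 0) * ω.2 x j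
      = ∑ x : Torus d N, ∑ j, ω.2 x j / M x * ω.2 (x + unitVec 0) j := by
    refine (Equiv.sum_comp (Equiv.addRight (unitVec 0 : Torus d N)) _).symm.trans ?_
    simp
  simp only [hq, sub_mul, Finset.sum_sub_distrib]
  rw [h]
  congr 1 <;> exact Finset.sum_congr rfl fun x _ => Finset.sum_congr rfl fun j _ => by ring

omit [NeZero d] in
theorem sqrt_mul_rmom (hM : ∀ x, 0 < M x) (a : Torus d N × Fin d) (ω : Phase d N) :
    √(M a.1) * rmom M a.1 a.2 ω = ω.2 a.1 a.2 := by
  have h' : √(M a.1) ≠ 0 := (Real.sqrt_pos.2 (hM a.1)).ne'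
  rw [rmom]
  field_simp

theorem sum_hamField_cross (hM : ∀ x, 0 < M x) (ω : Phase d N) :
    ∑ a : Torus d N × Fin d, √(M a.1) * (rmom M a.1 a.2 (hamField α ν M ω) * diffLin a ω
        + diffLin a (hamField α ν M ω) * rmom M a.1 a.2 ω)
      = ∑ a : Torus d N × Fin d,
        (√(M a.1) * √(M (nextCoord a).1) * (1 / M (nextCoord a).1 - 1 / M a.1))
          * (rmom M a.1 a.2 ω * rmom M (nextCoord a).1 (nextCoord a).2 ω) := by
  have h1 := sum_hamField_snd_mul_diffLin (α := α) (ν := ν) (M := M) ω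
  have h2 := sum_diffLin_hamField_mul (α := α) (ν := ν) (M := M) ω
  calc _ = ∑ a : Torus d N × Fin d, (hamField α ν M ω).2 a.1 a.2 * diffLin a ω
        + ∑ a : Torus d N × Fin d, diffLin a (hamField α ν M ω) * ω.2 a.1 a.2 := by
        rw [← Finset.sum_add_distrib]
        refine Finset.sum_congr rfl fun a _ => ?_
        rw [← sqrt_mul_rmom hM a ω, ← sqrt_mul_rmom hM a (hamField α ν M ω)]
        ring
    _ = _ := by
        rw [h1, h2, zero_add]
        refine Finset.sum_congr rfl fun a _ => ?_
        rw [← sqrt_mul_rmom hM a ω, ← sqrt_mul_rmom hM (nextCoord a) ω]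
        ring

/-- The difference is split at the middle site, and each of the two bonds is a single term of the
energy form. -/
theorem diffLin_sq_le (hα : 0 < α) (hν : 0 ≤ ν) (hM : ∀ x, 0 < M x) (a : Torus d N × Fin d)
    (ω : Phase d N) : diffLin a ω ^ 2 ≤ 4 / α * pol α ν M ω ω := by
  have hp := pol_self_nonneg hα hν hM ω
  by_cases hN : (N : ℕ) = 1
  · rw [diffLin_apply, unitVec_eq_zero hN]
    simpa using mul_nonneg (div_nonneg zero_le_four hα.le) hp
  · have h1 := pol_term_le hα hν hM ω (neighbor_add_unitVec hN 0 a.1) a.2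
    have h2 := pol_term_le hα hν hM ω (neighbor_add_unitVec hN 0 (a.1 - unitVec 0)) a.2
    rw [sub_add_cancel] at h2
    rw [diffLin_apply, div_mul_eq_mul_div, le_div_iff₀ hα]
    set u := ω.1 (a.1 + unitVec 0) a.2
    set v := ω.1 (a.1 - unitVec 0) a.2
    set t := ω.1 a.1 a.2
    nlinarith [mul_nonneg hα.le (sq_nonneg (u - t - (t - v)))]

theorem diffLin_dirQ (hN : 3 ≤ (N : ℕ)) (a : Torus d N × Fin d) :
    diffLin a (dirQ (nextCoord a)) = 1 := by
  rw [diffLin_apply]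
  simp only [dirQ, nextCoord, single_single_apply, if_true, if_neg (sub_unitVec_ne hN 0 a.1),
    sub_zero]

end Current

/-! ### Identities between quadratic forms and matrices. -/

section MatrixOfCurrent

variable {ι : Type*} [Fintype ι]

theorem eq_of_quadratic_eq {B C : Matrix ι ι ℝ} (hB : B.transpose = B) (hC : C.transpose = C)
    (h : ∀ z, z ⬝ᵥ B.mulVec z = z ⬝ᵥ C.mulVec z) : B = C := by
  classical
  have hB' : ∀ i j, B i j = B j i := fun i j => congrFun (congrFun hB j) i
  have hC' : ∀ i j, C i j = C j i := fun i j => congrFun (congrFun hC j) i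
  ext i j
  have h1 := h (Pi.single i 1 + Pi.single j 1)
  have h2 := h (Pi.single i 1)
  have h3 := h (Pi.single j 1)
  simp only [Matrix.mulVec_add, add_dotProduct, dotProduct_add, Matrix.mulVec_single_one,
    single_one_dotProduct, Matrix.col_apply] at h1 h2 h3
  rw [hB' j i, hC' j i] at h1
  linarith

theorem quadratic_comm {B A : Matrix ι ι ℝ} (hB : B.transpose = B) (hA : A.transpose = -A)
    (z : ι → ℝ) : z ⬝ᵥ (comm B A).mulVec z = 2 * (A.mulVec z ⬝ᵥ B.mulVec z) := by
  have h1 : z ⬝ᵥ A.mulVec (B.mulVec z) = -(A.mulVec z ⬝ᵥ B.mulVec z) := by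
    rw [Matrix.dotProduct_mulVec, ← Matrix.mulVec_transpose, hA, Matrix.neg_mulVec, neg_dotProduct]
  have h2 : z ⬝ᵥ B.mulVec (A.mulVec z) = A.mulVec z ⬝ᵥ B.mulVec z := by
    rw [Matrix.dotProduct_mulVec, ← Matrix.mulVec_transpose, hB, dotProduct_comm]
  rw [comm, Matrix.sub_mulVec, dotProduct_sub, ← Matrix.mulVec_mulVec, ← Matrix.mulVec_mulVec, h1,
    h2]
  ring

theorem comm_transpose {B A : Matrix ι ι ℝ} (hB : B.transpose = B) (hA : A.transpose = -A) :
    (comm B A).transpose = comm B A := by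
  simp only [comm, Matrix.transpose_sub, Matrix.transpose_mul, hB, hA, Matrix.neg_mul,
    Matrix.mul_neg]
  abel

theorem vecMulVec_mulVec_eq (a b z : ι → ℝ) :
    (Matrix.vecMulVec a b).mulVec z = (b ⬝ᵥ z) • a := by
  rw [Matrix.vecMulVec_mulVec]
  ext i
  simp [mul_comm]

theorem two_mul_dotProduct_crossMat {α : Type*} [Fintype α] (e w : α → ι → ℝ) (c : α → ℝ)
    (y z : ι → ℝ) : 2 * (y ⬝ᵥ (crossMat e w c).mulVec z)
      = ∑ a, c a * ((e a ⬝ᵥ y) * (w a ⬝ᵥ z) + (w a ⬝ᵥ y) * (e a ⬝ᵥ z)) := by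
  simp only [crossMat, symProd, Matrix.smul_mulVec, Matrix.sum_mulVec, dotProduct_smul,
    dotProduct_sum, Matrix.add_mulVec, dotProduct_add, vecMulVec_mulVec_eq, smul_eq_mul,
    Finset.mul_sum]
  refine Finset.sum_congr rfl fun a _ => ?_
  rw [dotProduct_comm y, dotProduct_comm y]
  ring

theorem rotMat_mulVec {α : Type*} (e : α → ι → ℝ) (a b : α) (z : ι → ℝ) :
    (rotMat e a b).mulVec z = (e b ⬝ᵥ z) • e a - (e a ⬝ᵥ z) • e b := by
  rw [rotMat, Matrix.sub_mulVec, vecMulVec_mulVec_eq, vecMulVec_mulVec_eq]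

end MatrixOfCurrent

/-! ### The energy coordinates of the chain. -/

section Coordinates

variable {d : ℕ} [NeZero d] {N : ℕ+} {α ν : ℝ} {M : Torus d N → ℝ}

theorem diffLin_dirPi (a b : Torus d N × Fin d) : diffLin a (dirPi M b) = 0 := by
  simp [diffLin_apply, dirPi, dirP]

/-- Coordinates in which the energy is half the squared Euclidean norm, with the matrix of the
Hamiltonian vector field and the vectors that represent the rescaled momenta and the symmetric
differences of the positions. -/
theorem exists_energy_coordinates (hα : 0 < α) (hν : 0 ≤ ν) (hM : ∀ x, 0 < M x) :
    ∃ (ι : Type) (_ : Fintype ι) (_ : DecidableEq ι) (Z : Phase d N →L[ℝ] (ι → ℝ))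
      (A : Matrix ι ι ℝ) (e w : Torus d N × Fin d → ι → ℝ),
      Function.Surjective Z ∧ (∀ ω η, pol α ν M ω η = Z ω ⬝ᵥ Z η) ∧ A.transpose = -A ∧
      (∀ ω, Z (hamField α ν M ω) = A.mulVec (Z ω)) ∧
      (∀ a b, e a ⬝ᵥ e b = if a = b then 1 else 0) ∧ (∀ a b, e a ⬝ᵥ w b = 0) ∧
      (∀ a ω, e a ⬝ᵥ Z ω = rmom M a.1 a.2 ω) ∧ (∀ a ω, w a ⬝ᵥ Z ω = diffLin a ω) ∧
      (∀ a b ω, Z (rotField M a b ω) = (rotMat e a b).mulVec (Z ω)) ∧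
      ∀ a, w a ⬝ᵥ w a ≤ 4 / α := by
  obtain ⟨ι, hι, hι', Z, hs, hZ⟩ := exists_coordinates (pol α ν M) (pol_comm α ν M)
    (pol_self_nonneg hα hν hM)
  obtain ⟨A, hA, hZA⟩ := exists_matrix_of_antisymm hs hZ (A := hamField α ν M) pol_hamField_self
  choose w hw hw' using fun a : Torus d N × Fin d => exists_dual_vector hs hZ
    (l := diffLin a) (C := 4 / α) (by positivity) (diffLin_sq_le hα hν hM a)
  have he : ∀ a ω, Z (dirPi M a) ⬝ᵥ Z ω = rmom M a.1 a.2 ω := fun a ω => by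
    rw [dotProduct_comm, ← hZ, pol_dirPi hM]
  refine ⟨ι, hι, hι', LinearMap.toContinuousLinearMap Z, A, fun a => Z (dirPi M a), w, hs, hZ, hA,
    hZA, fun a b => ?_, fun a b => ?_, he, hw, fun a b ω => ?_, hw'⟩
  · rw [← hZ, pol_dirPi_dirPi hM]
  · rw [dotProduct_comm, hw, diffLin_dirPi]
  · rw [rotMat_mulVec]
    change Z (rmom M b.1 b.2 ω • dirPi M a - rmom M a.1 a.2 ω • dirPi M b) =
      (Z (dirPi M b) ⬝ᵥ Z ω) • Z (dirPi M a) - (Z (dirPi M a) ⬝ᵥ Z ω) • Z (dirPi M b)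
    rw [map_sub, map_smul, map_smul, he, he]

end Coordinates

/-! ### Volume-order bounds uniform in the masses. -/

section Bounds

variable {ι : Type*} [Fintype ι] {d : ℕ} {N : ℕ+} {α mlo mhi : ℝ} {M : Torus d N → ℝ}

/-- A bound, per site of the torus, for the norms of the current and of the trial function. -/
noncomputable def siteBound (d : ℕ) (α mlo mhi : ℝ) : ℝ :=
  d * (4 * α / mlo) + d * (4 * mhi / α) + d * (mhi ^ 2 / mlo ^ 2)
    + d * (2 * d * d) * (8 * mhi / α)

theorem sum_coord_le {f : Torus d N × Fin d → ℝ} {b : ℝ} (h : ∀ a, f a ≤ b) :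
    ∑ a, f a ≤ d * b * ((N : ℕ) : ℝ) ^ d := by
  refine (Finset.sum_le_card_nsmul _ _ b fun a _ => h a).trans (le_of_eq ?_)
  rw [Finset.card_univ, Fintype.card_prod, card_torus, Fintype.card_fin, nsmul_eq_mul]
  push_cast
  ring

theorem sum_noisePairs_le {f : (Torus d N × Fin d) × (Torus d N × Fin d) → ℝ} {b : ℝ} (hb : 0 ≤ b)
    (h : ∀ a, f a ≤ b) :
    ∑ a ∈ noisePairs d N, f a ≤ d * (2 * d * d) * b * ((N : ℕ) : ℝ) ^ d := by
  refine (Finset.sum_le_card_nsmul _ _ b fun a _ => h a).trans ?_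
  rw [nsmul_eq_mul]
  have h1 : ((noisePairs d N).card : ℝ) ≤ ((N : ℕ) : ℝ) ^ d * (d * (2 * d * d)) := by
    exact_mod_cast card_noisePairs_le
  refine (mul_le_mul_of_nonneg_right h1 hb).trans (le_of_eq ?_)
  ring

theorem current_coeff_sq_le (hα : 0 < α) (hlo : 0 < mlo) (hM : ∀ x, M x ∈ Set.Icc mlo mhi)
    {w : ι → ℝ} (hw : w ⬝ᵥ w ≤ 4 / α) (x : Torus d N) :
    (-α / √(M x)) ^ 2 * (w ⬝ᵥ w) ≤ 4 * α / mlo := by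
  have hM0 : 0 < M x := hlo.trans_le (hM x).1
  have h1 : (-α / √(M x)) ^ 2 ≤ α ^ 2 / mlo := by
    rw [div_pow, Real.sq_sqrt hM0.le, neg_sq]
    exact div_le_div_of_nonneg_left (sq_nonneg α) hlo (hM x).1
  calc _ ≤ α ^ 2 / mlo * (4 / α) :=
        mul_le_mul h1 hw (Finset.sum_nonneg fun _ _ => mul_self_nonneg _) (by positivity)
    _ = _ := by field_simp

theorem trial_coeff_sq_le (hlo : 0 < mlo) (hM : ∀ x, M x ∈ Set.Icc mlo mhi)
    {w : ι → ℝ} (hw : w ⬝ᵥ w ≤ 4 / α) (x : Torus d N) :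
    √(M x) ^ 2 * (w ⬝ᵥ w) ≤ 4 * mhi / α := by
  have hM0 : 0 < M x := hlo.trans_le (hM x).1
  rw [Real.sq_sqrt hM0.le]
  calc _ ≤ mhi * (4 / α) :=
        mul_le_mul (hM x).2 hw (Finset.sum_nonneg fun _ _ => mul_self_nonneg _)
          (hM0.le.trans (hM x).2)
    _ = _ := by ring

/-- The square equals `(M x - M y)² / (M x * M y)`. -/
theorem mass_coeff_sq_le (hlo : 0 < mlo) (hM : ∀ x, M x ∈ Set.Icc mlo mhi) (x y : Torus d N) :
    (√(M x) * √(M y) * (1 / M y - 1 / M x)) ^ 2 ≤ mhi ^ 2 / mlo ^ 2 := by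
  have hx : 0 < M x := hlo.trans_le (hM x).1
  have hy : 0 < M y := hlo.trans_le (hM y).1
  have h1 : (√(M x) * √(M y) * (1 / M y - 1 / M x)) ^ 2 = (M x - M y) ^ 2 / (M x * M y) := by
    rw [mul_pow, mul_pow, Real.sq_sqrt hx.le, Real.sq_sqrt hy.le]
    field_simp
  rw [h1]
  refine div_le_div₀ (sq_nonneg _) (sq_le_sq' ?_ ?_) (by positivity) ?_
  · linarith [(hM y).2]
  · linarith [(hM x).2]
  · nlinarith [(hM x).1, (hM y).1]

end Bounds

/-! ### Two-sided bounds in finite volume. -/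

section Dynamics

variable {d : ℕ} [NeZero d] {N : ℕ+} {α ν γ T mlo mhi : ℝ} {M : Torus d N → ℝ}

theorem totalCurrent_eq_zero (hN : (N : ℕ) = 1) (ω : Phase d N) : totalCurrent α M ω = 0 := by
  rw [totalCurrent_eq]
  refine Finset.sum_eq_zero fun a _ => ?_
  rw [diffLin_apply, unitVec_eq_zero hN]
  simp

theorem nextCoord_mem_noisePairs (hN : (N : ℕ) ≠ 1) (a : Torus d N × Fin d) :
    (a, nextCoord a) ∈ noisePairs d N := by
  classical
  exact Finset.mem_filter.2 ⟨Finset.mem_univ _, neighbor_add_unitVec hN 0 a.1⟩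

omit [NeZero d] in
theorem ne_of_mem_noisePairs {b : (Torus d N × Fin d) × (Torus d N × Fin d)}
    (hb : b ∈ noisePairs d N) : b.1 ≠ b.2 := by
  classical
  exact fun h => ((Finset.mem_filter.1 hb).2).1 (congrArg Prod.fst h)

theorem siteBound_pos (hα : 0 < α) (hlo : 0 < mlo) (hhi : mlo ≤ mhi) :
    0 < siteBound d α mlo mhi := by
  have hd : (0 : ℝ) < d := Nat.cast_pos.2 (Nat.pos_of_neZero d)
  have hhi0 : 0 < mhi := hlo.trans_le hhi
  unfold siteBound
  positivity

/-- The lower bound for the Green–Kubo quantity. -/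
noncomputable def greenKuboLower (d : ℕ) (α ν γ T mlo mhi : ℝ) : ℝ :=
  2 * T ^ 2 * (γ / 4 * (α * (d * (1 / (2 * ν + 4 * d * α))) / 2) ^ 2
    / (3 * (2 + (γ / 4) ^ 2) * siteBound d α mlo mhi))

/-- The upper bound for the Green–Kubo quantity. -/
noncomputable def greenKuboUpper (d : ℕ) (α γ T mlo mhi : ℝ) : ℝ :=
  2 * T ^ 2 * (siteBound d α mlo mhi / (γ / 4))

/-- Cauchy–Schwarz against the displacement of the next site alone, on which the symmetric
difference is one. For this the two neighbours must be distinct, whence `3 ≤ N`. -/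
theorem one_div_le_dotProduct_self {ι : Type*} [Fintype ι] {Z : Phase d N →L[ℝ] (ι → ℝ)}
    (hα : 0 < α) (hν : 0 ≤ ν) (hZ : ∀ ω η, pol α ν M ω η = Z ω ⬝ᵥ Z η) (hN : 3 ≤ (N : ℕ))
    {a : Torus d N × Fin d} {w : ι → ℝ} (hw : ∀ ω, w ⬝ᵥ Z ω = diffLin a ω) :
    1 / (2 * ν + 4 * d * α) ≤ w ⬝ᵥ w := by
  have hd : (0 : ℝ) < d := Nat.cast_pos.2 (Nat.pos_of_neZero d)
  have h1 := Finset.sum_mul_sq_le_sq_mul_sq Finset.univ w (Z (dirQ (nextCoord a)))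
  have h2 : ∑ i, w i * Z (dirQ (nextCoord a)) i = 1 := by
    rw [← diffLin_dirQ hN a, ← hw]
    rfl
  have h3 := pol_dirQ_self_le (ν := ν) (M := M) hα (nextCoord a)
  rw [hZ] at h3
  have h4 : 0 ≤ w ⬝ᵥ w := Finset.sum_nonneg fun _ _ => mul_self_nonneg _
  rw [h2] at h1
  simp only [sq] at h1
  change 1 * 1 ≤ (w ⬝ᵥ w) * (Z (dirQ (nextCoord a)) ⬝ᵥ Z (dirQ (nextCoord a))) at h1
  rw [div_le_iff₀ (by positivity)]
  nlinarith [mul_le_mul_of_nonneg_left h3 h4]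

omit [NeZero d] in
theorem le_sum_coord {f : Torus d N × Fin d → ℝ} {b : ℝ} (h : ∀ a, b ≤ f a) :
    d * b * ((N : ℕ) : ℝ) ^ d ≤ ∑ a, f a := by
  refine le_trans (le_of_eq ?_) (Finset.card_nsmul_le_sum _ _ b fun a _ => h a)
  rw [Finset.card_univ, Fintype.card_prod, card_torus, Fintype.card_fin, nsmul_eq_mul]
  push_cast
  ring

variable {Ω : Type*} [MeasurableSpace Ω] {ℙ : Measure Ω} [IsProbabilityMeasure ℙ]
  {Y : ℝ≥0 → Ω → Phase d N}

theorem IsEquilibriumDynamics.greenKubo_bounds (hα : 0 < α) (hν : 0 ≤ ν) (hγ : 0 < γ) (hT : 0 < T)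
    (hlo : 0 < mlo) (hM : ∀ x, M x ∈ Set.Icc mlo mhi)
    (hY : IsEquilibriumDynamics α ν γ T M ℙ Y) {lam : ℝ} (hlam : 0 < lam) :
    (∀ t, Integrable (fun w => totalCurrent α M (Y t w) * totalCurrent α M (Y 0 w)) ℙ) ∧
    IntegrableOn (fun t : ℝ => Real.exp (-lam * t) * (((N : ℕ) : ℝ) ^ d)⁻¹ *
      correlation α M ℙ Y t.toNNReal) (Set.Ioi 0) ∧
    0 ≤ greenKubo α M ℙ Y lam ∧ greenKubo α M ℙ Y lam ≤ greenKuboUpper d α γ T mlo mhi ∧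
    (3 ≤ (N : ℕ) → lam ≤ 1 → greenKuboLower d α ν γ T mlo mhi ≤ greenKubo α M ℙ Y lam) := by
  have hM0 : ∀ x, 0 < M x := fun x => hlo.trans_le (hM x).1
  have hlohi : mlo ≤ mhi := (hM 0).1.trans (hM 0).2
  set K := siteBound d α mlo mhi with hKdef
  have hK : 0 < K := siteBound_pos hα hlo hlohi
  -- On the one-point torus there are no bonds for the noise, but the current vanishes identically.
  by_cases hN : (N : ℕ) = 1
  · have hcorr : ∀ t, correlation α M ℙ Y t = 0 := fun t => by
      simp [correlation, totalCurrent_eq_zero hN]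
    have hG : greenKubo α M ℙ Y lam = 0 := by simp [greenKubo, hcorr]
    refine ⟨fun t => by simp [totalCurrent_eq_zero hN], by simp [hcorr], hG.ge, ?_, fun h => by omega⟩
    rw [hG, greenKuboUpper, ← hKdef]
    positivity
  obtain ⟨ι, _, _, Z, A, e, w, hs, hZ, hA, hZA, he, hew, hrm, hdf, hrot, hw⟩ :=
    exists_energy_coordinates (M := M) hα hν hM0
  set c : Torus d N × Fin d → ℝ := fun a => -α / √(M a.1) with hc
  set c' : Torus d N × Fin d → ℝ := fun a => √(M a.1) with hc'
  set r : Torus d N × Fin d → ℝ := fun a =>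
    √(M a.1) * √(M (nextCoord a).1) * (1 / M (nextCoord a).1 - 1 / M a.1) with hr
  set V : ℝ := ((N : ℕ) : ℝ) ^ d with hVdef
  have hV : 0 < V := pow_pos (Nat.cast_pos.2 N.pos) d
  have hquad : ∀ ω, totalCurrent α M ω = quad Z (crossMat e w c) ω := fun ω => by
    rw [totalCurrent_eq, quad, dotProduct_crossMat_mulVec]
    simp only [hrm, hdf, hc]
  -- The weights `c' = √M` turn rescaled momenta into true momenta, for which the position part of
  -- the drift cancels.
  have hcomm : comm (crossMat e w c') A = crossMat e (fun a => e (nextCoord a)) r := by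
    refine eq_of_quadratic_eq (comm_transpose (crossMat_transpose e w c') hA)
      (crossMat_transpose _ _ _) fun z => ?_
    obtain ⟨ω, rfl⟩ := hs z
    rw [quadratic_comm (crossMat_transpose e w c') hA, two_mul_dotProduct_crossMat, ← hZA,
      dotProduct_crossMat_mulVec]
    simp only [hrm, hdf, hc', hr]
    exact sum_hamField_cross hM0 ω
  have hhi0 : 0 < mhi := hlo.trans_le hlohi
  have hd : (0 : ℝ) < d := Nat.cast_pos.2 (Nat.pos_of_neZero d)
  have hKi : d * (4 * α / mlo) ≤ K ∧ d * (4 * mhi / α) ≤ K ∧ d * (mhi ^ 2 / mlo ^ 2) ≤ K ∧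
      d * (2 * d * d) * (8 * mhi / α) ≤ K := by
    have h1 : 0 ≤ d * (4 * α / mlo) := by positivity
    have h2 : 0 ≤ d * (4 * mhi / α) := by positivity
    have h3 : 0 ≤ d * (mhi ^ 2 / mlo ^ 2) := by positivity
    have h4 : 0 ≤ d * (2 * d * d) * (8 * mhi / α) := by positivity
    rw [hKdef, siteBound]
    refine ⟨?_, ?_, ?_, ?_⟩ <;> linarith
  obtain ⟨u, hu⟩ := exists_resolvent (κ := γ / 4) (by positivity) hlam (noisePairs d N) hA
    (fun b : (Torus d N × Fin d) × (Torus d N × Fin d) => rotMat_transpose e b.1 b.2)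
    (crossMat e w c)
  obtain ⟨hQ0, hQ1, hQ2⟩ := resolvent_bounds (K := K) (V := V) (by positivity) hlam.le hA
    (fun b hb => ne_of_mem_noisePairs hb) (nextCoord_mem_noisePairs hN) hcomm he hew hK.le hV.le
    ((sum_coord_le fun a => current_coeff_sq_le hα hlo hM (hw a) a.1).trans
      (mul_le_mul_of_nonneg_right hKi.1 hV.le))
    ((sum_coord_le fun a => trial_coeff_sq_le hlo hM (hw a) a.1).trans
      (mul_le_mul_of_nonneg_right hKi.2.1 hV.le))
    ((sum_coord_le fun a => mass_coeff_sq_le hlo hM a.1 (nextCoord a).1).trans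
      (mul_le_mul_of_nonneg_right hKi.2.2.1 hV.le))
    ((sum_noisePairs_le (b := 8 * mhi / α) (by positivity) fun b =>
      (add_le_add (trial_coeff_sq_le hlo hM (hw b.1) b.1.1)
        (trial_coeff_sq_le hlo hM (hw b.2) b.2.1)).trans (le_of_eq (by ring))).trans
      (mul_le_mul_of_nonneg_right hKi.2.2.2 hV.le)) hu
  set Q := frob u (crossMat e w c) with hQ
  have hYs := hY.solvesFromStart hZ
  have hlaw := hY.map_eq_gaussianPi hZ hT hs
  have hMX : ∀ b : (Torus d N × Fin d) × (Torus d N × Fin d),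
      (rotMat e b.1 b.2).transpose = -rotMat e b.1 b.2 := fun b => rotMat_transpose e _ _
  have hE := hYs.conservesEnergy hZA (fun b ω => hrot b.1 b.2 ω) hA hMX hlaw
  obtain ⟨hint, hval⟩ := hE.laplace_corr hYs hZA (fun b ω => hrot b.1 b.2 ω) hA hMX hlam hu
  rw [corr_zero (hY.measurable 0) hlaw (crossMat_transpose e w c) (trace_crossMat hew c),
    Real.coe_toNNReal _ hT.le, ← hQ] at hval
  have hcorr : ∀ t, correlation α M ℙ Y t
      = corr Z ℙ Y (crossMat e w c) (crossMat e w c) t := fun t => by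
    simp only [correlation, corr, hquad]
    exact integral_congr_ae (ae_of_all _ fun w => mul_comm _ _)
  have hfun : (fun t : ℝ => Real.exp (-lam * t) * V⁻¹ * correlation α M ℙ Y t.toNNReal)
      = fun t : ℝ => V⁻¹ * (Real.exp (-lam * t)
        * corr Z ℙ Y (crossMat e w c) (crossMat e w c) t.toNNReal) := by
    funext t
    rw [hcorr]
    ring
  have hG : greenKubo α M ℙ Y lam = V⁻¹ * (2 * T ^ 2 * Q) := by
    rw [← hval, ← integral_const_mul, ← hfun]
    rfl
  have hT2 : 0 ≤ 2 * T ^ 2 := by positivity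
  refine ⟨fun t => ?_, ?_, ?_, ?_, fun hN3 hlam1 => ?_⟩
  · simp only [hquad]
    refine (hE.integrable_mul (crossMat e w c) (crossMat e w c) t).congr
      (ae_of_all _ fun w => mul_comm _ _)
  · rw [hfun]
    exact hint.const_mul _
  · rw [hG]
    positivity
  · rw [hG, greenKuboUpper, ← hKdef]
    calc V⁻¹ * (2 * T ^ 2 * Q) ≤ V⁻¹ * (2 * T ^ 2 * (K / (γ / 4) * V)) := by gcongr
      _ = _ := by field_simp
  -- The product `c * c'` is the constant `-α`, so all summands have the same sign and cannot
  -- cancel.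
  · have h1 : frob (crossMat e w c') (crossMat e w c) = -(α / 2 * ∑ a, w a ⬝ᵥ w a) := by
      rw [frob_crossMat he hew, Finset.mul_sum, Finset.mul_sum, ← Finset.sum_neg_distrib]
      refine Finset.sum_congr rfl fun a _ => ?_
      have h : √(M a.1) ≠ 0 := (Real.sqrt_pos.2 (hM0 a.1)).ne'
      simp only [hc, hc']
      field_simp
    have h2 : d * (1 / (2 * ν + 4 * d * α)) * V ≤ ∑ a, w a ⬝ᵥ w a :=
      le_sum_coord fun a => one_div_le_dotProduct_self hα hν hZ hN3 (hdf a)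
    rw [h1, neg_sq] at hQ2
    set b := d * (1 / (2 * ν + 4 * d * α)) with hb
    have hb0 : 0 < b := by positivity
    have h3 : (α * b / 2) ^ 2 * V ^ 2 ≤ (α / 2 * ∑ a, w a ⬝ᵥ w a) ^ 2 := by
      rw [← mul_pow]
      refine pow_le_pow_left₀ (by positivity) ?_ 2
      calc α * b / 2 * V = α / 2 * (b * V) := by ring
        _ ≤ _ := by gcongr
    have h4 : 3 * (lam ^ 2 + 1 + (γ / 4) ^ 2) * K * V * (Q / (γ / 4))
        ≤ 3 * (2 + (γ / 4) ^ 2) * K * V * (Q / (γ / 4)) := by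
      have : lam ^ 2 ≤ 1 := pow_le_one₀ hlam.le hlam1
      gcongr
      linarith
    have h5 := (h3.trans hQ2).trans h4
    rw [hG, greenKuboLower, ← hKdef, ← hb, mul_left_comm V⁻¹]
    refine mul_le_mul_of_nonneg_left ?_ hT2
    rw [div_le_iff₀ (by positivity)]
    -- The squared pairing is of order `V²` and the bound on it is `V * Q`, so `Q / V` stays bounded
    -- below.
    have h6 : V * V * (γ / 4 * (α * b / 2) ^ 2)
        ≤ V * V * (V⁻¹ * Q * (3 * (2 + (γ / 4) ^ 2) * K)) := by
      calc V * V * (γ / 4 * (α * b / 2) ^ 2) = γ / 4 * ((α * b / 2) ^ 2 * V ^ 2) := by ring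
        _ ≤ γ / 4 * (3 * (2 + (γ / 4) ^ 2) * K * V * (Q / (γ / 4))) := by gcongr
        _ = _ := by field_simp
    exact le_of_mul_le_mul_left h6 (mul_pos hV hV)

end Dynamics

theorem greenKuboLower_pos {d : ℕ} [NeZero d] {α ν γ T mlo mhi : ℝ} (hα : 0 < α) (hν : 0 ≤ ν)
    (hγ : 0 < γ) (hT : 0 < T) (hlo : 0 < mlo) (hhi : mlo ≤ mhi) :
    0 < greenKuboLower d α ν γ T mlo mhi := by
  have hd : (0 : ℝ) < d := Nat.cast_pos.2 (Nat.pos_of_neZero d)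
  have h := siteBound_pos (d := d) hα hlo hhi
  unfold greenKuboLower
  positivity

end NoisyChain

/-! ### Passage to the limits. -/

theorem mainTheorem6 (d : ℕ) [NeZero d] (α ν γ T mlo mhi : ℝ) (hα : 0 < α) (hν : 0 ≤ ν)
    (hγ : 0 < γ) (hT : 0 < T) (hmlo : 0 < mlo) :
    ∃ C : ℝ, 0 < C ∧
      ∀ (Pm : Measure ((Fin d → ℤ) → ℝ)) [IsProbabilityMeasure Pm],
        (∀ x, ∀ᵐ m ∂Pm, m x ∈ Set.Icc mlo mhi) →
        ∀ᵐ m ∂Pm,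
          ∀ (Ω : ℕ+ → Type*) [∀ N, MeasurableSpace (Ω N)] (ℙ : ∀ N, Measure (Ω N))
            [∀ N, IsProbabilityMeasure (ℙ N)] (X : ∀ N, ℝ≥0 → Ω N → NoisyChain.Phase d N),
            (∀ N, NoisyChain.IsEquilibriumDynamics α ν γ T (NoisyChain.torusMass N m)
              (ℙ N) (X N)) →
            -- the correlations and their Laplace transforms are well defined
            (∀ (N : ℕ+) (t : ℝ≥0), Integrable (fun ω =>
              NoisyChain.totalCurrent α (NoisyChain.torusMass N m) (X N t ω) *
                NoisyChain.totalCurrent α (NoisyChain.torusMass N m) (X N 0 ω)) (ℙ N)) ∧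
            (∀ (N : ℕ+) (lam : ℝ), 0 < lam → IntegrableOn (fun t : ℝ =>
              Real.exp (-lam * t) * (((N : ℕ) : ℝ) ^ d)⁻¹ *
                NoisyChain.correlation α (NoisyChain.torusMass N m) (ℙ N) (X N) t.toNNReal)
              (Set.Ioi 0)) ∧
            -- uniform boundedness
            (∀ (N : ℕ+) (lam : ℝ), 0 < lam →
              |NoisyChain.greenKubo α (NoisyChain.torusMass N m) (ℙ N) (X N) lam| ≤ C) ∧
            -- the two-sided asymptotic bounds
            ((C⁻¹ : ℝ) : EReal) ≤
              liminf (fun lam : ℝ => liminf (fun N : ℕ+ =>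
                (NoisyChain.greenKubo α (NoisyChain.torusMass N m) (ℙ N) (X N) lam : EReal))
                atTop) (𝓝[>] 0) ∧
            liminf (fun lam : ℝ => liminf (fun N : ℕ+ =>
                (NoisyChain.greenKubo α (NoisyChain.torusMass N m) (ℙ N) (X N) lam : EReal))
                atTop) (𝓝[>] 0) ≤
              limsup (fun lam : ℝ => limsup (fun N : ℕ+ =>
                (NoisyChain.greenKubo α (NoisyChain.torusMass N m) (ℙ N) (X N) lam : EReal))
                atTop) (𝓝[>] 0) ∧
            limsup (fun lam : ℝ => limsup (fun N : ℕ+ =>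
                (NoisyChain.greenKubo α (NoisyChain.torusMass N m) (ℙ N) (X N) lam : EReal))
                atTop) (𝓝[>] 0) ≤ (C : EReal) := by
  have key : ∀ m : (Fin d → ℤ) → ℝ, (∀ x, m x ∈ Set.Icc mlo mhi) → ∀ (N : ℕ+) (x : NoisyChain.Torus d N),
      NoisyChain.torusMass N m x ∈ Set.Icc mlo mhi := fun m hm N x => hm _
  by_cases hhi : mlo ≤ mhi
  -- If `mhi < mlo`, no probability law satisfies the mass bounds and any constant will do.
  swap
  · refine ⟨1, one_pos, fun Pm _ hPm => ?_⟩
    filter_upwards [hPm 0] with m hm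
    exact absurd (hm.1.trans hm.2) hhi
  set L := NoisyChain.greenKuboLower d α ν γ T mlo mhi with hL
  set U := NoisyChain.greenKuboUpper d α γ T mlo mhi with hU
  have hL0 : 0 < L := NoisyChain.greenKuboLower_pos hα hν hγ hT hmlo hhi
  have hC0 : 0 < max U L⁻¹ := lt_max_of_lt_right (inv_pos.2 hL0)
  refine ⟨max U L⁻¹, hC0, fun Pm _ hPm => ?_⟩
  -- The lattice is countable, so almost surely the mass bounds hold at all sites at once; this is
  -- the only use of the randomness.
  filter_upwards [ae_all_iff.2 hPm] with m hm
  intro Ω _ ℙ _ X hX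
  have h := fun (N : ℕ+) (lam : ℝ) (hlam : 0 < lam) =>
    (hX N).greenKubo_bounds hα hν hγ hT hmlo (key m hm N) hlam
  have hub : ∀ (N : ℕ+) (lam : ℝ), 0 < lam →
      NoisyChain.greenKubo α (NoisyChain.torusMass N m) (ℙ N) (X N) lam ≤ max U L⁻¹ :=
    fun N lam hlam => (h N lam hlam).2.2.2.1.trans (le_max_left _ _)
  have hlb : ∀ᶠ lam : ℝ in 𝓝[>] 0, ∀ᶠ N : ℕ+ in atTop,
      (max U L⁻¹)⁻¹ ≤ NoisyChain.greenKubo α (NoisyChain.torusMass N m) (ℙ N) (X N) lam := by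
    -- The lower bound is uniform for `lam ≤ 1` and `3 ≤ N`, so both lower limits inherit it.
    filter_upwards [Ioc_mem_nhdsGT (zero_lt_one' ℝ)] with lam hlam
    filter_upwards [eventually_ge_atTop (3 : ℕ+)] with N hN
    exact (inv_le_of_inv_le₀ hL0 (le_max_right _ _)).trans
      ((h N lam hlam.1).2.2.2.2 (PNat.coe_le_coe 3 N |>.2 hN) hlam.2)
  refine ⟨fun N t => (h N 1 one_pos).1 t, fun N lam hlam => (h N lam hlam).2.1,
    fun N lam hlam => ?_, ?_, ?_, ?_⟩
  · rw [abs_of_nonneg (h N lam hlam).2.2.1]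
    exact hub N lam hlam
  · refine le_liminf_of_le (by isBoundedDefault) ?_
    filter_upwards [hlb] with lam hlam
    refine le_liminf_of_le (by isBoundedDefault) ?_
    filter_upwards [hlam] with N hN
    exact EReal.coe_le_coe hN
  · exact (liminf_le_limsup).trans (limsup_le_limsup (Eventually.of_forall fun lam =>
      liminf_le_limsup))
  · refine limsup_le_of_le (by isBoundedDefault) ?_
    filter_upwards [self_mem_nhdsWithin] with lam hlam
    refine limsup_le_of_le (by isBoundedDefault) (Eventually.of_forall fun N => ?_)
    exact EReal.coe_le_coe (hub N lam hlam)
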